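/- **Notation.** For $|p|,|q|<1$ put $(x;q)=\prod_{r\ge0}(1-xq^r)$, $(x;p,q)=\prod_{r,s\ge0}(1-xp^rq^s)$ and $\Gamma(x)=\Gamma(x;p,q)=\frac{(pq/x;p,q)}{(x;p,q)}$. Several arguments, or a sign $\pm$ in an argument, denote products, e.g. $(az^{\pm1};q)=(az;q)(a/z;q)$. For a set $A\subset\mathbb C\setminus\{0\}$, a contour *separates $A$ from its reciprocals* if it is a piecewise continuously differentiable closed curve that avoids $0$, $A$ and $A^{-1}$, has winding number $1$ around $0$ and around every point of $A$, and winding number $0$ around every point of $A^{-1}$. For $m\ge 0$, $p,q\neq0$ and $t\in\mathbb C^{2m+6}$ with $\prod_r t_r=(pq)^{m+1}$ the renormalized elliptic beta integral is $$E^m(t)=\Bigl(\prod_{0\le r<s\le 2m+5}(t_rt_s;p,q)\Bigr)\frac{(p;p)(q;q)}{2}\int_{\mathcal C}\frac{\prod_{r=0}^{2m+5}\Gamma(t_rz^{\pm1})}{\Gamma(z^{\pm2})}\frac{dz}{2\pi i z},$$ where $\mathcal C$ separates the points $t_rp^jq^k$ ($j,k\ge0$) from their reciprocals, and by analytic continuation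 for those $t$ for which no such contour exists. For nonzero $b,t_1,\dots,t_4,p,q$ with $|p|,|q|<1$ let $$E(b;t;p,q)=\frac{E^5\bigl(t_1,\tfrac{pq}{bt_1},t_2,\tfrac{pq}{bt_2},t_3,\tfrac{pq}{bt_3},t_4,\tfrac{pq}{bt_4},\pm\sqrt b,\pm\sqrt{bq},\pm\sqrt{bp},\pm\sqrt{bpq}\bigr)}{\prod_{r=1}^4\bigl(bt_r^2,\tfrac{p^2q^2}{bt_r^2};p,q\bigr)},$$ again extended holomorphically in $(b,t)$ to the points where the denominator vanishes. **Proposition.** Let $0<|q|<1$ and let $\tau_1,\dots,\tau_4$ be real numbers with $0\le\tau_r\le1$ for $1\le r\le 4$. For all nonzero $b,t_1,\dots,t_4\in\mathbb C$ the limit of $E(b;t_1p^{\tau_1},\dots,t_4p^{\tau_4};p,q)$ as $p\to0$ ($p\in\mathbb C\setminus\{0\}$, principal values of the powers $p^{\tau_r}$) exists, and $$\lim_{p\to0}E(b;t_rp^{\tau_r};p,q)=\prod_{r<s:\,\tau_r=\tau_s=0}(t_rt_s;q)\prod_{r,s:\,\tau_r=0,\tau_s=1}\Bigl(\frac{qt_r}{bt_s};q\Bigr)\prod_{r<s:\,\tau_r=\tau_s=1}\Bigl(\frac{q^2}{b^2t_rt_s};q\Bigr)\frac{(b^2,qb^2;q)}{(b,qb;q)}$$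 $$\times\frac{(q;q)}2\int_{\mathcal C}\frac{(z^{\pm2};q)}{(bz^{\pm2};q)}\prod_{r:\,\tau_r=0}\frac{(bt_rz^{\pm1};q)}{(t_rz^{\pm1};q)}\prod_{r:\,\tau_r=1}\frac{(\frac q{t_r}z^{\pm1};q)}{(\frac q{bt_r}z^{\pm1};q)}\frac{dz}{2\pi iz},$$ where $\mathcal C$ is any contour that separates $A$ from its reciprocals, $A$ being the set of the reciprocals of the zeros in $z$ of $(xz;q)$, for $x=t_r$ with $\tau_r=0$ and for $x=\frac q{bt_r}$ with $\tau_r=1$, and of $(bz^2;q)$. If no such contour exists, the limit equals the analytic continuation in $(b,t)$ of the right-hand side. That is, there is a holomorphic function $F$ on $\{(b,t): b\ne0,\ t_r\neq0\}$ such that $F(b,t)$ is the right-hand side for every $(b,t)$ and every contour $\mathcal C$ as above, such contours exist for a dense set of $(b,t)$, and the limit is $F(b,t)$ for all nonzero $b,t_1,\dots,t_4$. -/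

import Mathlib

open Set Filter Topology

noncomputable section

/-- The infinite `q`-shifted factorial `(x;q) = ∏_{r ≥ 0} (1 - x q^r)`. -/
def qPoch (x q : ℂ) : ℂ := ∏' r : ℕ, (1 - x * q ^ r)

/-- The `p,q`-shifted factorial `(x;p,q) = ∏_{r,s ≥ 0} (1 - x p^r q^s)`. -/
def pqPoch (x p q : ℂ) : ℂ := ∏' i : ℕ × ℕ, (1 - x * p ^ i.1 * q ^ i.2)

/-- The elliptic gamma function `Γ(x;p,q) = (pq/x;p,q) / (x;p,q)`. -/
def ellGamma (x p q : ℂ) : ℂ := pqPoch (p * q / x) p q / pqPoch x p q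

/-- A closed curve `γ : [0,1] → ℂ` that is piecewise continuously differentiable: it is continuous,
closed, and away from finitely many parameters it is `C¹`, with bounded derivative. -/
def IsLoop (γ : ℝ → ℂ) : Prop :=
  ContinuousOn γ (Icc 0 1) ∧ γ 0 = γ 1 ∧
    ∃ (s : Finset ℝ) (M : ℝ), ∀ x ∈ Ioo (0 : ℝ) 1, x ∉ s →
      ContDiffAt ℝ 1 γ x ∧ ‖deriv γ x‖ ≤ M

/-- The contour integral `∫_γ f(z) dz`. -/
def loopIntegral (γ : ℝ → ℂ) (f : ℂ → ℂ) : ℂ :=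
  ∫ x in (0 : ℝ)..1, f (γ x) * deriv γ x

/-- The winding number `(1/2πi) ∫_γ dz/(z-a)` of a closed curve that avoids `a`. -/
def windingNr (γ : ℝ → ℂ) (a : ℂ) : ℂ :=
  loopIntegral γ (fun z => (z - a)⁻¹) / (2 * Real.pi * Complex.I)

/-- The closed curve `γ` goes once around the origin in the positive direction and separates the
points of `A` (which it also encircles once) from their reciprocals (which it does not encircle);
it passes through none of these points. -/
def Separates (γ : ℝ → ℂ) (A : Set ℂ) : Prop :=
  IsLoop γ ∧
    (∀ a, a = 0 ∨ a ∈ A → (∀ x ∈ Icc (0 : ℝ) 1, γ x ≠ a) ∧ windingNr γ a = 1) ∧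
    (∀ a ∈ A, (∀ x ∈ Icc (0 : ℝ) 1, γ x ≠ a⁻¹) ∧ windingNr γ a⁻¹ = 0)

/-- The integral `∫_C f(z) dz/(2πiz)` over a contour `C` that separates `A` from its reciprocals
(the integrands below have no other poles in `ℂ ∖ {0}`, so that the choice of the contour is
immaterial). The value is `0` if there is no such contour. -/
def sepIntegral (A : Set ℂ) (f : ℂ → ℂ) : ℂ :=
  open Classical in
  if h : ∃ γ, Separates γ A then
    loopIntegral h.choose (fun z => f z / (2 * Real.pi * Complex.I * z))
  else 0

/-- The value at `x` of the continuation of a function `f` given on `S`: this is `f x` for `x ∈ S`,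
and the limit of `f y` for `y → x`, `y ∈ S`, otherwise. If `S` is dense and `f` is the restriction
to `S` of a holomorphic function, this is the value of that holomorphic function. -/
def continued {X : Type*} [TopologicalSpace X] (S : Set X) (f : X → ℂ) (x : X) : ℂ :=
  open Classical in
  if x ∈ S then f x else limUnder (𝓝[S] x) f

/-- The points `t_r p^j q^k`. -/
def ellPoles {n : ℕ} (p q : ℂ) (t : Fin n → ℂ) : Set ℂ :=
  {z | ∃ (r : Fin n) (j k : ℕ), z = t r * p ^ j * q ^ k}

/-- The parameters `t` with `∏ t_r = (pq)^{m+1}` for which a contour exists that separates the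
points `t_r p^j q^k` from their reciprocals. -/
def ellGeneric (m : ℕ) (p q : ℂ) : Set (Fin (2 * m + 6) → ℂ) :=
  {t | ∏ r, t r = (p * q) ^ (m + 1) ∧ ∃ γ, Separates γ (ellPoles p q t)}

/-- The renormalized elliptic beta integral as an integral, for parameters for which the contour
exists. -/
def ellBetaIntegral (m : ℕ) (p q : ℂ) (t : Fin (2 * m + 6) → ℂ) : ℂ :=
  (∏ r, ∏ s, if r < s then pqPoch (t r * t s) p q else 1) *
    (qPoch p p * qPoch q q / 2) *
    sepIntegral (ellPoles p q t) (fun z =>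
      (∏ r, ellGamma (t r * z) p q * ellGamma (t r / z) p q) /
        (ellGamma (z ^ 2) p q * ellGamma (1 / z ^ 2) p q))

/-- The renormalized elliptic beta integral `E^m(t)` on `∏ t_r = (pq)^{m+1}`, extended by analytic
continuation to the parameters for which no contour exists. -/
def ellBeta (m : ℕ) (p q : ℂ) (t : Fin (2 * m + 6) → ℂ) : ℂ :=
  continued (ellGeneric m p q) (ellBetaIntegral m p q) t

/-- A square root; below both signs of it always occur together. -/
def csqrt (z : ℂ) : ℂ := z ^ (1 / 2 : ℂ)

/-- The sixteen parameters
`t_r, pq/(b t_r) (1 ≤ r ≤ 4), ±√b, ±√(bq), ±√(bp), ±√(bpq)`. -/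
def ellParams (b : ℂ) (t : Fin 4 → ℂ) (p q : ℂ) : Fin (2 * 5 + 6) → ℂ :=
  ![t 0, p * q / (b * t 0), t 1, p * q / (b * t 1),
    t 2, p * q / (b * t 2), t 3, p * q / (b * t 3),
    csqrt b, -csqrt b, csqrt (b * q), -csqrt (b * q),
    csqrt (b * p), -csqrt (b * p), csqrt (b * p * q), -csqrt (b * p * q)]

/-- The denominator `∏_r (b t_r², p²q²/(b t_r²); p,q)`. -/
def ellDenom (b : ℂ) (t : Fin 4 → ℂ) (p q : ℂ) : ℂ :=
  ∏ r, pqPoch (b * t r ^ 2) p q * pqPoch (p ^ 2 * q ^ 2 / (b * t r ^ 2)) p q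

/-- The elliptic hypergeometric integral `E(b;t;p,q)`, for nonzero `b`, `t_r`, `p` and `q`. It is
the quotient of `E^5` at the sixteen parameters by `ellDenom`, as a holomorphic function of
`(b,t)`: where no contour exists for these parameters, or where the denominator vanishes, the value
is that of the holomorphic continuation in `(b,t)`. -/
def ellE (b : ℂ) (t : Fin 4 → ℂ) (p q : ℂ) : ℂ :=
  continued
    {x : ℂ × (Fin 4 → ℂ) | x.1 ≠ 0 ∧ (∀ r, x.2 r ≠ 0) ∧ ellDenom x.1 x.2 p q ≠ 0 ∧
      ellParams x.1 x.2 p q ∈ ellGeneric 5 p q}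
    (fun x => ellBeta 5 p q (ellParams x.1 x.2 p q) / ellDenom x.1 x.2 p q)
    (b, t)

/-- The reciprocals of the zeros of `(t_r z;q)` (for `τ_r = 0`), of `(qz/(b t_r);q)`
(for `τ_r = 1`) and of `(b z²;q)`. -/
def limPoles (q : ℂ) (τ : Fin 4 → ℝ) (b : ℂ) (t : Fin 4 → ℂ) : Set ℂ :=
  {z | ∃ k : ℕ, (∃ r, τ r = 0 ∧ z = t r * q ^ k) ∨
    (∃ r, τ r = 1 ∧ z = q / (b * t r) * q ^ k) ∨ z ^ 2 = b * q ^ k}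

/-- The prefactor of the limiting integral. -/
def limPrefactor (q : ℂ) (τ : Fin 4 → ℝ) (b : ℂ) (t : Fin 4 → ℂ) : ℂ :=
  (∏ r, ∏ s, if r < s ∧ τ r = 0 ∧ τ s = 0 then qPoch (t r * t s) q else 1) *
  (∏ r, ∏ s, if τ r = 0 ∧ τ s = 1 then qPoch (q * t r / (b * t s)) q else 1) *
  (∏ r, ∏ s, if r < s ∧ τ r = 1 ∧ τ s = 1 then qPoch (q ^ 2 / (b ^ 2 * t r * t s)) q else 1) *
  (qPoch (b ^ 2) q * qPoch (q * b ^ 2) q / (qPoch b q * qPoch (q * b) q))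

/-- The integrand (without `dz/(2πiz)`) of the limiting integral. -/
def limIntegrand (q : ℂ) (τ : Fin 4 → ℝ) (b : ℂ) (t : Fin 4 → ℂ) (z : ℂ) : ℂ :=
  qPoch (z ^ 2) q * qPoch (1 / z ^ 2) q / (qPoch (b * z ^ 2) q * qPoch (b / z ^ 2) q) *
  (∏ r, if τ r = 0 then
      qPoch (b * t r * z) q * qPoch (b * t r / z) q / (qPoch (t r * z) q * qPoch (t r / z) q)
    else 1) *
  (∏ r, if τ r = 1 then
      qPoch (q / t r * z) q * qPoch (q / t r / z) q /
        (qPoch (q / (b * t r) * z) q * qPoch (q / (b * t r) / z) q)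
    else 1)

/-- The limiting expression, with the integral taken over the contour `γ`. -/
def limValue (q : ℂ) (τ : Fin 4 → ℝ) (γ : ℝ → ℂ) (b : ℂ) (t : Fin 4 → ℂ) : ℂ :=
  limPrefactor q τ b t * (qPoch q q / 2) *
    loopIntegral γ (fun z => limIntegrand q τ b t z / (2 * Real.pi * Complex.I * z))

/-- The set of `(b,t)` with `b` and all `t_r` nonzero. -/
def paramDomain : Set (ℂ × (Fin 4 → ℂ)) := {x | x.1 ≠ 0 ∧ ∀ r, x.2 r ≠ 0}

end

/-! Put v_r = pq/(b t_r). By the duplication formula the eight parameters ±√b, …, ±√(bpq) combine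
into products in z², and E becomes a prefactor times the integral of `ellCore`, an expression in
(b,u,v,p) with u = t, in which u, v and p may be treated as independent variables. It is symmetric
under the exchange of u_r and v_r. After the substitution of t_r p^{τ_r} and this exchange at the
indices with τ_r = 1, the point (b,u,v,p) tends to (b, `limParams`, 0, 0). Since (x;p,q) is
holomorphic at p = 0 too, prefactor and integrand specialize there to the limiting ones. So the
limit is the value at a point, provided that the renormalized integral extends holomorphically,
hence continuously, to a neighbourhood of that point. This is `exists_core_extension`.

Where a separating contour exists, it can be kept fixed under small changes of the parameters. The
difficulty lies at parameters that pinch the contour, that is, where two poles have product 1. Near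
the limit point only finitely many poles lie in a given annulus: some u_r q^k with u_r not tending
to 0, and some square roots of b q^k. Thus the integrand there is H(z) / ∏ (1 - a_κ z)(1 - a_κ/z).
Partial fractions in z + 1/z express its integral as a sum of integrals over two fixed circles,
divided by `residueDenom`; for distinct a_κ this is singular only where a_κ a_l = 1. If all a_κ are
scaled by c, the poles in c are simple, and the residues of the terms for κ and l cancel because H
vanishes at the pinching points (`tendsto_sub_mul_sum_residue`, `circlePair_add_circlePair`). That
vanishing is the purpose of the renormalizing prefactor and of the special numerator
(`chainNumerator_eq_zero`). Hence Cauchy's formula in c gives local holomorphic extensions, which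
glue along the dense set of unpinched parameters (`exists_holomorphic_extension`).

The supporting facts are the homological Cauchy theorem (`loopIntegral_eq_of_windingNr_eq`), the
existence of a separating contour whenever no two poles have product 1 (`exists_separates`), and the
density of such parameters. -/

section SeveralVariables

/-! ### Holomorphic functions of several variables -/

variable {E : Type*} [NormedAddCommGroup E] [NormedSpace ℂ E]

theorem DifferentiableAt.complex_div {f g : E → ℂ} {x : E} (hf : DifferentiableAt ℂ f x)
    (hg : DifferentiableAt ℂ g x) (h : g x ≠ 0) : DifferentiableAt ℂ (fun y => f y / g y) x := by
  simp only [div_eq_mul_inv]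
  exact hf.fun_mul ((differentiableAt_inv h).comp x hg)

theorem DifferentiableOn.complex_div {f g : E → ℂ} {Ω : Set E} (hf : DifferentiableOn ℂ f Ω)
    (hg : DifferentiableOn ℂ g Ω) (h : ∀ x ∈ Ω, g x ≠ 0) :
    DifferentiableOn ℂ (fun y => f y / g y) Ω := by
  intro x hx
  simp only [div_eq_mul_inv]
  exact (hf x hx).fun_mul ((differentiableAt_inv (h x hx)).comp_differentiableWithinAt x (hg x hx))

theorem line_differentiableOn {f : E → ℂ} {Ω : Set E} (hf : DifferentiableOn ℂ f Ω)
    (hΩ : IsOpen Ω) (x v : E) :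
    DifferentiableOn ℂ (fun c : ℂ => f (x + c • v)) {c | x + c • v ∈ Ω} := by
  intro c hc
  have h1 : DifferentiableAt ℂ f (x + c • v) := (hf _ hc).differentiableAt (hΩ.mem_nhds hc)
  have h2 : DifferentiableAt ℂ (fun c : ℂ => x + c • v) c := by fun_prop
  exact (h1.comp c h2).differentiableWithinAt

/-- Cauchy's estimate on the complex line through x in direction w, on disks of radius ρ < r/‖w‖,
followed by ρ → r/‖w‖. -/
theorem norm_fderiv_le_of_bound_ball {f : E → ℂ} {x : E} {r M : ℝ} (hr : 0 < r)
    (hf : DifferentiableOn ℂ f (Metric.ball x r)) (hM : ∀ y ∈ Metric.ball x r, ‖f y‖ ≤ M) :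
    ‖fderiv ℂ f x‖ ≤ M / r := by
  have hx : x ∈ Metric.ball x r := Metric.mem_ball_self hr
  have hM0 : 0 ≤ M := (norm_nonneg _).trans (hM x hx)
  refine ContinuousLinearMap.opNorm_le_bound _ (by positivity) fun w => ?_
  rcases eq_or_ne w 0 with rfl | hw
  · simp
  have hw' : 0 < ‖w‖ := norm_pos_iff.2 hw
  have hfx : HasFDerivAt f (fderiv ℂ f x) x :=
    ((hf x hx).differentiableAt (Metric.isOpen_ball.mem_nhds hx)).hasFDerivAt
  have hder : HasDerivAt (fun c : ℂ => f (x + c • w)) (fderiv ℂ f x w) 0 := by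
    have h2 : HasDerivAt (fun c : ℂ => x + c • w) w 0 := by
      simpa using ((hasDerivAt_id (0 : ℂ)).smul_const w).const_add x
    have h1 : HasFDerivAt f (fderiv ℂ f x) (x + (0 : ℂ) • w) := by simpa using hfx
    exact h1.comp_hasDerivAt (0 : ℂ) h2
  have key : ∀ ρ : ℝ, 0 < ρ → ρ < r / ‖w‖ → ‖fderiv ℂ f x w‖ ≤ M / ρ := by
    intro ρ h0 h1
    have hsub : ∀ c ∈ Metric.closedBall (0 : ℂ) ρ, x + c • w ∈ Metric.ball x r := by
      intro c hc
      simp only [mem_closedBall_zero_iff] at hc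
      simp only [Metric.mem_ball, dist_self_add_left, norm_smul]
      calc ‖c‖ * ‖w‖ ≤ ρ * ‖w‖ := by gcongr
        _ < r := by rwa [lt_div_iff₀ hw'] at h1
    rw [← hder.deriv]
    refine Complex.norm_deriv_le_of_forall_mem_sphere_norm_le h0 ?_ ?_
    · apply DifferentiableOn.diffContOnCl_ball (U := {c | x + c • w ∈ Metric.ball x r})
        (line_differentiableOn hf Metric.isOpen_ball x w)
      exact hsub
    · intro z hz
      exact hM _ (hsub z (Metric.sphere_subset_closedBall hz))
  have hlim : Tendsto (fun ρ : ℝ => M / ρ) (𝓝[<] (r / ‖w‖)) (𝓝 (M / (r / ‖w‖))) :=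
    (tendsto_const_nhds.div tendsto_id (by positivity)).mono_left nhdsWithin_le_nhds
  have : ‖fderiv ℂ f x w‖ ≤ M / (r / ‖w‖) := by
    refine ge_of_tendsto hlim ?_
    have hpos : 0 < r / ‖w‖ := by positivity
    filter_upwards [Ioo_mem_nhdsLT hpos] with ρ hρ using key ρ hρ.1 hρ.2
  calc _ ≤ M / (r / ‖w‖) := this
    _ = M / r * ‖w‖ := by field_simp

theorem norm_fderiv_sub_le_of_ball {f g : E → ℂ} {x : E} {r M : ℝ} (hr : 0 < r)
    (hf : DifferentiableOn ℂ f (Metric.ball x r)) (hg : DifferentiableOn ℂ g (Metric.ball x r))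
    (hM : ∀ y ∈ Metric.ball x r, ‖f y - g y‖ ≤ M) :
    ‖fderiv ℂ f x - fderiv ℂ g x‖ ≤ M / r := by
  have hx : Metric.ball x r ∈ 𝓝 x := Metric.ball_mem_nhds x hr
  rw [← fderiv_fun_sub (hf.differentiableAt hx) (hg.differentiableAt hx)]
  exact norm_fderiv_le_of_bound_ball hr (hf.fun_sub hg) hM

/-- Weierstrass' theorem: by Cauchy's estimate, uniform convergence on a ball makes the derivatives
uniformly Cauchy on the ball of half the radius, so that the limit can be differentiated termwise.
-/
theorem differentiableOn_of_tendstoUniformlyOn_nhds {ι : Type*} {l : Filter ι} [NeBot l]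
    {f : ι → E → ℂ} {g : E → ℂ} {Ω : Set E} (hΩ : IsOpen Ω)
    (hf : ∀ n, DifferentiableOn ℂ (f n) Ω)
    (h : ∀ x ∈ Ω, ∃ t ∈ 𝓝 x, TendstoUniformlyOn f g l t) :
    DifferentiableOn ℂ g Ω := by
  intro x hx
  obtain ⟨t, ht, hu⟩ := h x hx
  obtain ⟨δ, hδ, hball⟩ := Metric.mem_nhds_iff.1 (inter_mem ht (hΩ.mem_nhds hx))
  set B := Metric.ball x (δ / 2) with hB
  have hsub : ∀ y ∈ B, Metric.ball y (δ / 2) ⊆ t ∩ Ω := by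
    intro y hy
    refine (Metric.ball_subset_ball' ?_).trans hball
    have : dist y x < δ / 2 := hy
    linarith
  have hBt : B ⊆ t ∩ Ω := fun y hy => hsub y hy (Metric.mem_ball_self (by positivity))
  have hfd : ∀ n, ∀ y ∈ B, DifferentiableOn ℂ (f n) (Metric.ball y (δ / 2)) := fun n y hy =>
    (hf n).mono fun z hz => (hsub y hy hz).2
  have hcauchy : UniformCauchySeqOn (fun n => fderiv ℂ (f n)) l B := by
    intro u hu'
    obtain ⟨ε, hε, hεu⟩ := Metric.mem_uniformity_dist.1 hu'
    filter_upwards [hu.uniformCauchySeqOn _ (Metric.dist_mem_uniformity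
      (show 0 < ε / 2 * (δ / 2) by positivity))] with m hm y hy
    apply hεu
    rw [dist_eq_norm]
    calc _ ≤ ε / 2 * (δ / 2) / (δ / 2) := by
          refine norm_fderiv_sub_le_of_ball (by positivity) (hfd _ y hy) (hfd _ y hy) ?_
          intro z hz
          have := hm z (hsub y hy hz).1
          simp only [dist_eq_norm] at this
          exact this.le
      _ = ε / 2 := by field_simp
      _ < ε := by linarith
  have hlim : ∀ y ∈ B, ∃ g', Tendsto (fun n => fderiv ℂ (f n) y) l (𝓝 g') := fun y hy =>
    CompleteSpace.complete (hcauchy.cauchy_map hy)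
  choose! g' hg' using hlim
  have hx' : x ∈ B := Metric.mem_ball_self (by positivity)
  have := hasFDerivAt_of_tendstoUniformlyOn (f := f) (g := g) Metric.isOpen_ball
    (hcauchy.tendstoUniformlyOn_of_tendsto hg')
    (fun n y hy => ((hf n).differentiableAt (hΩ.mem_nhds (hBt hy).2)).hasFDerivAt)
    (fun y hy => hu.tendsto_at (hBt hy).1) hx'
  exact this.differentiableAt.differentiableWithinAt

/-- Holomorphy in the parameter makes a bound for the derivative unnecessary as a hypothesis, since
Cauchy's estimate supplies one. The factor `m` is kept apart because for a contour it is the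
derivative of the curve, which is only measurable and bounded. -/
theorem differentiableOn_parametric_integral [ProperSpace E] {Ω : Set E} (hΩ : IsOpen Ω)
    {a b : ℝ} (hab : a ≤ b) {g : E → ℝ → ℂ}
    (hc : ContinuousOn (Function.uncurry g) (Ω ×ˢ Icc a b))
    (hd : ∀ θ ∈ Icc a b, DifferentiableOn ℂ (fun x => g x θ) Ω)
    {m : ℝ → ℂ} (hm : Measurable m) {M : ℝ} (hM : ∀ᵐ θ : ℝ, θ ∈ Ioc a b → ‖m θ‖ ≤ M) :
    DifferentiableOn ℂ (fun x => ∫ θ in a..b, g x θ * m θ) Ω := by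
  intro x hx
  obtain ⟨δ, hδ, hball⟩ := Metric.nhds_basis_closedBall.mem_iff.1 (hΩ.mem_nhds hx)
  set r := δ / 2 with hr
  have hr0 : 0 < r := by positivity
  have hsub : ∀ y ∈ Metric.ball x r, Metric.ball y r ⊆ Metric.closedBall x δ := by
    intro y hy
    refine (Metric.ball_subset_ball' ?_).trans Metric.ball_subset_closedBall
    have : dist y x < r := hy
    linarith
  have hK : IsCompact (Metric.closedBall x δ ×ˢ Icc a b) :=
    (isCompact_closedBall x δ).prod isCompact_Icc
  have hcK : ContinuousOn (Function.uncurry g) (Metric.closedBall x δ ×ˢ Icc a b) :=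
    hc.mono (prod_mono hball subset_rfl)
  obtain ⟨C, hC⟩ := hK.exists_bound_of_continuousOn hcK
  have huc := hK.uniformContinuousOn_of_continuous hcK
  have hfd : ∀ θ ∈ Icc a b, ∀ y ∈ Metric.ball x r,
      DifferentiableOn ℂ (fun x => g x θ) (Metric.ball y r) := fun θ hθ y hy =>
    (hd θ hθ).mono ((hsub y hy).trans hball)
  have hslice : ∀ y ∈ Ω, ContinuousOn (fun θ => g y θ) (Icc a b) := fun y hy =>
    hc.comp (f := fun θ => (y, θ)) (by fun_prop) fun θ hθ => ⟨hy, hθ⟩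
  have hmeas : ∀ y ∈ Ω, MeasureTheory.AEStronglyMeasurable (fun θ => g y θ * m θ)
      (MeasureTheory.volume.restrict (Set.uIoc a b)) := by
    intro y hy
    rw [uIoc_of_le hab]
    exact (((hslice y hy).mono Ioc_subset_Icc_self).aestronglyMeasurable measurableSet_Ioc).mul
      hm.aestronglyMeasurable
  have hxr : x ∈ Metric.ball x r := Metric.mem_ball_self hr0
  -- The derivative in x is continuous in θ: Cauchy's estimate applies to the difference of two
  -- slices, which is small by uniform continuity.
  have hmeas' : MeasureTheory.AEStronglyMeasurable
      (fun θ => m θ • fderiv ℂ (fun x => g x θ) x)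
      (MeasureTheory.volume.restrict (Set.uIoc a b)) := by
    rw [uIoc_of_le hab]
    refine hm.aestronglyMeasurable.smul (ContinuousOn.aestronglyMeasurable ?_ measurableSet_Ioc)
    intro θ hθ
    rw [ContinuousWithinAt, Metric.tendsto_nhdsWithin_nhds]
    intro ε hε
    obtain ⟨η, hη, hη'⟩ := Metric.uniformContinuousOn_iff.1 huc (ε / 2 * r) (by positivity)
    refine ⟨η, hη, fun {θ'} h1 h2 => ?_⟩
    rw [dist_eq_norm]
    calc _ ≤ ε / 2 * r / r := by
          refine norm_fderiv_sub_le_of_ball hr0 (hfd _ (Ioc_subset_Icc_self h1) x hxr)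
            (hfd _ (Ioc_subset_Icc_self hθ) x hxr) fun z hz => ?_
          rw [← dist_eq_norm]
          refine (hη' (z, θ') ⟨hsub x hxr hz, Ioc_subset_Icc_self h1⟩ (z, θ)
            ⟨hsub x hxr hz, Ioc_subset_Icc_self hθ⟩ ?_).le
          rw [Prod.dist_eq]
          simpa using h2
      _ = ε / 2 := by field_simp
      _ < ε := by linarith
  have hMab : ∀ᵐ θ : ℝ, θ ∈ Set.uIoc a b → ‖m θ‖ ≤ M := by rwa [uIoc_of_le hab]
  refine (intervalIntegral.hasFDerivAt_integral_of_dominated_of_fderiv_le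
    (F' := fun x θ => m θ • fderiv ℂ (fun x => g x θ) x) (s := Metric.ball x r)
    (bound := fun _ => M * (C / r)) (Metric.ball_mem_nhds x hr0) ?_ ?_ hmeas' ?_ ?_
    ?_).differentiableAt.differentiableWithinAt
  · filter_upwards [hΩ.mem_nhds hx] with y hy using hmeas y hy
  · rw [intervalIntegrable_iff]
    refine MeasureTheory.IntegrableOn.of_bound (C := C * M) (by simp) (hmeas x hx) ?_
    rw [MeasureTheory.ae_restrict_iff' measurableSet_uIoc]
    filter_upwards [hMab] with θ h1 h2
    rw [norm_mul]
    rw [uIoc_of_le hab] at h2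
    have := hC (x, θ) ⟨Metric.mem_closedBall_self hδ.le, Ioc_subset_Icc_self h2⟩
    have h3 := h1 (by rwa [uIoc_of_le hab])
    exact mul_le_mul this h3 (norm_nonneg _) ((norm_nonneg _).trans this)
  · filter_upwards [hMab] with θ h1 h2 y hy
    rw [norm_smul]
    have h3 := h1 h2
    rw [uIoc_of_le hab] at h2
    have := norm_fderiv_le_of_bound_ball hr0 (hfd θ (Ioc_subset_Icc_self h2) y hy)
      (fun z hz => hC (z, θ) ⟨hsub y hy hz, Ioc_subset_Icc_self h2⟩)
    exact mul_le_mul h3 this (norm_nonneg _) ((norm_nonneg _).trans h3)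
  · exact intervalIntegrable_const
  · refine Eventually.of_forall fun θ h2 y hy => ?_
    rw [uIoc_of_le hab] at h2
    have := ((hfd θ (Ioc_subset_Icc_self h2) y hy).differentiableAt
      (Metric.ball_mem_nhds y hr0)).hasFDerivAt
    simpa [mul_comm] using this.mul_const (m θ)

end SeveralVariables

/-! ### Infinite products: zeros, splittings, joint holomorphy -/

section InfiniteProducts

theorem DifferentiableOn.complex_prod {E ι : Type*} [NormedAddCommGroup E] [NormedSpace ℂ E]
    {Ω : Set E} {f : ι → E → ℂ} {s : Finset ι} (h : ∀ i ∈ s, DifferentiableOn ℂ (f i) Ω) :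
    DifferentiableOn ℂ (fun x => ∏ i ∈ s, f i x) Ω := by
  classical
  induction s using Finset.induction_on with
  | empty => simp
  | insert a s ha ih =>
    simp only [Finset.prod_insert ha]
    exact (h a (by simp)).fun_mul (ih fun i hi => h i (by simp [hi]))

theorem summable_norm_pq (x : ℂ) {p q : ℂ} (hp : ‖p‖ < 1) (hq : ‖q‖ < 1) :
    Summable fun i : ℕ × ℕ => ‖-(x * p ^ i.1 * q ^ i.2)‖ := by
  have h := ((summable_geometric_of_lt_one (norm_nonneg p) hp).mul_of_nonneg
    (summable_geometric_of_lt_one (norm_nonneg q) hq) (fun _ => by positivity)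
    fun _ => by positivity).mul_left ‖x‖
  refine h.congr fun i => ?_
  simp [mul_assoc]

theorem multipliable_pq (x : ℂ) {p q : ℂ} (hp : ‖p‖ < 1) (hq : ‖q‖ < 1) :
    Multipliable fun i : ℕ × ℕ => (1 - x * p ^ i.1 * q ^ i.2) := by
  simp only [sub_eq_add_neg]
  exact multipliable_one_add_of_summable (summable_norm_pq x hp hq)

theorem multipliable_q (x : ℂ) {q : ℂ} (hq : ‖q‖ < 1) :
    Multipliable fun j : ℕ => (1 - x * q ^ j) := by
  simp only [sub_eq_add_neg]
  refine multipliable_one_add_of_summable ?_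
  simpa using (summable_geometric_of_lt_one (norm_nonneg q) hq).mul_left ‖x‖

theorem pqPoch_ne_zero_iff {x p q : ℂ} (hp : ‖p‖ < 1) (hq : ‖q‖ < 1) :
    pqPoch x p q ≠ 0 ↔ ∀ i j : ℕ, x * p ^ i * q ^ j ≠ 1 := by
  constructor
  · intro h i j hij
    refine h ?_
    have : HasProd (fun i : ℕ × ℕ => (1 - x * p ^ i.1 * q ^ i.2)) 0 :=
      hasProd_zero_of_exists_eq_zero ⟨(i, j), by simp [hij]⟩
    exact this.tprod_eq
  · intro h
    have := tprod_one_add_ne_zero_of_summable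
      (f := fun i : ℕ × ℕ => -(x * p ^ i.1 * q ^ i.2)) (fun i => ?_) (summable_norm_pq x hp hq)
    · simpa [pqPoch, sub_eq_add_neg] using this
    · rw [← sub_eq_add_neg]
      exact sub_ne_zero.2 (h i.1 i.2).symm

theorem qPoch_ne_zero_iff {x q : ℂ} (hq : ‖q‖ < 1) :
    qPoch x q ≠ 0 ↔ ∀ j : ℕ, x * q ^ j ≠ 1 := by
  constructor
  · intro h j hij
    refine h ?_
    have : HasProd (fun j : ℕ => (1 - x * q ^ j)) 0 :=
      hasProd_zero_of_exists_eq_zero ⟨j, by simp [hij]⟩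
    exact this.tprod_eq
  · intro h
    have := tprod_one_add_ne_zero_of_summable
      (f := fun j : ℕ => -(x * q ^ j)) (fun i => ?_) ?_
    · simpa [qPoch, sub_eq_add_neg] using this
    · rw [← sub_eq_add_neg]
      exact sub_ne_zero.2 (h i).symm
    · simpa using (summable_geometric_of_lt_one (norm_nonneg q) hq).mul_left ‖x‖

theorem qPoch_ne_zero_of_norm_lt {x q : ℂ} (hq : ‖q‖ < 1) (hx : ‖x‖ < 1) : qPoch x q ≠ 0 := by
  rw [qPoch_ne_zero_iff hq]
  intro j h
  have h1 : ‖x * q ^ j‖ < 1 := by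
    rw [norm_mul, norm_pow]
    exact mul_lt_one_of_nonneg_of_lt_one_left (norm_nonneg _) hx
      (pow_le_one₀ (norm_nonneg _) hq.le)
  simp [h] at h1

theorem pqPoch_ne_zero_of_norm_lt {x p q : ℂ} (hp : ‖p‖ < 1) (hq : ‖q‖ < 1) (hx : ‖x‖ < 1) :
    pqPoch x p q ≠ 0 := by
  rw [pqPoch_ne_zero_iff hp hq]
  intro i j h
  have h1 : ‖x * p ^ i * q ^ j‖ < 1 := by
    rw [norm_mul, norm_mul, norm_pow, norm_pow, mul_assoc]
    exact mul_lt_one_of_nonneg_of_lt_one_left (norm_nonneg _) hx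
      (mul_le_one₀ (pow_le_one₀ (norm_nonneg _) hp.le) (by positivity)
        (pow_le_one₀ (norm_nonneg _) hq.le))
  simp [h] at h1

/-- Because 0^0 = 1, the row i = 0 survives at p = 0. The limiting objects are therefore the case p
= 0 of the elliptic ones and need no separate treatment. -/
theorem pqPoch_zero (x q : ℂ) : pqPoch x 0 q = qPoch x q := by
  rw [pqPoch, qPoch]
  have hinj : Function.Injective fun j : ℕ => ((0, j) : ℕ × ℕ) := fun a b h => by simpa using h
  rw [← hinj.tprod_eq]
  · simp
  · rintro ⟨i, j⟩ h
    rcases i with _ | i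
    · exact ⟨j, rfl⟩
    · simp at h

@[simp] theorem qPoch_zero_left (q : ℂ) : qPoch 0 q = 1 := by simp [qPoch]

theorem qPoch_eq_mul {q : ℂ} (hq : ‖q‖ < 1) (x : ℂ) :
    qPoch x q = (1 - x) * qPoch (x * q) q := by
  rw [qPoch, qPoch, tprod_eq_zero_mul']
  · simp [pow_succ', mul_assoc]
  · simpa [pow_succ', mul_assoc] using multipliable_q (x * q) hq

theorem qPoch_eq_prod_mul {q : ℂ} (hq : ‖q‖ < 1) (x : ℂ) (K : ℕ) :
    qPoch x q = (∏ l ∈ Finset.range K, (1 - x * q ^ l)) * qPoch (x * q ^ K) q := by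
  induction K with
  | zero => simp
  | succ K ih =>
    rw [ih, qPoch_eq_mul hq (x * q ^ K), Finset.prod_range_succ, pow_succ, ← mul_assoc x,
      mul_assoc (Finset.prod _ _)]

theorem pqPoch_eq_tprod {p q : ℂ} (hp : ‖p‖ < 1) (hq : ‖q‖ < 1) (x : ℂ) :
    HasProd (fun i : ℕ => qPoch (x * p ^ i) q) (pqPoch x p q) :=
  (multipliable_pq x hp hq).hasProd.prod_fiberwise fun i => (multipliable_q (x * p ^ i) hq).hasProd

theorem pqPoch_eq_qPoch_mul {p q : ℂ} (hp : ‖p‖ < 1) (hq : ‖q‖ < 1) (x : ℂ) :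
    pqPoch x p q = qPoch x q * pqPoch (x * p) p q := by
  rw [← (pqPoch_eq_tprod hp hq x).tprod_eq, ← (pqPoch_eq_tprod hp hq (x * p)).tprod_eq,
    tprod_eq_zero_mul']
  · simp [pow_succ', mul_assoc]
  · simpa [pow_succ', mul_assoc] using (pqPoch_eq_tprod hp hq (x * p)).multipliable

theorem pqPoch_comm (x p q : ℂ) : pqPoch x p q = pqPoch x q p := by
  rw [pqPoch, pqPoch, ← (Equiv.prodComm ℕ ℕ).tprod_eq]
  simp [mul_right_comm]

/-- The quadrant of indices is the row i = 0, the rest of the column j = 0, and a shifted quadrant.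
The last factor cancels in 1/Γ(z^{±2}), which leaves one-variable products. -/
theorem pqPoch_eq_mul_mul {p q : ℂ} (hp : ‖p‖ < 1) (hq : ‖q‖ < 1) (x : ℂ) :
    pqPoch x p q = qPoch x q * qPoch (x * p) p * pqPoch (x * p * q) p q := by
  rw [pqPoch_eq_qPoch_mul hp hq, pqPoch_comm (x * p), pqPoch_eq_qPoch_mul hq hp,
    pqPoch_comm (x * p * q), ← mul_assoc]

theorem norm_sq_lt_one {q : ℂ} (hq : ‖q‖ < 1) : ‖q ^ 2‖ < 1 := by
  rw [norm_pow]
  exact pow_lt_one₀ (norm_nonneg _) hq two_ne_zero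

theorem qPoch_even_odd {q : ℂ} (hq : ‖q‖ < 1) (x : ℂ) :
    qPoch x q = qPoch x (q ^ 2) * qPoch (x * q) (q ^ 2) := by
  have hq2 := norm_sq_lt_one hq
  have h1 := (multipliable_q x hq2).hasProd
  have h2 := (multipliable_q (x * q) hq2).hasProd
  refine (HasProd.even_mul_odd (f := fun j : ℕ => (1 - x * q ^ j)) ?_ ?_).tprod_eq
  · simp only [pow_mul]
    exact h1
  · refine h2.congr_fun ?_
    intro j
    ring_nf

theorem pqPoch_even_odd_right {p q : ℂ} (hp : ‖p‖ < 1) (hq : ‖q‖ < 1) (x : ℂ) :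
    pqPoch x p q = pqPoch x p (q ^ 2) * pqPoch (x * q) p (q ^ 2) := by
  have hq2 := norm_sq_lt_one hq
  have h := (pqPoch_eq_tprod hp hq2 x).mul (pqPoch_eq_tprod hp hq2 (x * q))
  rw [← h.tprod_eq, ← (pqPoch_eq_tprod hp hq x).tprod_eq]
  refine tprod_congr fun i => ?_
  rw [qPoch_even_odd hq]
  congr 2
  ring

/-- Splitting both indices by parity; together with `pqPoch_mul_neg` this is the duplication
formula. -/
theorem pqPoch_even_odd {p q : ℂ} (hp : ‖p‖ < 1) (hq : ‖q‖ < 1) (x : ℂ) :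
    pqPoch x p q = pqPoch x (p ^ 2) (q ^ 2) * pqPoch (x * q) (p ^ 2) (q ^ 2) *
      (pqPoch (x * p) (p ^ 2) (q ^ 2) * pqPoch (x * p * q) (p ^ 2) (q ^ 2)) := by
  have hq2 := norm_sq_lt_one hq
  rw [pqPoch_even_odd_right hp hq, pqPoch_comm x, pqPoch_comm (x * q),
    pqPoch_even_odd_right hq2 hp, pqPoch_even_odd_right hq2 hp]
  simp only [pqPoch_comm _ (q ^ 2)]
  rw [mul_right_comm x q p]
  ring

theorem pqPoch_mul_neg {p q : ℂ} (hp : ‖p‖ < 1) (hq : ‖q‖ < 1) (x : ℂ) :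
    pqPoch x p q * pqPoch (-x) p q = pqPoch (x ^ 2) (p ^ 2) (q ^ 2) := by
  rw [pqPoch, pqPoch, ← (multipliable_pq x hp hq).tprod_mul (multipliable_pq (-x) hp hq), pqPoch]
  refine tprod_congr fun i => ?_
  ring

theorem qPoch_mul_neg {q : ℂ} (hq : ‖q‖ < 1) (x : ℂ) :
    qPoch x q * qPoch (-x) q = qPoch (x ^ 2) (q ^ 2) := by
  simpa [pqPoch_zero] using pqPoch_mul_neg (p := 0) (by simp) hq x

theorem isOpen_pqDomain : IsOpen {y : ℂ × ℂ × ℂ | ‖y.2.1‖ < 1 ∧ ‖y.2.2‖ < 1} :=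
  (isOpen_lt (f := fun y : ℂ × ℂ × ℂ => ‖y.2.1‖) (by fun_prop) continuous_const).inter
    (isOpen_lt (f := fun y : ℂ × ℂ × ℂ => ‖y.2.2‖) (by fun_prop) continuous_const)

/-- The product converges locally uniformly in all three variables, with majorant (‖x‖ + 1) r^i s^j.
The domain contains p = 0, which is what turns the limit p → 0 into an evaluation. -/
theorem differentiableOn_pqPoch :
    DifferentiableOn ℂ (fun y : ℂ × ℂ × ℂ => pqPoch y.1 y.2.1 y.2.2)
      {y | ‖y.2.1‖ < 1 ∧ ‖y.2.2‖ < 1} := by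
  refine differentiableOn_of_tendstoUniformlyOn_nhds (l := (atTop : Filter (Finset (ℕ × ℕ))))
    (f := fun s y => ∏ i ∈ s, (1 + -(y.1 * y.2.1 ^ i.1 * y.2.2 ^ i.2))) isOpen_pqDomain ?_ ?_
  · intro s
    exact DifferentiableOn.complex_prod fun i _ => by fun_prop
  · rintro ⟨x, p, q⟩ ⟨hp, hq⟩
    obtain ⟨r, hr, hr1⟩ := exists_between hp
    obtain ⟨s, hs, hs1⟩ := exists_between hq
    refine ⟨Metric.closedBall 0 (‖x‖ + 1) ×ˢ (Metric.closedBall 0 r ×ˢ Metric.closedBall 0 s),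
      ?_, ?_⟩
    · refine prod_mem_nhds ?_ (prod_mem_nhds ?_ ?_)
      · exact Metric.closedBall_mem_nhds_of_mem (by simp)
      · exact Metric.closedBall_mem_nhds_of_mem (by simpa using hr)
      · exact Metric.closedBall_mem_nhds_of_mem (by simpa using hs)
    · have hr0 : 0 ≤ r := (norm_nonneg p).trans hr.le
      have hs0 : 0 ≤ s := (norm_nonneg q).trans hs.le
      have hsum := ((summable_geometric_of_lt_one hr0 hr1).mul_of_nonneg
        (summable_geometric_of_lt_one hs0 hs1) (fun _ => by positivity)
        fun _ => by positivity).mul_left (‖x‖ + 1)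
      have := hsum.hasProdUniformlyOn_one_add
        (K := Metric.closedBall (0 : ℂ) (‖x‖ + 1) ×ˢ
          (Metric.closedBall (0 : ℂ) r ×ˢ Metric.closedBall (0 : ℂ) s))
        (f := fun (i : ℕ × ℕ) (y : ℂ × ℂ × ℂ) => -(y.1 * y.2.1 ^ i.1 * y.2.2 ^ i.2))
        ((isCompact_closedBall _ _).prod ((isCompact_closedBall _ _).prod
          (isCompact_closedBall _ _))) ?_ ?_
      · rw [hasProdUniformlyOn_iff_tendstoUniformlyOn] at this
        simpa only [pqPoch, sub_eq_add_neg] using this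
      · refine Eventually.of_forall fun i y hy => ?_
        simp only [mem_prod, mem_closedBall_zero_iff] at hy
        obtain ⟨h1, h2, h3⟩ := hy
        rw [norm_neg, norm_mul, norm_mul, norm_pow, norm_pow, mul_assoc]
        gcongr
      · intro i
        fun_prop

variable {E : Type*} [NormedAddCommGroup E] [NormedSpace ℂ E]

theorem DifferentiableOn.pqPoch {Ω : Set E} {x p q : E → ℂ} (hx : DifferentiableOn ℂ x Ω)
    (hp : DifferentiableOn ℂ p Ω) (hq : DifferentiableOn ℂ q Ω) (hp1 : ∀ y ∈ Ω, ‖p y‖ < 1)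
    (hq1 : ∀ y ∈ Ω, ‖q y‖ < 1) : DifferentiableOn ℂ (fun y => pqPoch (x y) (p y) (q y)) Ω :=
  differentiableOn_pqPoch.comp (f := fun y => (x y, p y, q y)) (by fun_prop)
    fun y hy => ⟨hp1 y hy, hq1 y hy⟩

theorem DifferentiableOn.qPoch {Ω : Set E} {x q : E → ℂ} (hx : DifferentiableOn ℂ x Ω)
    (hq : DifferentiableOn ℂ q Ω) (hq1 : ∀ y ∈ Ω, ‖q y‖ < 1) :
    DifferentiableOn ℂ (fun y => qPoch (x y) (q y)) Ω := by
  simp only [← pqPoch_zero]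
  exact hx.pqPoch (differentiableOn_const _) hq (by simp) hq1

theorem differentiable_qPoch {q : ℂ} (hq : ‖q‖ < 1) : Differentiable ℂ fun x => qPoch x q := by
  rw [← differentiableOn_univ]
  exact differentiableOn_id.qPoch (differentiableOn_const q) fun _ _ => hq

end InfiniteProducts

/-! ### Integrals along closed curves and winding numbers -/

section Loops

variable {γ γ₁ γ₂ : ℝ → ℂ}

theorem IsLoop.exists_bound_deriv (h : IsLoop γ) :
    ∃ M : ℝ, ∀ᵐ x : ℝ, x ∈ Ioc (0 : ℝ) 1 → ‖deriv γ x‖ ≤ M := by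
  obtain ⟨-, -, s, M, hM⟩ := h
  refine ⟨M, ?_⟩
  have hs : MeasureTheory.volume ((insert 1 s : Set ℝ)) = 0 :=
    (Set.Countable.insert 1 s.countable_toSet).measure_zero _
  filter_upwards [MeasureTheory.measure_eq_zero_iff_ae_notMem.1 hs] with x hx hx'
  simp only [mem_insert_iff, not_or] at hx
  exact (hM x ⟨hx'.1, lt_of_le_of_ne hx'.2 hx.1⟩ hx.2).2

theorem IsLoop.intervalIntegrable (h : IsLoop γ) {g : ℝ → ℂ} (hg : ContinuousOn g (Icc 0 1)) :
    IntervalIntegrable (fun x => g x * deriv γ x) MeasureTheory.volume 0 1 := by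
  obtain ⟨M, hM⟩ := h.exists_bound_deriv
  obtain ⟨C, hC⟩ := isCompact_Icc.exists_bound_of_continuousOn hg
  rw [intervalIntegrable_iff, uIoc_of_le zero_le_one]
  refine MeasureTheory.IntegrableOn.of_bound (C := C * M) (by simp) ?_ ?_
  · exact ((hg.mono Ioc_subset_Icc_self).aestronglyMeasurable measurableSet_Ioc).mul
      (measurable_deriv γ).aestronglyMeasurable
  · rw [MeasureTheory.ae_restrict_iff' measurableSet_Ioc]
    filter_upwards [hM] with x hx hx'
    rw [norm_mul]
    have := hC x (Ioc_subset_Icc_self hx')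
    exact mul_le_mul this (hx hx') (norm_nonneg _) ((norm_nonneg _).trans this)

theorem IsLoop.integrable_comp (h : IsLoop γ) {f : ℂ → ℂ}
    (hf : ContinuousOn f (γ '' Icc 0 1)) :
    IntervalIntegrable (fun x => f (γ x) * deriv γ x) MeasureTheory.volume 0 1 :=
  h.intervalIntegrable (hf.comp h.1 (mapsTo_image γ _))

theorem loopIntegral_congr {f g : ℂ → ℂ} (h : ∀ x ∈ Icc (0 : ℝ) 1, f (γ x) = g (γ x)) :
    loopIntegral γ f = loopIntegral γ g := by
  refine intervalIntegral.integral_congr fun x hx => ?_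
  rw [uIcc_of_le zero_le_one] at hx
  simp only [h x hx]

theorem IsLoop.loopIntegral_add (h : IsLoop γ) {f g : ℂ → ℂ} (hf : ContinuousOn f (γ '' Icc 0 1))
    (hg : ContinuousOn g (γ '' Icc 0 1)) :
    loopIntegral γ (fun z => f z + g z) = loopIntegral γ f + loopIntegral γ g := by
  rw [loopIntegral, loopIntegral, loopIntegral,
    ← intervalIntegral.integral_add (h.integrable_comp hf) (h.integrable_comp hg)]
  simp only [add_mul]

theorem loopIntegral_const_mul (c : ℂ) (f : ℂ → ℂ) :
    loopIntegral γ (fun z => c * f z) = c * loopIntegral γ f := by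
  rw [loopIntegral, loopIntegral, ← intervalIntegral.integral_const_mul]
  simp only [mul_assoc]

theorem IsLoop.loopIntegral_sub (h : IsLoop γ) {f g : ℂ → ℂ} (hf : ContinuousOn f (γ '' Icc 0 1))
    (hg : ContinuousOn g (γ '' Icc 0 1)) :
    loopIntegral γ (fun z => f z - g z) = loopIntegral γ f - loopIntegral γ g := by
  rw [loopIntegral, loopIntegral, loopIntegral,
    ← intervalIntegral.integral_sub (h.integrable_comp hf) (h.integrable_comp hg)]
  simp only [sub_mul]

theorem IsLoop.loopIntegral_deriv_eq_zero (h : IsLoop γ) {f F : ℂ → ℂ}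
    (hf : ContinuousOn f (γ '' Icc 0 1))
    (hF : ∀ x ∈ Icc (0 : ℝ) 1, HasDerivAt F (f (γ x)) (γ x)) : loopIntegral γ f = 0 := by
  have hint := h.integrable_comp hf
  obtain ⟨hc, hend, s, M, hM⟩ := h
  have := MeasureTheory.integral_eq_of_hasDerivAt_off_countable_of_le (fun x => F (γ x))
    (fun x => f (γ x) * deriv γ x) zero_le_one s.countable_toSet ?_ ?_ hint
  · rw [loopIntegral, this, hend, sub_self]
  · intro x hx
    exact (hF x hx).continuousAt.comp_continuousWithinAt (hc x hx)
  · rintro x ⟨hx, hxs⟩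
    exact (hF x (Ioo_subset_Icc_self hx)).comp x
      (((hM x hx hxs).1.differentiableAt one_ne_zero).hasDerivAt)

theorem IsLoop.isCompact_image (h : IsLoop γ) : IsCompact (γ '' Icc 0 1) :=
  isCompact_Icc.image_of_continuousOn h.1

theorem continuousOn_inv_sub {a : ℂ} (ha : ∀ x ∈ Icc (0 : ℝ) 1, γ x ≠ a) :
    ContinuousOn (fun z => (z - a)⁻¹) (γ '' Icc 0 1) := by
  refine ContinuousOn.inv₀ (by fun_prop) ?_
  rintro _ ⟨x, hx, rfl⟩
  exact sub_ne_zero.2 (ha x hx)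

/-- The difference of the two integrands has the primitive log((z - b)/(z - a)) = log(1 + (a - b)/(z
- a)). The hypothesis keeps the argument in the unit disk about 1, where the principal branch is
holomorphic. -/
theorem IsLoop.windingNr_eq_of_near (h : IsLoop γ) {a b : ℂ}
    (hab : ∀ x ∈ Icc (0 : ℝ) 1, ‖b - a‖ < ‖γ x - a‖) : windingNr γ b = windingNr γ a := by
  have ha : ∀ x ∈ Icc (0 : ℝ) 1, γ x ≠ a := fun x hx hxa => by
    have := hab x hx
    rw [hxa, sub_self, norm_zero] at this
    exact absurd this (not_lt.2 (norm_nonneg _))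
  have hb : ∀ x ∈ Icc (0 : ℝ) 1, γ x ≠ b := fun x hx hxb => by
    have := hab x hx
    rw [hxb] at this
    exact lt_irrefl _ this
  have key : loopIntegral γ (fun z => (z - b)⁻¹ - (z - a)⁻¹) = 0 := by
    refine h.loopIntegral_deriv_eq_zero (F := fun z => Complex.log (1 + (a - b) / (z - a)))
      ((continuousOn_inv_sub hb).sub (continuousOn_inv_sub ha)) fun x hx => ?_
    have h1 : γ x - a ≠ 0 := sub_ne_zero.2 (ha x hx)
    have h2 : γ x - b ≠ 0 := sub_ne_zero.2 (hb x hx)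
    have hs : 1 + (a - b) / (γ x - a) ∈ Complex.slitPlane := by
      apply Complex.mem_slitPlane_of_norm_lt_one
      rw [norm_div, div_lt_one (norm_pos_iff.2 h1), norm_sub_rev]
      exact hab x hx
    have h3 : HasDerivAt (fun z : ℂ => 1 + (a - b) / (z - a))
        ((0 * (γ x - a) - (a - b) * 1) / (γ x - a) ^ 2) (γ x) :=
      ((hasDerivAt_const (γ x) (a - b)).div ((hasDerivAt_id (γ x)).sub_const a) h1).const_add 1
    convert h3.clog hs using 1
    have h4 : 1 + (a - b) / (γ x - a) = (γ x - b) / (γ x - a) := by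
      field_simp
      ring
    rw [h4]
    field_simp
    ring
  rw [h.loopIntegral_sub (continuousOn_inv_sub hb) (continuousOn_inv_sub ha)] at key
  rw [windingNr, windingNr, sub_eq_zero.1 key]

/-- On the disk ‖z‖ < ‖a‖ the function log(1 - z/a) is a primitive. -/
theorem IsLoop.windingNr_eq_zero_of_large (h : IsLoop γ) {a : ℂ}
    (ha : ∀ x ∈ Icc (0 : ℝ) 1, ‖γ x‖ < ‖a‖) : windingNr γ a = 0 := by
  have ha0 : a ≠ 0 := by
    rintro rfl
    have := ha 0 (by simp)
    rw [norm_zero] at this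
    exact absurd this (not_lt.2 (norm_nonneg _))
  have hne : ∀ x ∈ Icc (0 : ℝ) 1, γ x ≠ a := fun x hx hxa => by
    have := ha x hx
    rw [hxa] at this
    exact lt_irrefl _ this
  have key : loopIntegral γ (fun z => (z - a)⁻¹) = 0 := by
    refine h.loopIntegral_deriv_eq_zero (F := fun z => Complex.log (1 + -z / a))
      (continuousOn_inv_sub hne) fun x hx => ?_
    have h2 : γ x - a ≠ 0 := sub_ne_zero.2 (hne x hx)
    have hs : 1 + -γ x / a ∈ Complex.slitPlane := by
      apply Complex.mem_slitPlane_of_norm_lt_one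
      rw [norm_div, norm_neg, div_lt_one (norm_pos_iff.2 ha0)]
      exact ha x hx
    have h3 : HasDerivAt (fun z : ℂ => 1 + -z / a) (-1 / a) (γ x) :=
      (((hasDerivAt_id (γ x)).neg).div_const a).const_add 1
    convert h3.clog hs using 1
    have h4 : 1 + -γ x / a = -(γ x - a) / a := by
      field_simp
      ring
    rw [h4]
    field_simp
  rw [windingNr, key, zero_div]

theorem IsLoop.windingNr_eq_of_small (h : IsLoop γ) {a : ℂ}
    (ha : ∀ x ∈ Icc (0 : ℝ) 1, ‖a‖ < ‖γ x‖) : windingNr γ a = windingNr γ 0 :=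
  h.windingNr_eq_of_near (by simpa using ha)

theorem IsLoop.differentiableOn_parametric {E : Type*} [NormedAddCommGroup E] [NormedSpace ℂ E]
    [ProperSpace E] (h : IsLoop γ) {Ω : Set E} (hΩ : IsOpen Ω) {g : E → ℂ → ℂ}
    (hc : ContinuousOn (Function.uncurry g) (Ω ×ˢ (γ '' Icc 0 1)))
    (hd : ∀ z ∈ γ '' Icc 0 1, DifferentiableOn ℂ (fun x => g x z) Ω) :
    DifferentiableOn ℂ (fun x => loopIntegral γ (g x)) Ω := by
  obtain ⟨M, hM⟩ := h.exists_bound_deriv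
  refine differentiableOn_parametric_integral hΩ zero_le_one (g := fun x θ => g x (γ θ))
    (m := deriv γ) ?_ (fun θ hθ => hd _ (mem_image_of_mem γ hθ)) (measurable_deriv γ) hM
  refine hc.comp (f := fun p : E × ℝ => (p.1, γ p.2)) ?_ fun p hp => ⟨hp.1, mem_image_of_mem γ hp.2⟩
  exact continuousOn_fst.prodMk (h.1.comp continuousOn_snd fun p hp => hp.2)

end Loops

/-! ### The homological Cauchy theorem -/

section Cauchy

variable {γ γ₁ γ₂ : ℝ → ℂ}

/-- Only the diagonal needs an argument: strict differentiability handles nearby pairs of distinct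
points, and continuity of f' handles the diagonal pairs. -/
theorem continuousOn_dslope_prod {U : Set ℂ} (hU : IsOpen U) {f : ℂ → ℂ}
    (hf : DifferentiableOn ℂ f U) :
    ContinuousOn (fun p : ℂ × ℂ => dslope f p.1 p.2) (U ×ˢ U) := by
  rintro ⟨a, b⟩ ⟨ha, hb⟩
  refine ContinuousAt.continuousWithinAt ?_
  have hfa := hf.analyticAt (hU.mem_nhds ha)
  by_cases hab : b = a
  · subst hab
    have hstrict := hfa.hasStrictDerivAt
    have hderiv : ContinuousAt (deriv f) b := hfa.deriv.continuousAt
    rw [Metric.continuousAt_iff']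
    intro ε hε
    have h1 := hstrict.hasStrictFDerivAt.isLittleO.bound (half_pos hε)
    have h2 : ∀ᶠ p : ℂ × ℂ in 𝓝 (b, b), dist (deriv f p.1) (deriv f b) < ε :=
      (hderiv.comp (x := ((b, b) : ℂ × ℂ)) continuousAt_fst).eventually
        (Metric.ball_mem_nhds _ hε)
    filter_upwards [h1, h2] with p h3 h4
    simp only [dslope_same]
    by_cases hp : p.2 = p.1
    · rw [hp, dslope_same]
      exact h4
    · rw [dslope_of_ne _ hp, slope_def_field, dist_eq_norm]
      have h5 : p.2 - p.1 ≠ 0 := sub_ne_zero.2 hp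
      have h6 : (f p.2 - f p.1) / (p.2 - p.1) - deriv f b =
          -(f p.1 - f p.2 - (p.1 - p.2) • deriv f b) / (p.2 - p.1) := by
        rw [smul_eq_mul]
        field_simp
        ring
      rw [h6, norm_div, norm_neg, div_lt_iff₀ (norm_pos_iff.2 h5)]
      rw [norm_sub_rev p.1 p.2] at h3
      simp only [ContinuousLinearMap.toSpanSingleton_apply] at h3
      have := norm_pos_iff.2 h5
      nlinarith
  · have hev : ∀ᶠ p : ℂ × ℂ in 𝓝 (a, b), dslope f p.1 p.2 = (f p.2 - f p.1) / (p.2 - p.1) := by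
      have : ∀ᶠ p : ℂ × ℂ in 𝓝 (a, b), p.2 ≠ p.1 :=
        (isOpen_ne_fun continuous_snd continuous_fst).mem_nhds hab
      filter_upwards [this] with p hp
      rw [dslope_of_ne _ hp, slope_def_field]
    refine ContinuousAt.congr ?_ (EventuallyEq.symm hev)
    have hfa' : ContinuousAt (fun p : ℂ × ℂ => f p.1) (a, b) :=
      ContinuousAt.comp (x := ((a, b) : ℂ × ℂ)) hfa.continuousAt continuousAt_fst
    have hfb : ContinuousAt (fun p : ℂ × ℂ => f p.2) (a, b) :=
      ContinuousAt.comp (x := ((a, b) : ℂ × ℂ))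
        (hf.analyticAt (hU.mem_nhds hb)).continuousAt continuousAt_snd
    exact (hfb.sub hfa').div (by fun_prop) (sub_ne_zero.2 hab)

theorem IsLoop.exists_norm_lt (h : IsLoop γ) : ∃ M : ℝ, ∀ x ∈ Icc (0 : ℝ) 1, ‖γ x‖ < M := by
  obtain ⟨C, hC⟩ := isCompact_Icc.exists_bound_of_continuousOn h.1
  exact ⟨C + 1, fun x hx => (hC x hx).trans_lt (lt_add_one C)⟩

theorem IsLoop.eventually_far (h : IsLoop γ) {a : ℂ} (ha : ∀ x ∈ Icc (0 : ℝ) 1, γ x ≠ a) :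
    ∀ᶠ b in 𝓝 a, ∀ x ∈ Icc (0 : ℝ) 1, ‖b - a‖ < ‖γ x - a‖ := by
  have hcpt := h.isCompact_image
  have hpos : ∃ d > 0, ∀ z ∈ γ '' Icc 0 1, d ≤ ‖z - a‖ := by
    obtain ⟨z, hz, hmin⟩ := hcpt.exists_isMinOn (f := fun z => ‖z - a‖)
      ⟨γ 0, mem_image_of_mem γ (by simp)⟩ (by fun_prop)
    refine ⟨‖z - a‖, ?_, fun w hw => hmin hw⟩
    obtain ⟨x, hx, rfl⟩ := hz
    exact norm_pos_iff.2 (sub_ne_zero.2 (ha x hx))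
  obtain ⟨d, hd, hd'⟩ := hpos
  filter_upwards [Metric.ball_mem_nhds a hd] with b hb x hx
  have : ‖b - a‖ < d := by rwa [← dist_eq_norm]
  exact this.trans_le (hd' _ (mem_image_of_mem γ hx))

theorem ne_of_forall_far {a b : ℂ} (hab : ∀ x ∈ Icc (0 : ℝ) 1, ‖b - a‖ < ‖γ x - a‖) :
    ∀ x ∈ Icc (0 : ℝ) 1, γ x ≠ b := fun x hx h => by
  have := hab x hx
  rw [h] at this
  exact lt_irrefl _ this

theorem loopIntegral_dslope (h : IsLoop γ) {U : Set ℂ} {f : ℂ → ℂ} (hf : ContinuousOn f U)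
    (hγ : ∀ x ∈ Icc (0 : ℝ) 1, γ x ∈ U) {z : ℂ} (hz : ∀ x ∈ Icc (0 : ℝ) 1, γ x ≠ z) :
    loopIntegral γ (dslope f z) = loopIntegral γ (fun w => f w * (w - z)⁻¹) -
      f z * (2 * Real.pi * Complex.I) * windingNr γ z := by
  have h1 : loopIntegral γ (dslope f z) =
      loopIntegral γ (fun w => f w * (w - z)⁻¹ - f z * (w - z)⁻¹) := by
    refine loopIntegral_congr fun x hx => ?_
    rw [dslope_of_ne _ (hz x hx), slope_def_field]
    ring
  have hsub : γ '' Icc 0 1 ⊆ U := by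
    rintro _ ⟨x, hx, rfl⟩
    exact hγ x hx
  rw [h1, h.loopIntegral_sub (f := fun w => f w * (w - z)⁻¹) (g := fun w => f z * (w - z)⁻¹)
    ((hf.mono hsub).mul (continuousOn_inv_sub hz)) (continuousOn_const.mul (continuousOn_inv_sub hz)), loopIntegral_const_mul, windingNr]
  have : (2 * Real.pi * Complex.I : ℂ) ≠ 0 := Complex.two_pi_I_ne_zero
  field_simp

theorem differentiableAt_cauchyTransform (h : IsLoop γ) {U : Set ℂ} {f : ℂ → ℂ}
    (hf : ContinuousOn f U) (hγ : ∀ x ∈ Icc (0 : ℝ) 1, γ x ∈ U) {z : ℂ}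
    (hz : ∀ x ∈ Icc (0 : ℝ) 1, γ x ≠ z) :
    DifferentiableAt ℂ (fun z => loopIntegral γ (fun w => f w * (w - z)⁻¹)) z := by
  have hsub : γ '' Icc 0 1 ⊆ U := by
    rintro _ ⟨x, hx, rfl⟩
    exact hγ x hx
  have hopen : IsOpen (γ '' Icc 0 1)ᶜ := h.isCompact_image.isClosed.isOpen_compl
  have hmem : z ∈ (γ '' Icc 0 1)ᶜ := by
    rintro ⟨x, hx, rfl⟩
    exact hz x hx rfl
  refine (h.differentiableOn_parametric hopen (g := fun z w => f w * (w - z)⁻¹) ?_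
    ?_).differentiableAt (hopen.mem_nhds hmem)
  · refine ContinuousOn.mul ?_ (ContinuousOn.inv₀ (by fun_prop) ?_)
    · exact (hf.mono hsub).comp continuousOn_snd fun p hp => hp.2
    · rintro ⟨a, b⟩ ⟨ha, hb⟩ hab
      rw [sub_eq_zero] at hab
      simp only at hab ha
      exact ha (hab ▸ hb)
  · intro w hw a ha
    have : w - a ≠ 0 := sub_ne_zero.2 fun h => ha (h ▸ hw)
    exact ((differentiableAt_inv this).comp a (by fun_prop)).const_mul _
      |>.differentiableWithinAt

/-- Dixon's argument. The difference of the two integrals is holomorphic in z on U. Outside U it is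
continued by the difference of the Cauchy transforms, which agrees with it wherever the two winding
numbers coincide. The result is entire and tends to 0 at infinity, hence vanishes by Liouville. -/
theorem loopIntegral_dslope_sub_eq_zero {U : Set ℂ} (hU : IsOpen U) {f : ℂ → ℂ}
    (hf : DifferentiableOn ℂ f U) (h₁ : IsLoop γ₁) (h₂ : IsLoop γ₂)
    (m₁ : ∀ x ∈ Icc (0 : ℝ) 1, γ₁ x ∈ U) (m₂ : ∀ x ∈ Icc (0 : ℝ) 1, γ₂ x ∈ U)
    (hw : ∀ a ∉ U, windingNr γ₁ a = windingNr γ₂ a) {z : ℂ} (hz : z ∈ U) :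
    loopIntegral γ₁ (dslope f z) = loopIntegral γ₂ (dslope f z) := by
  classical
  set C : ℂ → ℂ := fun z => loopIntegral γ₁ (fun w => f w * (w - z)⁻¹) -
    loopIntegral γ₂ (fun w => f w * (w - z)⁻¹) with hC
  set D : ℂ → ℂ := fun z => if z ∈ U then loopIntegral γ₁ (dslope f z) -
    loopIntegral γ₂ (dslope f z) else C z with hD
  have hDC : ∀ z, (∀ x ∈ Icc (0 : ℝ) 1, γ₁ x ≠ z) → (∀ x ∈ Icc (0 : ℝ) 1, γ₂ x ≠ z) →
      windingNr γ₁ z = windingNr γ₂ z → D z = C z := by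
    intro z h1 h2 h3
    by_cases hz : z ∈ U
    · simp only [hD, if_pos hz]
      rw [loopIntegral_dslope h₁ hf.continuousOn m₁ h1,
        loopIntegral_dslope h₂ hf.continuousOn m₂ h2, h3, hC]
      ring
    · simp only [hD, if_neg hz]
  have hdiff : Differentiable ℂ D := by
    intro z
    by_cases hz : z ∈ U
    · have key : ∀ γ, IsLoop γ → (∀ x ∈ Icc (0 : ℝ) 1, γ x ∈ U) →
          DifferentiableAt ℂ (fun z => loopIntegral γ (dslope f z)) z := by
        intro γ h m
        have hsub : γ '' Icc 0 1 ⊆ U := by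
          rintro _ ⟨x, hx, rfl⟩
          exact m x hx
        refine (h.differentiableOn_parametric hU (g := fun z w => dslope f z w) ?_
          ?_).differentiableAt (hU.mem_nhds hz)
        · exact (continuousOn_dslope_prod hU hf).mono (prod_mono subset_rfl hsub)
        · intro w hw
          have := (Complex.differentiableOn_dslope (hU.mem_nhds (hsub hw))).2 hf
          refine this.congr fun z _ => ?_
          by_cases hzw : z = w
          · rw [hzw]
          · rw [dslope_of_ne _ hzw, dslope_of_ne _ (Ne.symm hzw), slope_comm]
      refine ((key γ₁ h₁ m₁).sub (key γ₂ h₂ m₂)).congr_of_eventuallyEq ?_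
      filter_upwards [hU.mem_nhds hz] with y hy
      simp [hD, hy]
    · have n₁ : ∀ x ∈ Icc (0 : ℝ) 1, γ₁ x ≠ z := fun x hx h => hz (h ▸ m₁ x hx)
      have n₂ : ∀ x ∈ Icc (0 : ℝ) 1, γ₂ x ≠ z := fun x hx h => hz (h ▸ m₂ x hx)
      refine ((differentiableAt_cauchyTransform h₁ hf.continuousOn m₁ n₁).sub
        (differentiableAt_cauchyTransform h₂ hf.continuousOn m₂ n₂)).congr_of_eventuallyEq ?_
      -- Winding numbers are locally constant, so their equality at z ∉ U persists nearby, and there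
      -- the two formulas for `D` agree.
      filter_upwards [h₁.eventually_far n₁, h₂.eventually_far n₂] with y h1 h2
      refine hDC y (ne_of_forall_far h1) (ne_of_forall_far h2) ?_
      rw [h₁.windingNr_eq_of_near h1, h₂.windingNr_eq_of_near h2, hw z hz]
  obtain ⟨M₁, hM₁⟩ := h₁.exists_norm_lt
  obtain ⟨M₂, hM₂⟩ := h₂.exists_norm_lt
  have hlimC : ∀ γ, IsLoop γ → (∀ x ∈ Icc (0 : ℝ) 1, γ x ∈ U) →
      Tendsto (fun z => loopIntegral γ (fun w => f w * (w - z)⁻¹)) (cocompact ℂ) (𝓝 0) := by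
    intro γ h m
    obtain ⟨B, hB⟩ := h.exists_bound_deriv
    obtain ⟨M, hM⟩ := h.exists_norm_lt
    have hfγ : ContinuousOn (fun x => f (γ x)) (Icc 0 1) := hf.continuousOn.comp h.1 m
    obtain ⟨K, hK⟩ := isCompact_Icc.exists_bound_of_continuousOn hfγ
    have hK0 : 0 ≤ K := (norm_nonneg _).trans (hK 0 (by simp))
    refine squeeze_zero_norm' (a := fun z => K * |B| * (‖z‖ - M)⁻¹) ?_ ?_
    · filter_upwards [tendsto_norm_cocompact_atTop.eventually_gt_atTop M] with z hz
      have := intervalIntegral.norm_integral_le_of_norm_le_const_ae (a := 0) (b := 1)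
        (C := K * |B| * (‖z‖ - M)⁻¹) (f := fun x => f (γ x) * (γ x - z)⁻¹ * deriv γ x) ?_
      · simpa [loopIntegral] using this
      · rw [uIoc_of_le zero_le_one]
        filter_upwards [hB] with x hx hx'
        have hx'' := Ioc_subset_Icc_self hx'
        have h1 := hK x hx''
        have h2 := (hx hx').trans (le_abs_self B)
        have h3 : ‖z‖ - M ≤ ‖γ x - z‖ := by
          have h4 := norm_sub_norm_le z (γ x)
          have h5 := hM x hx''
          rw [norm_sub_rev] at h4
          linarith
        have h4 : 0 < ‖z‖ - M := by linarith
        rw [norm_mul, norm_mul, norm_inv, mul_right_comm]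
        gcongr
    · have h1 : Tendsto (fun z : ℂ => (‖z‖ - M)⁻¹) (cocompact ℂ) (𝓝 0) :=
        tendsto_inv_atTop_zero.comp (tendsto_atTop_add_const_right _ (-M)
          (tendsto_norm_cocompact_atTop (E := ℂ)))
      simpa using h1.const_mul (K * |B|)
  have hlim : Tendsto D (cocompact ℂ) (𝓝 0) := by
    have h1 : Tendsto C (cocompact ℂ) (𝓝 0) := by
      simpa using (hlimC γ₁ h₁ m₁).sub (hlimC γ₂ h₂ m₂)
    refine h1.congr' ?_
    filter_upwards [tendsto_norm_cocompact_atTop.eventually_gt_atTop M₁,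
      tendsto_norm_cocompact_atTop.eventually_gt_atTop M₂] with z hz₁ hz₂
    have l₁ : ∀ x ∈ Icc (0 : ℝ) 1, ‖γ₁ x‖ < ‖z‖ := fun x hx => (hM₁ x hx).trans hz₁
    have l₂ : ∀ x ∈ Icc (0 : ℝ) 1, ‖γ₂ x‖ < ‖z‖ := fun x hx => (hM₂ x hx).trans hz₂
    refine (hDC z (fun x hx h => ?_) (fun x hx h => ?_) ?_).symm
    · exact absurd (l₁ x hx) (by rw [h]; exact lt_irrefl _)
    · exact absurd (l₂ x hx) (by rw [h]; exact lt_irrefl _)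
    · rw [h₁.windingNr_eq_zero_of_large l₁, h₂.windingNr_eq_zero_of_large l₂]
  have hzero : D z = 0 := hdiff.apply_eq_of_tendsto_cocompact z hlim
  simp only [hD, if_pos hz] at hzero
  exact sub_eq_zero.1 hzero

/-- The previous lemma is applied to (w - z) f(w), whose difference quotient at z is f itself. Any z
∈ U serves, and the starting point of the first curve is one. -/
theorem loopIntegral_eq_of_windingNr_eq {U : Set ℂ} (hU : IsOpen U) {f : ℂ → ℂ}
    (hf : DifferentiableOn ℂ f U) (h₁ : IsLoop γ₁) (h₂ : IsLoop γ₂)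
    (m₁ : ∀ x ∈ Icc (0 : ℝ) 1, γ₁ x ∈ U) (m₂ : ∀ x ∈ Icc (0 : ℝ) 1, γ₂ x ∈ U)
    (hw : ∀ a ∉ U, windingNr γ₁ a = windingNr γ₂ a) :
    loopIntegral γ₁ f = loopIntegral γ₂ f := by
  have hz : γ₁ 0 ∈ U := m₁ 0 (by simp)
  set z := γ₁ 0
  have hg : DifferentiableOn ℂ (fun w => (w - z) * f w) U := by fun_prop
  have key := loopIntegral_dslope_sub_eq_zero hU hg h₁ h₂ m₁ m₂ hw hz
  have hd : ∀ w ∈ U, dslope (fun w => (w - z) * f w) z w = f w := by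
    intro w hw
    by_cases h : w = z
    · rw [h, dslope_same]
      have h1 : HasDerivAt (fun w => (w - z) * f w) (1 * f z + (z - z) * deriv f z) z :=
        ((hasDerivAt_id z).sub_const z).mul
          (hf.differentiableAt (hU.mem_nhds hz)).hasDerivAt
      simpa using h1.deriv
    · exact dslope_sub_smul_of_ne f h
  rw [loopIntegral_congr fun x hx => hd _ (m₁ x hx),
    loopIntegral_congr fun x hx => hd _ (m₂ x hx)] at key
  exact key

end Cauchy

/-! ### Curves in an annulus, exceptional points, perturbation -/

section AnnulusLoops

variable {γ γ₁ γ₂ : ℝ → ℂ}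

theorem contDiff_isLoop {γ : ℝ → ℂ} (h : ContDiff ℝ 1 γ) (h01 : γ 0 = γ 1) : IsLoop γ := by
  have hcd : Continuous (deriv γ) := h.continuous_deriv le_rfl
  obtain ⟨M, hM⟩ := isCompact_Icc.exists_bound_of_continuousOn
    (s := Icc (0 : ℝ) 1) hcd.continuousOn
  exact ⟨h.continuous.continuousOn, h01, ∅, M, fun x hx _ =>
    ⟨h.contDiffAt, hM x (Ioo_subset_Icc_self hx)⟩⟩

theorem windingNr_exp {ψ : ℝ → ℂ} (h : ContDiff ℝ 1 ψ)
    (h01 : ψ 1 - ψ 0 = 2 * Real.pi * Complex.I) :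
    windingNr (fun x => Complex.exp (ψ x)) 0 = 1 := by
  have hcd : Continuous (deriv ψ) := h.continuous_deriv le_rfl
  have hder : ∀ x, HasDerivAt ψ (deriv ψ x) x := fun x =>
    (h.differentiable one_ne_zero x).hasDerivAt
  have h1 : ∀ x, (Complex.exp (ψ x) - 0)⁻¹ * deriv (fun x => Complex.exp (ψ x)) x = deriv ψ x := by
    intro x
    rw [((hder x).cexp).deriv, sub_zero, inv_mul_cancel_left₀ (Complex.exp_ne_zero _)]
  rw [windingNr, loopIntegral]
  simp only [h1]
  rw [intervalIntegral.integral_eq_sub_of_hasDerivAt (fun x _ => hder x)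
    (hcd.intervalIntegrable _ _), h01, div_self Complex.two_pi_I_ne_zero]

/-- The open annulus `1/R < |z| < R`. -/
def annulus (R : ℝ) : Set ℂ := {z | R⁻¹ < ‖z‖ ∧ ‖z‖ < R}

theorem isOpen_annulus (R : ℝ) : IsOpen (annulus R) :=
  (isOpen_lt continuous_const continuous_norm).inter (isOpen_lt continuous_norm continuous_const)

theorem ne_zero_of_mem_annulus {R : ℝ} (hR : 0 < R) {z : ℂ} (h : z ∈ annulus R) : z ≠ 0 := by
  rintro rfl
  have := h.1
  rw [norm_zero, inv_lt_zero] at this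
  linarith

theorem mem_annulus_of_le {R R' : ℝ} (hR' : 0 < R') (h : R' < R) {z : ℂ} (h1 : R'⁻¹ ≤ ‖z‖)
    (h2 : ‖z‖ ≤ R') : z ∈ annulus R :=
  ⟨(inv_strictAnti₀ hR' h).trans_le h1, h2.trans_lt h⟩

/-- The circle of radius `ρ` about the origin. -/
noncomputable def circleLoop (ρ : ℝ) (x : ℝ) : ℂ := Complex.exp (Real.log ρ + 2 * Real.pi * Complex.I * x)

theorem norm_circleLoop {ρ : ℝ} (hρ : 0 < ρ) (x : ℝ) : ‖circleLoop ρ x‖ = ρ := by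
  rw [circleLoop, Complex.norm_exp]
  simp [Real.exp_log hρ]

theorem contDiff_circleLoop_exponent (ρ : ℝ) :
    ContDiff ℝ 1 fun x : ℝ => (Real.log ρ + 2 * Real.pi * Complex.I * x : ℂ) :=
  contDiff_const.add (contDiff_const.mul Complex.ofRealCLM.contDiff)

theorem isLoop_circleLoop (ρ : ℝ) : IsLoop (circleLoop ρ) := by
  refine contDiff_isLoop (Complex.contDiff_exp.comp (contDiff_circleLoop_exponent ρ)) ?_
  simp only [circleLoop]
  rw [Complex.exp_add, Complex.exp_add]
  simp [Complex.exp_two_pi_mul_I]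

theorem windingNr_circleLoop_zero (ρ : ℝ) : windingNr (circleLoop ρ) 0 = 1 :=
  windingNr_exp (contDiff_circleLoop_exponent ρ) (by push_cast; ring)

theorem windingNr_circleLoop_of_lt {ρ : ℝ} {a : ℂ} (ha : ‖a‖ < ρ) :
    windingNr (circleLoop ρ) a = 1 := by
  rw [← windingNr_circleLoop_zero ρ]
  refine (isLoop_circleLoop ρ).windingNr_eq_of_small fun x _ => ?_
  rwa [norm_circleLoop ((norm_nonneg a).trans_lt ha)]

theorem windingNr_circleLoop_of_gt {ρ : ℝ} (hρ : 0 < ρ) {a : ℂ} (ha : ρ < ‖a‖) :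
    windingNr (circleLoop ρ) a = 0 :=
  (isLoop_circleLoop ρ).windingNr_eq_zero_of_large fun x _ => by rwa [norm_circleLoop hρ]

/-- Winding numbers need comparison only at 0 and at the points of `P`: beyond the annulus they are
0, and inside its hole they equal the winding number about 0. -/
theorem loopIntegral_eq_on_annulus {R : ℝ} {P : Set ℂ} (hP : P.Finite) {f : ℂ → ℂ}
    (hf : DifferentiableOn ℂ f (annulus R \ P)) (h₁ : IsLoop γ₁) (h₂ : IsLoop γ₂)
    (m₁ : ∀ x ∈ Icc (0 : ℝ) 1, γ₁ x ∈ annulus R) (m₂ : ∀ x ∈ Icc (0 : ℝ) 1, γ₂ x ∈ annulus R)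
    (n₁ : ∀ x ∈ Icc (0 : ℝ) 1, γ₁ x ∉ P) (n₂ : ∀ x ∈ Icc (0 : ℝ) 1, γ₂ x ∉ P)
    (h0 : windingNr γ₁ 0 = windingNr γ₂ 0) (hw : ∀ a ∈ P, windingNr γ₁ a = windingNr γ₂ a) :
    loopIntegral γ₁ f = loopIntegral γ₂ f := by
  refine loopIntegral_eq_of_windingNr_eq ((isOpen_annulus R).sdiff hP.isClosed) hf h₁ h₂
    (fun x hx => ⟨m₁ x hx, n₁ x hx⟩) (fun x hx => ⟨m₂ x hx, n₂ x hx⟩) fun a ha => ?_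
  by_cases haP : a ∈ P
  · exact hw a haP
  by_cases h1 : R⁻¹ < ‖a‖
  · have h2 : R ≤ ‖a‖ := by
      by_contra h
      exact ha ⟨⟨h1, not_le.1 h⟩, haP⟩
    rw [h₁.windingNr_eq_zero_of_large fun x hx => (m₁ x hx).2.trans_le h2,
      h₂.windingNr_eq_zero_of_large fun x hx => (m₂ x hx).2.trans_le h2]
  · rw [not_lt] at h1
    rw [h₁.windingNr_eq_of_small fun x hx => h1.trans_lt (m₁ x hx).1,
      h₂.windingNr_eq_of_small fun x hx => h1.trans_lt (m₂ x hx).1, h0]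

/-- A parameter where γ takes the value a with nonzero derivative is isolated among such parameters,
and a set of isolated points of the line is countable. -/
theorem ae_deriv_eq_zero_of_eq (γ : ℝ → ℂ) (a : ℂ) : ∀ᵐ x : ℝ, γ x = a → deriv γ x = 0 := by
  have hc : {x : ℝ | x ∈ {x | γ x = a ∧ deriv γ x ≠ 0} ∧
      𝓝[{x | γ x = a ∧ deriv γ x ≠ 0} ∩ Ioi x] x = ⊥}.Countable :=
    countable_setOfPred_isolated_right_within
  filter_upwards [MeasureTheory.measure_eq_zero_iff_ae_notMem.1 (hc.measure_zero
    MeasureTheory.volume)] with x hx hxa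
  by_contra hne
  refine hx ⟨⟨hxa, hne⟩, ?_⟩
  have hd : HasDerivAt γ (deriv γ x) x :=
    (differentiableAt_of_deriv_ne_zero hne).hasDerivAt
  have hev := hd.eventually_ne (c := a) hne
  rw [← Filter.empty_mem_iff_bot]
  have h1 : 𝓝[{x | γ x = a ∧ deriv γ x ≠ 0} ∩ Ioi x] x ≤ 𝓝[≠] x :=
    nhdsWithin_mono x fun z hz => ne_of_gt hz.2
  filter_upwards [h1 hev, self_mem_nhdsWithin] with z h2 h3
  exact h2 h3.1.1

/-- An admissible contour may run through zeros of gamma factors where the elliptic integrand, as a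
quotient with x/0 = 0, has a wrong value. There are countably many such zeros, and they do not
affect the integral even if the curve rests at one of them. -/
theorem loopIntegral_congr_off_countable {B : Set ℂ} (hB : B.Countable) {f g : ℂ → ℂ}
    (h : ∀ x ∈ Icc (0 : ℝ) 1, γ x ∉ B → f (γ x) = g (γ x)) :
    loopIntegral γ f = loopIntegral γ g := by
  have h1 : ∀ᵐ x : ℝ, ∀ a ∈ B, γ x = a → deriv γ x = 0 :=
    (MeasureTheory.ae_ball_iff hB).2 fun a _ => ae_deriv_eq_zero_of_eq γ a
  refine intervalIntegral.integral_congr_ae ?_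
  filter_upwards [h1] with x hx hx'
  rw [uIoc_of_le zero_le_one] at hx'
  by_cases hxB : γ x ∈ B
  · rw [hx _ hxB rfl, mul_zero, mul_zero]
  · rw [h x (Ioc_subset_Icc_self hx') hxB]

theorem Separates.ne_zero {A : Set ℂ} (h : Separates γ A) {a : ℂ} (ha : a ∈ A) : a ≠ 0 := by
  rintro rfl
  have h1 := (h.2.1 0 (Or.inl rfl)).2
  have h2 := (h.2.2 0 ha).2
  rw [inv_zero] at h2
  exact zero_ne_one (h2.symm.trans h1)

/-- Otherwise a = 1/b would have winding number both 1 and 0. The converse is `exists_separates`. -/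
theorem Separates.mul_ne_one {A : Set ℂ} (h : Separates γ A) {a b : ℂ} (ha : a ∈ A) (hb : b ∈ A) :
    a * b ≠ 1 := by
  intro hab
  have h1 := (h.2.1 a (Or.inr ha)).2
  have h2 := (h.2.2 b hb).2
  rw [← eq_inv_of_mul_eq_one_left hab] at h2
  exact zero_ne_one (h2.symm.trans h1)

theorem Separates.mono {A B : Set ℂ} (h : Separates γ A) (hBA : B ⊆ A) : Separates γ B :=
  ⟨h.1, fun a ha => h.2.1 a (ha.imp_right fun hb => hBA hb), fun a ha => h.2.2 a (hBA ha)⟩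

/-- A tolerance relative to ‖a‖ controls a and 1/a at once, since |z - 1/a| = |1 - a z| / |a|.
Compactness bounds |z - a| and |1 - a z| below along the curve, even if `A` accumulates at 0. -/
theorem Separates.exists_perturbation {A : Set ℂ} (h : Separates γ A)
    (hK : IsCompact (insert 0 A)) : ∃ δ > 0, ∀ A' : Set ℂ,
      (∀ a' ∈ A', ∃ a ∈ A, ‖a' - a‖ ≤ δ * ‖a‖) → Separates γ A' := by
  have hl := h.1
  have hcpt : IsCompact (insert 0 A ×ˢ (γ '' Icc 0 1)) := hK.prod hl.isCompact_image
  have hne : (insert 0 A ×ˢ (γ '' Icc 0 1)).Nonempty :=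
    ⟨(0, γ 0), mem_insert 0 A, mem_image_of_mem γ (by simp)⟩
  have key : ∀ g : ℂ × ℂ → ℂ, Continuous g → (∀ p ∈ insert 0 A ×ˢ (γ '' Icc 0 1), g p ≠ 0) →
      ∃ c > 0, ∀ p ∈ insert 0 A ×ˢ (γ '' Icc 0 1), c ≤ ‖g p‖ := by
    intro g hg hg0
    obtain ⟨p, hp, hmin⟩ := hcpt.exists_isMinOn hne hg.norm.continuousOn
    exact ⟨‖g p‖, norm_pos_iff.2 (hg0 p hp), fun p' hp' => hmin hp'⟩
  obtain ⟨c₁, hc₁, h₁⟩ := key (fun p => p.2 - p.1) (by fun_prop) (by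
    rintro ⟨a, _⟩ ⟨ha, x, hx, rfl⟩
    exact sub_ne_zero.2 ((h.2.1 a ha).1 x hx))
  obtain ⟨c₂, hc₂, h₂⟩ := key (fun p => 1 - p.1 * p.2) (by fun_prop) (by
    rintro ⟨a, _⟩ ⟨ha, x, hx, rfl⟩ h0
    have h0' : 1 = a * γ x := sub_eq_zero.1 h0
    rcases ha with rfl | ha
    · simp at h0'
    · exact (h.2.2 a ha).1 x hx (eq_inv_of_mul_eq_one_right h0'.symm))
  obtain ⟨B, hB⟩ := hK.exists_bound_of_continuousOn (f := fun z : ℂ => z) continuousOn_id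
  have hB0 : 0 ≤ B := (norm_nonneg _).trans (hB 0 (mem_insert _ _))
  -- The bound 1/2 gives ‖a'‖ ≥ ‖a‖/2; c₂/4 then controls the reciprocals, and c₁/(2(B+1)) the
  -- points themselves.
  refine ⟨min (1 / 2) (min (c₂ / 4) (c₁ / (2 * (B + 1)))), by positivity, fun A' hA' => ?_⟩
  set δ := min (1 / 2) (min (c₂ / 4) (c₁ / (2 * (B + 1)))) with hδ
  have hδ1 : δ ≤ 1 / 2 := min_le_left _ _
  have hδ2 : δ ≤ c₂ / 4 := (min_le_right _ _).trans (min_le_left _ _)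
  have hδ3 : δ ≤ c₁ / (2 * (B + 1)) := (min_le_right _ _).trans (min_le_right _ _)
  have hδ0 : 0 < δ := by positivity
  refine ⟨hl, ?_, ?_⟩
  · rintro a' (rfl | ha')
    · exact h.2.1 0 (Or.inl rfl)
    obtain ⟨a, ha, hd⟩ := hA' a' ha'
    have hfar : ∀ x ∈ Icc (0 : ℝ) 1, ‖a' - a‖ < ‖γ x - a‖ := by
      intro x hx
      have h3 := h₁ (a, γ x) ⟨mem_insert_of_mem _ ha, mem_image_of_mem γ hx⟩
      have h4 : δ * ‖a‖ ≤ c₁ / (2 * (B + 1)) * (B + 1) := by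
        have := hB a (mem_insert_of_mem _ ha)
        gcongr
        linarith
      have h5 : c₁ / (2 * (B + 1)) * (B + 1) = c₁ / 2 := by field_simp
      simp only at h3
      linarith
    exact ⟨ne_of_forall_far hfar, by
      rw [hl.windingNr_eq_of_near hfar]; exact (h.2.1 a (Or.inr ha)).2⟩
  · intro a' ha'
    obtain ⟨a, ha, hd⟩ := hA' a' ha'
    have ha0 : a ≠ 0 := h.ne_zero ha
    have hap : 0 < ‖a‖ := norm_pos_iff.2 ha0
    have ha'2 : ‖a‖ / 2 ≤ ‖a'‖ := by
      have h3 := norm_sub_norm_le a a'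
      rw [norm_sub_rev] at h3
      nlinarith
    have ha'p : 0 < ‖a'‖ := by linarith
    have ha'0 : a' ≠ 0 := norm_pos_iff.1 ha'p
    have hfar : ∀ x ∈ Icc (0 : ℝ) 1, ‖a'⁻¹ - a⁻¹‖ < ‖γ x - a⁻¹‖ := by
      intro x hx
      have h3 := h₂ (a, γ x) ⟨mem_insert_of_mem _ ha, mem_image_of_mem γ hx⟩
      have h4 : a'⁻¹ - a⁻¹ = (a - a') / a' / a := by field_simp
      have h5 : γ x - a⁻¹ = -(1 - a * γ x) / a := by field_simp; ring
      rw [h4, h5, norm_div, norm_div (-(1 - a * γ x)), norm_neg]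
      refine div_lt_div_of_pos_right (lt_of_lt_of_le ?_ h3) hap
      rw [norm_div, div_lt_iff₀ ha'p, norm_sub_rev]
      nlinarith
    exact ⟨ne_of_forall_far hfar, by
      rw [hl.windingNr_eq_of_near hfar]; exact (h.2.2 a ha).2⟩

end AnnulusLoops

/-! ### Existence of separating contours -/

section Existence

/-- The direction in which the logarithmic spiral of slope `m` through `z` meets the unit circle. -/
noncomputable def spiralDir (m : ℝ) (z : ℂ) : ℂ :=
  z / ‖z‖ * Complex.exp (m * Real.log ‖z‖ * Complex.I)

/-- For equal moduli the directions never agree. Otherwise, with d = log‖a‖ - log‖c‖ ≠ 0, agreement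
fixes e^{imd}, hence m modulo 2π/d. So a single slope serves for finitely many pairs of points. -/
theorem countable_spiralDir_eq {a c : ℂ} (ha : a ≠ 0) (hc : c ≠ 0) (hac : a ≠ c) :
    {m : ℝ | spiralDir m a = spiralDir m c}.Countable := by
  have ha' : (‖a‖ : ℂ) ≠ 0 := by exact_mod_cast norm_ne_zero_iff.2 ha
  have hc' : (‖c‖ : ℂ) ≠ 0 := by exact_mod_cast norm_ne_zero_iff.2 hc
  rcases eq_or_ne ‖a‖ ‖c‖ with h | h
  · convert countable_empty (α := ℝ)
    rw [eq_empty_iff_forall_notMem]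
    intro m hm
    simp only [mem_ofPred_eq, spiralDir, h] at hm
    exact hac ((div_left_inj' hc').1 (mul_right_cancel₀ (Complex.exp_ne_zero _) hm))
  set d : ℝ := Real.log ‖a‖ - Real.log ‖c‖ with hd
  have hd0 : d ≠ 0 := sub_ne_zero.2 fun h' => h (Real.log_injOn_pos
    (norm_pos_iff.2 ha) (norm_pos_iff.2 hc) h')
  rcases {m : ℝ | spiralDir m a = spiralDir m c}.eq_empty_or_nonempty with he | ⟨m₀, hm₀⟩
  · rw [he]
    exact countable_empty
  refine (countable_range fun n : ℤ => m₀ + 2 * Real.pi * n / d).mono fun m hm => ?_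
  have key : ∀ m : ℝ, spiralDir m a = spiralDir m c →
      Complex.exp (m * d * Complex.I) = (c / ‖c‖) / (a / ‖a‖) := by
    intro m hm
    simp only [spiralDir] at hm
    have h1 : (m * d * Complex.I : ℂ) = m * Real.log ‖a‖ * Complex.I -
        m * Real.log ‖c‖ * Complex.I := by
      rw [hd]
      push_cast
      ring
    rw [h1, Complex.exp_sub, div_eq_div_iff (Complex.exp_ne_zero _) (by positivity), mul_comm, hm]
  have h1 : Complex.exp (m * d * Complex.I - m₀ * d * Complex.I) = 1 := by
    rw [Complex.exp_sub, key m hm, key m₀ hm₀, div_self]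
    positivity
  obtain ⟨n, hn⟩ := Complex.exp_eq_one_iff.1 h1
  refine ⟨n, ?_⟩
  have h2 : ((m * d - m₀ * d : ℝ) : ℂ) = ((n * (2 * Real.pi) : ℝ) : ℂ) := by
    push_cast
    have := Complex.I_ne_zero
    apply mul_right_cancel₀ this
    linear_combination hn
  have h3 := Complex.ofReal_injective h2
  simp only
  field_simp
  linarith

/-- The closed curve that meets the spiral of slope `m` with direction `e^{iφ}` in its point of
modulus `e^{h φ}`. -/
noncomputable def spiralLoop (h : ℝ → ℝ) (m : ℝ) (x : ℝ) : ℂ :=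
  Complex.exp (h (2 * Real.pi * x) + (2 * Real.pi * x - m * h (2 * Real.pi * x)) * Complex.I)

variable {h : ℝ → ℝ} {m : ℝ}

theorem norm_spiralLoop (h : ℝ → ℝ) (m x : ℝ) :
    ‖spiralLoop h m x‖ = Real.exp (h (2 * Real.pi * x)) := by
  rw [spiralLoop, Complex.norm_exp]
  simp

theorem contDiff_spiral_exponent (hh : ContDiff ℝ 1 h) (m : ℝ) : ContDiff ℝ 1 fun x : ℝ =>
    (h (2 * Real.pi * x) + (2 * Real.pi * x - m * h (2 * Real.pi * x)) * Complex.I : ℂ) := by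
  have h1 : ContDiff ℝ 1 fun x : ℝ => (h (2 * Real.pi * x) : ℂ) :=
    Complex.ofRealCLM.contDiff.comp (hh.comp (contDiff_const.mul contDiff_id))
  exact h1.add (((contDiff_const.mul Complex.ofRealCLM.contDiff).sub
    (contDiff_const.mul h1)).mul contDiff_const)

theorem isLoop_spiralLoop (hh : ContDiff ℝ 1 h) (hp : Function.Periodic h (2 * Real.pi)) :
    IsLoop (spiralLoop h m) := by
  refine contDiff_isLoop (Complex.contDiff_exp.comp (contDiff_spiral_exponent hh m)) ?_
  have h1 : h (2 * Real.pi) = h 0 := by simpa using hp 0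
  simp only [spiralLoop, mul_zero, mul_one, h1]
  rw [Complex.exp_eq_exp_iff_exists_int]
  refine ⟨-1, ?_⟩
  push_cast
  ring

theorem windingNr_spiralLoop_zero (hh : ContDiff ℝ 1 h) (hp : Function.Periodic h (2 * Real.pi)) :
    windingNr (spiralLoop h m) 0 = 1 := by
  refine windingNr_exp (contDiff_spiral_exponent hh m) ?_
  have h1 : h (2 * Real.pi) = h 0 := by simpa using hp 0
  simp only [mul_zero, mul_one, h1]
  push_cast
  ring

/-- The point of modulus `e^r` on the spiral of slope `m` with direction `e^{iα}`. -/
noncomputable def spiralPoint (m α r : ℝ) : ℂ := Complex.exp (r + (α - m * r) * Complex.I)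

theorem norm_spiralPoint (m α r : ℝ) : ‖spiralPoint m α r‖ = Real.exp r := by
  rw [spiralPoint, Complex.norm_exp]
  simp

theorem spiralLoop_ne_spiralPoint (hp : Function.Periodic h (2 * Real.pi)) {α r : ℝ}
    (hr : r ≠ h α) (x : ℝ) : spiralLoop h m x ≠ spiralPoint m α r := by
  intro heq
  have hn : h (2 * Real.pi * x) = r := by
    have := congrArg norm heq
    rw [norm_spiralLoop, norm_spiralPoint] at this
    exact Real.exp_injective this
  rw [spiralLoop, spiralPoint, hn, Complex.exp_eq_exp_iff_exists_int] at heq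
  obtain ⟨n, hn'⟩ := heq
  have h1 : ((2 * Real.pi * x : ℝ) : ℂ) = ((α + n * (2 * Real.pi) : ℝ) : ℂ) := by
    push_cast
    apply mul_right_cancel₀ Complex.I_ne_zero
    linear_combination hn'
  have h2 : 2 * Real.pi * x = α + n * (2 * Real.pi) := Complex.ofReal_injective h1
  rw [h2, hp.int_mul n α] at hn
  exact hr hn.symm

/-- Along a spiral the loop is met only at r = h α. On either side the winding number is locally
constant, so its derivative in r is 0. -/
theorem windingNr_spiralPoint_const (hh : ContDiff ℝ 1 h)
    (hp : Function.Periodic h (2 * Real.pi)) {α : ℝ} {S : Set ℝ} (hS : IsOpen S)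
    (hS' : IsPreconnected S) (hα : h α ∉ S) {r s : ℝ} (hr : r ∈ S) (hs : s ∈ S) :
    windingNr (spiralLoop h m) (spiralPoint m α r) =
      windingNr (spiralLoop h m) (spiralPoint m α s) := by
  have hl : IsLoop (spiralLoop h m) := isLoop_spiralLoop hh hp
  have hev : ∀ r ∈ S, ∀ᶠ s in 𝓝 r, windingNr (spiralLoop h m) (spiralPoint m α s) =
      windingNr (spiralLoop h m) (spiralPoint m α r) := by
    intro r hr
    have hc : Continuous fun r : ℝ => spiralPoint m α r := by
      unfold spiralPoint
      fun_prop
    have := hc.continuousAt (x := r) |>.eventually (hl.eventually_far (a := spiralPoint m α r)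
      fun x _ => spiralLoop_ne_spiralPoint hp (fun h => hα (h ▸ hr)) x)
    filter_upwards [this] with s hs using hl.windingNr_eq_of_near hs
  have hd : ∀ r ∈ S, HasDerivAt (fun r => windingNr (spiralLoop h m) (spiralPoint m α r)) 0 r :=
    fun r hr => (hasDerivAt_const r _).congr_of_eventuallyEq (hev r hr)
  exact hS.is_const_of_deriv_eq_zero hS' (fun r hr => (hd r hr).differentiableAt.differentiableWithinAt)
    (fun r hr => (hd r hr).deriv) hr hs

theorem windingNr_spiralPoint_of_lt (hh : ContDiff ℝ 1 h)
    (hp : Function.Periodic h (2 * Real.pi)) {L : ℝ} (hL : ∀ φ, -L ≤ h φ) {α r : ℝ}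
    (hr : r < h α) : windingNr (spiralLoop h m) (spiralPoint m α r) = 1 := by
  have h1 := windingNr_spiralPoint_const (m := m) hh hp (α := α) isOpen_Iio isPreconnected_Iio
    (lt_irrefl (h α)) (mem_Iio.2 hr)
    (mem_Iio.2 (show -L - 1 < h α by linarith [hL α]))
  rw [h1, ← windingNr_spiralLoop_zero (m := m) hh hp]
  refine (isLoop_spiralLoop hh hp).windingNr_eq_of_small fun x _ => ?_
  rw [norm_spiralPoint, norm_spiralLoop, Real.exp_lt_exp]
  linarith [hL (2 * Real.pi * x)]

theorem windingNr_spiralPoint_of_gt (hh : ContDiff ℝ 1 h)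
    (hp : Function.Periodic h (2 * Real.pi)) {L : ℝ} (hL : ∀ φ, h φ ≤ L) {α r : ℝ}
    (hr : h α < r) : windingNr (spiralLoop h m) (spiralPoint m α r) = 0 := by
  have h1 := windingNr_spiralPoint_const (m := m) hh hp (α := α) isOpen_Ioi isPreconnected_Ioi
    (lt_irrefl (h α)) (mem_Ioi.2 hr)
    (mem_Ioi.2 (show h α < L + 1 by linarith [hL α]))
  rw [h1]
  refine (isLoop_spiralLoop hh hp).windingNr_eq_zero_of_large fun x _ => ?_
  rw [norm_spiralPoint, norm_spiralLoop, Real.exp_lt_exp]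
  linarith [hL (2 * Real.pi * x)]

theorem exists_spiralPoint (m : ℝ) {a : ℂ} (ha : a ≠ 0) :
    ∃ α : ℝ, spiralPoint m α (Real.log ‖a‖) = a ∧
      Complex.exp (α * Complex.I) = spiralDir m a := by
  have hap : 0 < ‖a‖ := norm_pos_iff.2 ha
  have h1 : Complex.exp (Real.log ‖a‖ + a.arg * Complex.I) = a := by
    rw [Complex.exp_add, ← Complex.ofReal_exp, Real.exp_log hap]
    exact Complex.norm_mul_exp_arg_mul_I a
  refine ⟨a.arg + m * Real.log ‖a‖, ?_, ?_⟩
  · rw [spiralPoint]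
    push_cast
    rw [add_sub_cancel_right]
    exact h1
  · rw [spiralDir]
    push_cast
    rw [add_mul, Complex.exp_add]
    congr 1
    rw [eq_div_iff (by exact_mod_cast hap.ne'), mul_comm]
    exact Complex.norm_mul_exp_arg_mul_I a

/-- If poles and reciprocals never lie on a common ray, a loop that is a graph over the circle of
directions separates them: it passes far out over the poles and close to 0 over the reciprocals.
Rays are replaced by spirals of a common slope, chosen so that none contains both one of the
finitely many poles of modulus at least 1/R and a reciprocal of such a pole. Smaller poles lie
inside every loop with moduli in [1/R, R], and their reciprocals outside. -/
theorem exists_separates {A : Set ℂ} {R : ℝ} (hR : 1 < R) (hfin : {a ∈ A | R⁻¹ ≤ ‖a‖}.Finite)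
    (hA : ∀ a ∈ A, ‖a‖ < R) (h0 : ∀ a ∈ A, a ≠ 0) (hne : ∀ a ∈ A, ∀ b ∈ A, a * b ≠ 1) :
    ∃ γ, Separates γ A ∧ ∀ x, R⁻¹ ≤ ‖γ x‖ ∧ ‖γ x‖ ≤ R := by
  have hR0 : 0 < R := by linarith
  set L := Real.log R with hL
  have hLpos : 0 < L := Real.log_pos hR
  set P := {a ∈ A | R⁻¹ ≤ ‖a‖} with hP
  obtain ⟨m, hm⟩ : ∃ m : ℝ, ∀ a ∈ P, ∀ b ∈ P, spiralDir m a ≠ spiralDir m b⁻¹ := by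
    have hbad : (⋃ a ∈ P, ⋃ b ∈ P, {m : ℝ | spiralDir m a = spiralDir m b⁻¹}).Countable :=
      hfin.countable.biUnion fun a ha => hfin.countable.biUnion fun b hb =>
        countable_spiralDir_eq (h0 a ha.1) (inv_ne_zero (h0 b hb.1)) fun hab =>
          hne a ha.1 b hb.1 (by rw [hab, inv_mul_cancel₀ (h0 b hb.1)])
    obtain ⟨m, hm⟩ := (hbad.dense_compl ℝ).nonempty
    refine ⟨m, fun a ha b hb hab => hm ?_⟩
    simp only [mem_iUnion]
    exact ⟨a, ha, b, hb, hab⟩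
  have hPc : IsClosed (spiralDir m '' P) := (hfin.image _).isClosed
  have hQc : IsClosed ((fun b => spiralDir m b⁻¹) '' P) := (hfin.image _).isClosed
  have hdisj : Disjoint ((fun b => spiralDir m b⁻¹) '' P) (spiralDir m '' P) := by
    rw [disjoint_left]
    rintro _ ⟨b, hb, rfl⟩ ⟨a, ha, hab⟩
    exact hm a ha b hb hab
  obtain ⟨f, hf0, hf1, hf01⟩ := exists_contMDiffMap_zero_one_of_isClosed
    (modelWithCornersSelf ℝ ℂ) (n := 1) hQc hPc hdisj
  have hfd : ContDiff ℝ 1 f := contMDiff_iff_contDiff.1 f.contMDiff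
  -- The modulus e^h is R in the directions of the poles, 1/R in those of the reciprocals, and
  -- always in between.
  set h : ℝ → ℝ := fun φ => L * (2 * f (Complex.exp (φ * Complex.I)) - 1) with hh
  have hcd : ContDiff ℝ 1 h := by
    have h1 : ContDiff ℝ 1 fun φ : ℝ => Complex.exp (φ * Complex.I) :=
      Complex.contDiff_exp.comp (Complex.ofRealCLM.contDiff.mul contDiff_const)
    exact contDiff_const.mul ((contDiff_const.mul (hfd.comp h1)).sub contDiff_const)
  have hper : Function.Periodic h (2 * Real.pi) := by
    intro φ
    simp only [hh]
    push_cast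
    rw [add_mul, Complex.exp_add, Complex.exp_two_pi_mul_I, mul_one]
  have hlow : ∀ φ, -L ≤ h φ := fun φ => by
    have := (hf01 (Complex.exp (φ * Complex.I))).1
    simp only [hh]
    nlinarith
  have hup : ∀ φ, h φ ≤ L := fun φ => by
    have := (hf01 (Complex.exp (φ * Complex.I))).2
    simp only [hh]
    nlinarith
  have hl : IsLoop (spiralLoop h m) := isLoop_spiralLoop hcd hper
  have hnorm : ∀ x, R⁻¹ ≤ ‖spiralLoop h m x‖ ∧ ‖spiralLoop h m x‖ ≤ R := by
    intro x
    rw [norm_spiralLoop]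
    constructor
    · rw [← Real.exp_log hR0, ← Real.exp_neg, Real.exp_le_exp]
      exact hlow _
    · rw [← Real.le_log_iff_exp_le hR0]
      exact hup _
  refine ⟨spiralLoop h m, ⟨hl, ?_, ?_⟩, hnorm⟩
  · intro a ha
    by_cases hsmall : ‖a‖ < R⁻¹
    · have hs : ∀ x ∈ Icc (0 : ℝ) 1, ‖a‖ < ‖spiralLoop h m x‖ := fun x _ =>
        hsmall.trans_le (hnorm x).1
      refine ⟨fun x hx hxa => ?_, ?_⟩
      · have := hs x hx
        rw [hxa] at this
        exact lt_irrefl _ this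
      · rw [hl.windingNr_eq_of_small hs, windingNr_spiralLoop_zero hcd hper]
    · have ha0 : a ≠ 0 := by
        rintro rfl
        rw [norm_zero] at hsmall
        exact hsmall (inv_pos.2 hR0)
      have haA : a ∈ A := ha.resolve_left ha0
      have haP : a ∈ P := ⟨haA, not_lt.1 hsmall⟩
      obtain ⟨α, hα1, hα2⟩ := exists_spiralPoint m ha0
      have hhα : h α = L := by
        simp only [hh]
        rw [hα2, hf1 (mem_image_of_mem _ haP)]
        simp only [Pi.one_apply]
        ring
      have hlt : Real.log ‖a‖ < h α := by
        rw [hhα]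
        exact Real.log_lt_log (norm_pos_iff.2 ha0) (hA a haA)
      rw [← hα1]
      exact ⟨fun x _ => spiralLoop_ne_spiralPoint hper hlt.ne x,
        windingNr_spiralPoint_of_lt hcd hper hlow hlt⟩
  · intro a ha
    have ha0 := h0 a ha
    have hap : 0 < ‖a‖ := norm_pos_iff.2 ha0
    by_cases hsmall : ‖a‖ < R⁻¹
    · have hs : ∀ x ∈ Icc (0 : ℝ) 1, ‖spiralLoop h m x‖ < ‖a⁻¹‖ := fun x _ => by
        refine (hnorm x).2.trans_lt ?_
        rw [norm_inv]
        exact (lt_inv_comm₀ hap hR0).1 hsmall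
      refine ⟨fun x hx hxa => ?_, hl.windingNr_eq_zero_of_large hs⟩
      have := hs x hx
      rw [hxa] at this
      exact lt_irrefl _ this
    · have haP : a ∈ P := ⟨ha, not_lt.1 hsmall⟩
      obtain ⟨α, hα1, hα2⟩ := exists_spiralPoint m (inv_ne_zero ha0)
      have hhα : h α = -L := by
        simp only [hh]
        rw [hα2, hf0 (mem_image_of_mem (fun b => spiralDir m b⁻¹) haP)]
        simp only [Pi.zero_apply]
        ring
      have hlt : h α < Real.log ‖a⁻¹‖ := by
        rw [hhα, norm_inv, Real.log_inv]
        have := Real.log_lt_log hap (hA a ha)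
        linarith
      rw [← hα1]
      exact ⟨fun x _ => spiralLoop_ne_spiralPoint hper hlt.ne' x,
        windingNr_spiralPoint_of_gt hcd hper hup hlt⟩

end Existence

/-! ### Partial fractions in z + 1/z and cancellation of residues -/

section PartialFractions

variable {Κ : Type*} [Fintype Κ] [DecidableEq Κ]

/-- The factor `(1 - a z)(1 - a / z)`. -/
noncomputable def pairFactor (a z : ℂ) : ℂ := (1 - a * z) * (1 - a / z)

theorem pairFactor_eq {a z : ℂ} (ha : a ≠ 0) (hz : z ≠ 0) :
    pairFactor a z = -a * ((z + z⁻¹) - (a + a⁻¹)) := by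
  rw [pairFactor]; field_simp; ring

/-- Each factor is linear in z + 1/z, so this is Lagrange interpolation of the constant 1 at the
nodes a_κ + 1/a_κ. The nodes are distinct because the a_κ are distinct and no product a_κ a_l is 1.
-/
theorem prod_pairFactor_inv [Nonempty Κ] {a : Κ → ℂ} (ha : ∀ κ, a κ ≠ 0)
    (hinj : Function.Injective a) (hne : ∀ κ l, a κ * a l ≠ 1) {z : ℂ} (hz : z ≠ 0)
    (hpf : ∀ κ, pairFactor (a κ) z ≠ 0) :
    (∏ κ, pairFactor (a κ) z)⁻¹ =
      ∑ κ, (∏ l ∈ Finset.univ.erase κ, pairFactor (a l) (a κ))⁻¹ * (pairFactor (a κ) z)⁻¹ := by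
  set v : Κ → ℂ := fun κ => a κ + (a κ)⁻¹ with hv
  have hvi : Set.InjOn v (Finset.univ : Finset Κ) := by
    intro κ _ l _ h
    by_contra hκl
    have h1 : (a κ - a l) * (a κ * a l - 1) = 0 := by
      have h2 : a κ + (a κ)⁻¹ = a l + (a l)⁻¹ := h
      have := ha κ
      have := ha l
      field_simp at h2
      linear_combination h2
    rcases mul_eq_zero.1 h1 with h2 | h2
    · exact hκl (hinj (sub_eq_zero.1 h2))
    · exact hne κ l (sub_eq_zero.1 h2)
  have hx : ∀ κ ∈ (Finset.univ : Finset Κ), z + z⁻¹ ≠ v κ := by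
    intro κ _ h
    exact hpf κ (by rw [pairFactor_eq (ha κ) hz, h, hv]; ring)
  have h1 := Lagrange.eval_interpolate_not_at_node (1 : Κ → ℂ) hx
  rw [Lagrange.interpolate_one hvi Finset.univ_nonempty, Polynomial.eval_one,
    Lagrange.eval_nodal] at h1
  have h2 : (∏ κ, pairFactor (a κ) z) = (∏ κ, -a κ) * ∏ κ, (z + z⁻¹ - v κ) := by
    rw [← Finset.prod_mul_distrib]
    exact Finset.prod_congr rfl fun κ _ => pairFactor_eq (ha κ) hz
  have h3 : ∀ κ, (∏ l ∈ Finset.univ.erase κ, pairFactor (a l) (a κ))⁻¹ * (pairFactor (a κ) z)⁻¹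
      = (∏ κ, -a κ)⁻¹ * (Lagrange.nodalWeight Finset.univ v κ * (z + z⁻¹ - v κ)⁻¹) := by
    intro κ
    have h4 : ∀ l, pairFactor (a l) (a κ) = -a l * (v κ - v l) := fun l => pairFactor_eq (ha l) (ha κ)
    simp only [h4]
    rw [pairFactor_eq (ha κ) hz, Finset.prod_mul_distrib, Lagrange.nodalWeight,
      Finset.prod_inv_distrib, ← Finset.mul_prod_erase _ _ (Finset.mem_univ κ)]
    simp only [mul_inv, hv]
    ring
  rw [h2, Finset.sum_congr rfl fun κ _ => h3 κ, ← Finset.mul_sum, mul_inv]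
  congr 1
  simp only [Pi.one_apply, mul_one] at h1
  exact inv_eq_of_mul_eq_one_right h1.symm

/-- The product `∏_l (1 - a_κ a_l) ∏_{l ≠ κ} (1 - a_l / a_κ)`. -/
noncomputable def residueDenom (a : Κ → ℂ) (κ : Κ) : ℂ :=
  (∏ l, (1 - a κ * a l)) * ∏ l ∈ Finset.univ.erase κ, (1 - a l / a κ)

theorem residueDenom_eq (a : Κ → ℂ) (κ : Κ) :
    residueDenom a κ = (∏ l ∈ Finset.univ.erase κ, pairFactor (a l) (a κ)) * (1 - a κ * a κ) := by
  rw [residueDenom, ← Finset.mul_prod_erase _ _ (Finset.mem_univ κ)]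
  simp only [pairFactor, Finset.prod_mul_distrib]
  rw [Finset.prod_congr rfl fun l _ => by rw [mul_comm (a κ) (a l)]]
  ring

theorem tendsto_sub_div_one_sub_sq {c w : ℂ} (h : w ^ 2 * c = 1) :
    Tendsto (fun z => (z - w) / (1 - z ^ 2 * c)) (𝓝[≠] w) (𝓝 (-w / 2)) := by
  have hw : w ≠ 0 := by rintro rfl; simp at h
  have hc : c = (w ^ 2)⁻¹ := eq_inv_of_mul_eq_one_right h
  have h1 : Tendsto (fun z => -w ^ 2 / (z + w)) (𝓝[≠] w) (𝓝 (-w ^ 2 / (w + w))) := by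
    refine Tendsto.mono_left ?_ nhdsWithin_le_nhds
    exact tendsto_const_nhds.div (Continuous.tendsto (by fun_prop) w)
      (by rw [← two_mul]; exact mul_ne_zero two_ne_zero hw)
  have h2 : -w ^ 2 / (w + w) = -w / 2 := by field_simp; norm_num
  rw [h2] at h1
  refine h1.congr' ?_
  have h3 : ∀ᶠ z in 𝓝[≠] w, z + w ≠ 0 :=
    nhdsWithin_le_nhds ((Continuous.continuousAt (by fun_prop)).eventually_ne
      (by rw [← two_mul]; exact mul_ne_zero two_ne_zero hw))
  filter_upwards [h3, self_mem_nhdsWithin] with z hz hzw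
  have h4 : z - w ≠ 0 := sub_ne_zero.2 hzw
  have h5 : 1 - z ^ 2 * c = -(z - w) * (z + w) / w ^ 2 := by rw [hc]; field_simp; ring
  rw [h5]
  field_simp

/-- As the a_κ are distinct, w² a_κ a_l = 1 determines l from κ, so each term has at most a simple
pole at w. The relation is an involution κ ↔ l, and the cofactors of P_κ and P_l in the two residues
are equal, so `hpair` makes them cancel. If κ is its own partner, then 2 P_κ(w) = 0. -/
theorem tendsto_sub_mul_sum_residue {a : Κ → ℂ} (ha : ∀ κ, a κ ≠ 0)
    (hinj : Function.Injective a) {w : ℂ} (hw : w ≠ 0) {P : Κ → ℂ → ℂ}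
    (hP : ∀ κ, ContinuousAt (P κ) w)
    (hpair : ∀ κ l, w ^ 2 * (a κ * a l) = 1 → P κ w + P l w = 0) :
    Tendsto (fun z => (z - w) * ∑ κ, P κ z / residueDenom (fun l => z * a l) κ) (𝓝[≠] w) (𝓝 0) := by
  classical
  have huniq : ∀ κ l l', w ^ 2 * (a κ * a l) = 1 → w ^ 2 * (a κ * a l') = 1 → l = l' := by
    intro κ l l' h h'
    have h1 : w ^ 2 * a κ ≠ 0 := mul_ne_zero (pow_ne_zero 2 hw) (ha κ)
    exact hinj (mul_left_cancel₀ h1 (by linear_combination h - h'))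
  set C : Κ → ℂ := fun κ => ∏ l ∈ Finset.univ.erase κ, (1 - a l / a κ) with hC
  have hC0 : ∀ κ, C κ ≠ 0 := fun κ => by
    refine Finset.prod_ne_zero_iff.2 fun l hl => sub_ne_zero.2 fun h => ?_
    rw [eq_div_iff (ha κ), one_mul] at h
    exact (Finset.mem_erase.1 hl).1 (hinj h.symm)
  have hden : ∀ z, z ≠ 0 → ∀ κ, residueDenom (fun l => z * a l) κ
      = (∏ l, (1 - z ^ 2 * (a κ * a l))) * C κ := by
    intro z hz κ
    rw [residueDenom]
    congr 1
    · exact Finset.prod_congr rfl fun l _ => by ring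
    · exact Finset.prod_congr rfl fun l _ => by rw [mul_div_mul_left _ _ hz]
  -- The partner of κ at the pinch w; the default value κ keeps π an involution.
  set π : Κ → Κ := fun κ => if h : ∃ l, w ^ 2 * (a κ * a l) = 1 then h.choose else κ with hπ
  have hπ1 : ∀ κ l, w ^ 2 * (a κ * a l) = 1 → π κ = l := by
    intro κ l h
    have hex : ∃ l, w ^ 2 * (a κ * a l) = 1 := ⟨l, h⟩
    simp only [hπ, dif_pos hex]
    exact huniq κ _ _ hex.choose_spec h
  set D : Κ → Κ → ℂ := fun κ l => (∏ m ∈ Finset.univ.erase l, (1 - w ^ 2 * (a κ * a m))) * C κ with hD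
  set L : Κ → ℂ := fun κ => if w ^ 2 * (a κ * a (π κ)) = 1
    then P κ w * (-w / 2) / D κ (π κ) else 0 with hL
  have hlim : ∀ κ, Tendsto (fun z => (z - w) * (P κ z / residueDenom (fun l => z * a l) κ))
      (𝓝[≠] w) (𝓝 (L κ)) := by
    intro κ
    have hPc : Tendsto (P κ) (𝓝[≠] w) (𝓝 (P κ w)) := (hP κ).tendsto.mono_left nhdsWithin_le_nhds
    have hz0 : ∀ᶠ z in 𝓝[≠] w, z ≠ 0 := nhdsWithin_le_nhds (continuousAt_id.eventually_ne hw)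
    have hprod : ∀ s : Finset Κ, Tendsto (fun z => (∏ m ∈ s, (1 - z ^ 2 * (a κ * a m))) * C κ)
        (𝓝[≠] w) (𝓝 ((∏ m ∈ s, (1 - w ^ 2 * (a κ * a m))) * C κ)) := by
      intro s
      refine Tendsto.mono_left (Continuous.tendsto ?_ w) nhdsWithin_le_nhds
      fun_prop
    by_cases h : w ^ 2 * (a κ * a (π κ)) = 1
    · have hDne : D κ (π κ) ≠ 0 := by
        refine mul_ne_zero (Finset.prod_ne_zero_iff.2 fun m hm => sub_ne_zero.2 fun h' => ?_) (hC0 κ)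
        exact (Finset.mem_erase.1 hm).1 (huniq κ _ _ h'.symm h)
      simp only [hL, if_pos h]
      have h1 := (hPc.mul (tendsto_sub_div_one_sub_sq h)).div (hprod (Finset.univ.erase (π κ))) hDne
      refine h1.congr' ?_
      filter_upwards [hz0] with z hz
      simp only [Pi.div_apply]
      rw [hden z hz, ← Finset.mul_prod_erase _ _ (Finset.mem_univ (π κ)), mul_div_assoc',
        mul_div_assoc', div_div, mul_assoc, mul_comm (P κ z)]
    · have hno : ∀ l, w ^ 2 * (a κ * a l) ≠ 1 := fun l hl => h (by rw [hπ1 κ l hl]; exact hl)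
      simp only [hL, if_neg h]
      have hDne : (∏ m, (1 - w ^ 2 * (a κ * a m))) * C κ ≠ 0 :=
        mul_ne_zero (Finset.prod_ne_zero_iff.2 fun m _ => sub_ne_zero.2 (hno m).symm) (hC0 κ)
      have hzw : Tendsto (fun z => z - w) (𝓝[≠] w) (𝓝 0) := by
        refine Tendsto.mono_left ?_ nhdsWithin_le_nhds
        simpa using (continuous_id.sub continuous_const).tendsto (f := fun z : ℂ => z - w) w
      have h1 := hzw.mul (hPc.div (hprod Finset.univ) hDne)
      rw [zero_mul] at h1
      refine h1.congr' ?_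
      filter_upwards [hz0] with z hz
      simp only [Pi.div_apply]
      rw [hden z hz]
  have hsum : ∑ κ, L κ = 0 := by
    refine Finset.sum_involution (fun κ _ => π κ) ?_ ?_ (fun _ _ => Finset.mem_univ _) ?_
    · intro κ _
      by_cases h : w ^ 2 * (a κ * a (π κ)) = 1
      · have h' : w ^ 2 * (a (π κ) * a κ) = 1 := by rw [mul_comm (a (π κ))]; exact h
        have hππ : π (π κ) = κ := hπ1 _ _ h'
        simp only [hL, hππ, if_pos h, if_pos h']
        -- From w² a_κ a_{πκ} = 1 follows a_m / a_κ = w² a_{πκ} a_m and the same with κ and πκ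
        -- interchanged. Thus the two products in `D` change places.
        have hDD : D (π κ) κ = D κ (π κ) := by
          have h2 : ∀ m, a m / a κ = w ^ 2 * (a (π κ) * a m) := fun m => by
            have := ha κ
            field_simp
            linear_combination -(a m) * h
          have h3 : ∀ m, a m / a (π κ) = w ^ 2 * (a κ * a m) := fun m => by
            have := ha (π κ)
            field_simp
            linear_combination -(a m) * h
          simp only [hD, hC, h2, h3]
          ring
        rw [hDD, ← add_div, ← add_mul, hpair κ (π κ) h, zero_mul, zero_div]
      · have hno : ∀ l, w ^ 2 * (a κ * a l) ≠ 1 := fun l hl => h (by rw [hπ1 κ l hl]; exact hl)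
        have hπκ : π κ = κ := by
          simp only [hπ]
          rw [dif_neg (not_exists.2 hno)]
        rw [hπκ]
        simp only [hL, if_neg h, add_zero]
    · intro κ _ hne hfix
      apply hne
      by_cases h : w ^ 2 * (a κ * a (π κ)) = 1
      · rw [hfix] at h
        have h2 := hpair κ κ h
        have h3 : P κ w = 0 := by linear_combination h2 / 2
        simp [hL, h3]
      · simp [hL, h]
    · intro κ _
      by_cases h : ∃ l, w ^ 2 * (a κ * a l) = 1
      · obtain ⟨l, hl⟩ := h
        rw [hπ1 κ l hl]
        exact hπ1 _ _ (by rw [mul_comm (a l)]; exact hl)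
      · have hπκ : π κ = κ := by
          simp only [hπ]
          rw [dif_neg h]
        rw [hπκ, hπκ]
  rw [← hsum]
  simp only [Finset.mul_sum]
  exact tendsto_finsetSum _ fun κ _ => hlim κ

end PartialFractions

/-! ### Separated contour integrals as sums of circle integrals -/

section ContourFormula

/-- The integral `∫_γ f(z) dz/(2πiz)`. -/
noncomputable def cInt (γ : ℝ → ℂ) (f : ℂ → ℂ) : ℂ :=
  loopIntegral γ (fun z => f z / (2 * Real.pi * Complex.I * z))

variable {γ γ₁ γ₂ : ℝ → ℂ} {R R' : ℝ}

theorem two_pi_I_mul_ne_zero {z : ℂ} (hz : z ≠ 0) : 2 * (Real.pi : ℂ) * Complex.I * z ≠ 0 :=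
  mul_ne_zero Complex.two_pi_I_ne_zero hz

theorem cInt_const_mul (c : ℂ) (f : ℂ → ℂ) : cInt γ (fun z => c * f z) = c * cInt γ f := by
  rw [cInt, cInt, ← loopIntegral_const_mul]
  simp only [mul_div_assoc]

theorem cInt_congr {f g : ℂ → ℂ} (h : ∀ x ∈ Icc (0 : ℝ) 1, f (γ x) = g (γ x)) :
    cInt γ f = cInt γ g :=
  loopIntegral_congr fun x hx => by rw [h x hx]

theorem continuousOn_div_two_pi_I {f : ℂ → ℂ} {s : Set ℂ} (hf : ContinuousOn f s)
    (h0 : ∀ z ∈ s, z ≠ 0) : ContinuousOn (fun z => f z / (2 * Real.pi * Complex.I * z)) s :=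
  hf.div (by fun_prop) fun z hz => two_pi_I_mul_ne_zero (h0 z hz)

theorem IsLoop.cInt_add (h : IsLoop γ) {f g : ℂ → ℂ} (h0 : ∀ z ∈ γ '' Icc 0 1, z ≠ 0)
    (hf : ContinuousOn f (γ '' Icc 0 1)) (hg : ContinuousOn g (γ '' Icc 0 1)) :
    cInt γ (fun z => f z + g z) = cInt γ f + cInt γ g := by
  rw [cInt, cInt, cInt, ← h.loopIntegral_add (continuousOn_div_two_pi_I hf h0)
    (continuousOn_div_two_pi_I hg h0)]
  simp only [add_div]

theorem IsLoop.cInt_sum {Κ : Type*} (h : IsLoop γ) (s : Finset Κ) {f : Κ → ℂ → ℂ}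
    (h0 : ∀ z ∈ γ '' Icc 0 1, z ≠ 0) (hf : ∀ κ ∈ s, ContinuousOn (f κ) (γ '' Icc 0 1)) :
    cInt γ (fun z => ∑ κ ∈ s, f κ z) = ∑ κ ∈ s, cInt γ (f κ) := by
  classical
  induction s using Finset.induction_on with
  | empty => simp [cInt, loopIntegral]
  | insert a s ha ih =>
    simp only [Finset.sum_insert ha]
    rw [h.cInt_add h0 (hf a (by simp))
      (continuousOn_finsetSum s fun κ hκ => hf κ (by simp [hκ])),
      ih fun κ hκ => hf κ (by simp [hκ])]

theorem cInt_eq_on_annulus (hR : 0 < R) {P : Set ℂ} (hP : P.Finite) {f : ℂ → ℂ}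
    (hf : DifferentiableOn ℂ f (annulus R \ P)) (h₁ : IsLoop γ₁) (h₂ : IsLoop γ₂)
    (m₁ : ∀ x ∈ Icc (0 : ℝ) 1, γ₁ x ∈ annulus R) (m₂ : ∀ x ∈ Icc (0 : ℝ) 1, γ₂ x ∈ annulus R)
    (n₁ : ∀ x ∈ Icc (0 : ℝ) 1, γ₁ x ∉ P) (n₂ : ∀ x ∈ Icc (0 : ℝ) 1, γ₂ x ∉ P)
    (h0 : windingNr γ₁ 0 = windingNr γ₂ 0) (hw : ∀ a ∈ P, windingNr γ₁ a = windingNr γ₂ a) :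
    cInt γ₁ f = cInt γ₂ f :=
  loopIntegral_eq_on_annulus hP (hf.fun_div (by fun_prop) fun _ hz =>
    two_pi_I_mul_ne_zero (ne_zero_of_mem_annulus hR hz.1)) h₁ h₂ m₁ m₂ n₁ n₂ h0 hw

theorem circleLoop_mem_annulus {ρ : ℝ} (hρ : 0 < ρ) (h1 : R⁻¹ < ρ) (h2 : ρ < R) (x : ℝ) :
    circleLoop ρ x ∈ annulus R := by
  rw [annulus, Set.mem_ofPred_eq, norm_circleLoop hρ]
  exact ⟨h1, h2⟩

/-- The zero of H at c cancels the only pole between the circles. -/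
theorem cInt_circleLoop_div_sub_eq (hR' : 1 < R') (hR : R' < R) {H : ℂ → ℂ}
    (hH : DifferentiableOn ℂ H (annulus R)) {c : ℂ} (hc1 : R'⁻¹ < ‖c‖) (hc2 : ‖c‖ < R')
    (hHc : H c = 0) :
    cInt (circleLoop R'⁻¹) (fun z => H z / (z - c)) = cInt (circleLoop R') (fun z => H z / (z - c)) := by
  have h0 : 0 < R' := by linarith
  have hlt : R⁻¹ < R'⁻¹ := inv_strictAnti₀ h0 hR
  have hlt1 : R'⁻¹ < 1 := inv_lt_one_of_one_lt₀ hR'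
  have hca : c ∈ annulus R := ⟨hlt.trans hc1, hc2.trans hR⟩
  have key : ∀ ρ : ℝ, 0 < ρ → ρ ≠ ‖c‖ →
      cInt (circleLoop ρ) (fun z => H z / (z - c)) = cInt (circleLoop ρ) (dslope H c) := by
    intro ρ hρ hne
    refine cInt_congr fun x _ => ?_
    have hx : circleLoop ρ x ≠ c := fun h => hne (by rw [← h, norm_circleLoop hρ])
    rw [dslope_of_ne _ hx, slope_def_field, hHc, sub_zero]
  rw [key _ (inv_pos.2 h0) hc1.ne, key _ h0 hc2.ne']
  refine cInt_eq_on_annulus (P := ∅) (h0.trans hR) Set.finite_empty ?_ (isLoop_circleLoop _)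
    (isLoop_circleLoop _) (fun x _ => ?_) (fun x _ => ?_) (fun _ _ => id) (fun _ _ => id) ?_
    (fun _ h => h.elim)
  · rw [sdiff_empty]
    exact (Complex.differentiableOn_dslope ((isOpen_annulus R).mem_nhds hca)).2 hH
  · exact circleLoop_mem_annulus (inv_pos.2 h0) hlt (by linarith) x
  · exact circleLoop_mem_annulus h0 (by linarith) hR x
  · rw [windingNr_circleLoop_zero, windingNr_circleLoop_zero]

/-- The value `(1 - a²) ∫ H(z) / ((1 - a z)(1 - a / z)) dz/(2πiz)` of a contour integral over a
contour separating `a` from its reciprocal, as a sum of integrals over circles. -/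
noncomputable def circlePair (R' : ℝ) (H : ℂ → ℂ) (a : ℂ) : ℂ :=
  cInt (circleLoop R'⁻¹) (fun z => H z / (1 - a * z)) +
    a * cInt (circleLoop R') (fun z => H z / (z - a))

theorem circlePair_eq_sub {H : ℂ → ℂ} {a : ℂ} (ha : a ≠ 0) : circlePair R' H a =
    a * cInt (circleLoop R') (fun z => H z / (z - a)) -
      a⁻¹ * cInt (circleLoop R'⁻¹) (fun z => H z / (z - a⁻¹)) := by
  have h1 : ∀ z, H z / (1 - a * z) = -a⁻¹ * (H z / (z - a⁻¹)) := by
    intro z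
    have h2 : z - a⁻¹ = -a⁻¹ * (1 - a * z) := by field_simp; ring
    rw [h2, mul_div_assoc', mul_div_mul_left _ _ (neg_ne_zero.2 (inv_ne_zero ha))]
  rw [circlePair]
  simp only [h1]
  rw [cInt_const_mul]
  ring

/-- In the form `circlePair_eq_sub`, each of the two expressions is an outer integral with pole at a
or b minus an inner integral with pole at the other. As H vanishes at both poles, inner and outer
integrals agree and everything cancels. -/
theorem circlePair_add_circlePair (hR' : 1 < R') (hR : R' < R) {H : ℂ → ℂ}
    (hH : DifferentiableOn ℂ H (annulus R)) {a b : ℂ} (hab : a * b = 1) (ha : ‖a‖ < R')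
    (hb : ‖b‖ < R') (hHa : H a = 0) (hHb : H b = 0) :
    circlePair R' H a + circlePair R' H b = 0 := by
  have ha0 : a ≠ 0 := left_ne_zero_of_mul_eq_one hab
  have hb0 : b ≠ 0 := right_ne_zero_of_mul_eq_one hab
  have hba : a⁻¹ = b := inv_eq_of_mul_eq_one_right hab
  have hba' : b⁻¹ = a := by rw [← hba, inv_inv]
  have h0 : 0 < R' := by linarith
  have ha1 : R'⁻¹ < ‖a‖ := by
    rw [← hba', norm_inv]
    exact inv_strictAnti₀ (norm_pos_iff.2 hb0) hb
  have hb1 : R'⁻¹ < ‖b‖ := by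
    rw [← hba, norm_inv]
    exact inv_strictAnti₀ (norm_pos_iff.2 ha0) ha
  rw [circlePair_eq_sub ha0, circlePair_eq_sub hb0, hba, hba',
    cInt_circleLoop_div_sub_eq hR' hR hH ha1 ha hHa, cInt_circleLoop_div_sub_eq hR' hR hH hb1 hb hHb]
  ring

theorem pairFactor_ne_zero_of_separates {A : Set ℂ} (hγ : Separates γ A) {a : ℂ} (ha : a ∈ A) {x : ℝ}
    (hx : x ∈ Icc (0 : ℝ) 1) : pairFactor a (γ x) ≠ 0 := by
  have ha0 := hγ.ne_zero ha
  have h0 := (hγ.2.1 0 (Or.inl rfl)).1 x hx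
  refine mul_ne_zero (sub_ne_zero.2 fun h => ?_) (sub_ne_zero.2 fun h => ?_)
  · exact (hγ.2.2 a ha).1 x hx (eq_inv_of_mul_eq_one_right h.symm)
  · rw [eq_div_iff h0, one_mul] at h
    exact (hγ.2.1 a (Or.inr ha)).1 x hx h

/-- (1 - a²)/((1 - az)(1 - a/z)) = 1/(1 - az) + a/(z - a). The first term has its pole at 1/a,
outside the contour, which can be replaced by the small circle; the second has it at a, inside, and
the large circle can be used. -/
theorem cInt_div_pairFactor (hR' : 1 < R') (hR : R' < R) {H : ℂ → ℂ}
    (hH : DifferentiableOn ℂ H (annulus R)) {a : ℂ} (ha : ‖a‖ < R')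
    (hγ : Separates γ {a}) (hγR : ∀ x ∈ Icc (0 : ℝ) 1, γ x ∈ annulus R) :
    (1 - a * a) * cInt γ (fun z => H z / pairFactor a z) = circlePair R' H a := by
  have h0 : 0 < R' := by linarith
  have hR0 : 0 < R := h0.trans hR
  have hlt : R⁻¹ < R'⁻¹ := inv_strictAnti₀ h0 hR
  have hlt1 : R'⁻¹ < 1 := inv_lt_one_of_one_lt₀ hR'
  have ha0 : a ≠ 0 := hγ.ne_zero rfl
  have hai : R'⁻¹ < ‖a⁻¹‖ := by rw [norm_inv]; exact inv_strictAnti₀ (norm_pos_iff.2 ha0) ha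
  have hγ0 : ∀ x ∈ Icc (0 : ℝ) 1, γ x ≠ 0 := fun x hx => (hγ.2.1 0 (Or.inl rfl)).1 x hx
  have hγa : ∀ x ∈ Icc (0 : ℝ) 1, γ x ≠ a := fun x hx => (hγ.2.1 a (Or.inr rfl)).1 x hx
  have hγi : ∀ x ∈ Icc (0 : ℝ) 1, γ x ≠ a⁻¹ := fun x hx => (hγ.2.2 a rfl).1 x hx
  have hne1 : ∀ z, z ≠ a⁻¹ → 1 - a * z ≠ 0 := fun z hz =>
    sub_ne_zero.2 fun h => hz (eq_inv_of_mul_eq_one_right h.symm)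
  have hc : ContinuousOn H (γ '' Icc 0 1) := hH.continuousOn.mono (by
    rintro _ ⟨x, hx, rfl⟩; exact hγR x hx)
  have h1 : cInt γ (fun z => H z / (1 - a * z)) =
      cInt (circleLoop R'⁻¹) (fun z => H z / (1 - a * z)) := by
    refine cInt_eq_on_annulus (P := {a⁻¹}) hR0 (Set.finite_singleton _) ?_ hγ.1
      (isLoop_circleLoop _) hγR (fun x _ => circleLoop_mem_annulus (inv_pos.2 h0) hlt (by linarith) x)
      hγi (fun x _ h => ?_) ?_ ?_
    · exact (hH.mono sdiff_subset).fun_div (by fun_prop) fun z hz => hne1 z hz.2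
    · have h := congrArg norm (Set.mem_singleton_iff.1 h)
      rw [norm_circleLoop (inv_pos.2 h0)] at h
      exact hai.ne h
    · rw [(hγ.2.1 0 (Or.inl rfl)).2, windingNr_circleLoop_zero]
    · rintro _ rfl
      rw [(hγ.2.2 a rfl).2, windingNr_circleLoop_of_gt (inv_pos.2 h0) hai]
  have h2 : cInt γ (fun z => H z / (z - a)) =
      cInt (circleLoop R') (fun z => H z / (z - a)) := by
    refine cInt_eq_on_annulus (P := {a}) hR0 (Set.finite_singleton _) ?_ hγ.1
      (isLoop_circleLoop _) hγR (fun x _ => circleLoop_mem_annulus h0 (by linarith) hR x)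
      hγa (fun x _ h => ?_) ?_ ?_
    · exact (hH.mono sdiff_subset).fun_div (by fun_prop) fun z hz => sub_ne_zero.2 hz.2
    · have h := congrArg norm (Set.mem_singleton_iff.1 h)
      rw [norm_circleLoop h0] at h
      exact ha.ne' h
    · rw [(hγ.2.1 0 (Or.inl rfl)).2, windingNr_circleLoop_zero]
    · rintro _ rfl
      rw [(hγ.2.1 _ (Or.inr rfl)).2, windingNr_circleLoop_of_lt ha]
  rw [circlePair, ← h1, ← h2, ← cInt_const_mul, ← cInt_const_mul, ← hγ.1.cInt_add]
  · refine cInt_congr fun x hx => ?_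
    have e1 := hne1 _ (hγi x hx)
    have e2 := sub_ne_zero.2 (hγa x hx)
    have e3 := hγ0 x hx
    have e4 : 1 - a / γ x = (γ x - a) / γ x := by field_simp
    rw [pairFactor, e4]
    field_simp
    ring
  · rintro _ ⟨x, hx, rfl⟩; exact hγ0 x hx
  · refine hc.div (by fun_prop) ?_
    rintro _ ⟨x, hx, rfl⟩; exact hne1 _ (hγi x hx)
  · refine continuousOn_const.mul (hc.div (by fun_prop) ?_)
    rintro _ ⟨x, hx, rfl⟩; exact sub_ne_zero.2 (hγa x hx)

theorem cInt_div_prod_pairFactor {Κ : Type*} [Fintype Κ] [DecidableEq Κ] [Nonempty Κ]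
    (hR' : 1 < R') (hR : R' < R) {H : ℂ → ℂ} (hH : DifferentiableOn ℂ H (annulus R)) {a : Κ → ℂ}
    (ha : ∀ κ, ‖a κ‖ < R') (hinj : Function.Injective a) (hγ : Separates γ (range a))
    (hγR : ∀ x ∈ Icc (0 : ℝ) 1, γ x ∈ annulus R) :
    cInt γ (fun z => H z / ∏ κ, pairFactor (a κ) z) =
      ∑ κ, circlePair R' H (a κ) / residueDenom a κ := by
  have hR0 : 0 < R := by linarith
  have ha0 : ∀ κ, a κ ≠ 0 := fun κ => hγ.ne_zero ⟨κ, rfl⟩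
  have hne : ∀ κ l, a κ * a l ≠ 1 := fun κ l => hγ.mul_ne_one ⟨κ, rfl⟩ ⟨l, rfl⟩
  have hc : ContinuousOn H (γ '' Icc 0 1) := hH.continuousOn.mono (by
    rintro _ ⟨x, hx, rfl⟩; exact hγR x hx)
  have h0 : ∀ z ∈ γ '' Icc 0 1, z ≠ 0 := by
    rintro _ ⟨x, hx, rfl⟩; exact ne_zero_of_mem_annulus hR0 (hγR x hx)
  have hpf : ∀ κ, ∀ x ∈ Icc (0 : ℝ) 1, pairFactor (a κ) (γ x) ≠ 0 := fun κ x hx =>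
    pairFactor_ne_zero_of_separates hγ ⟨κ, rfl⟩ hx
  have e1 : cInt γ (fun z => H z / ∏ κ, pairFactor (a κ) z) =
      cInt γ (fun z => ∑ κ, (∏ l ∈ Finset.univ.erase κ, pairFactor (a l) (a κ))⁻¹ *
        (H z / pairFactor (a κ) z)) := by
    refine cInt_congr fun x hx => ?_
    rw [div_eq_mul_inv, prod_pairFactor_inv ha0 hinj hne (h0 _ ⟨x, hx, rfl⟩) (fun κ => hpf κ x hx),
      Finset.mul_sum]
    exact Finset.sum_congr rfl fun κ _ => by ring
  rw [e1, hγ.1.cInt_sum _ h0]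
  · refine Finset.sum_congr rfl fun κ _ => ?_
    rw [cInt_const_mul, ← cInt_div_pairFactor hR' hR hH (ha κ)
      (hγ.mono (Set.singleton_subset_iff.2 ⟨κ, rfl⟩)) hγR, residueDenom_eq,
      mul_comm (1 - a κ * a κ), mul_div_mul_right _ _ (sub_ne_zero.2 (hne κ κ).symm), div_eq_inv_mul]
  · intro κ _
    refine continuousOn_const.mul (hc.div ?_ ?_)
    · change ContinuousOn (fun z => (1 - a κ * z) * (1 - a κ / z)) _
      exact ContinuousOn.mul (by fun_prop) (continuousOn_const.sub
        (continuousOn_const.div continuousOn_id h0))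
    · rintro _ ⟨x, hx, rfl⟩
      exact hpf κ x hx

end ContourFormula

/-! ### Gluing and removable singularities -/

section Extension

variable {X : Type*} [NormedAddCommGroup X] [NormedSpace ℂ X]

/-- The local extensions are continuous and agree with `I` on the dense set `S`. So each is the
limit of `I` along `S`, and this limit defines the global extension. -/
theorem exists_glue {Ω S : Set X} (hΩ : IsOpen Ω) (hSΩ : S ⊆ Ω) (hdense : Ω ⊆ closure S) {I : X → ℂ}
    (hloc : ∀ x₀ ∈ Ω, ∃ U ∈ 𝓝 x₀, ∃ F : X → ℂ, DifferentiableOn ℂ F U ∧ ∀ x ∈ S ∩ U, F x = I x) :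
    ∃ Φ : X → ℂ, DifferentiableOn ℂ Φ Ω ∧ ∀ x ∈ S, Φ x = I x := by
  have key : ∀ x₀ ∈ Ω, ∃ V, IsOpen V ∧ x₀ ∈ V ∧ ∃ F : X → ℂ, DifferentiableOn ℂ F V ∧
      (∀ x ∈ S ∩ V, F x = I x) ∧ ∀ x ∈ Ω ∩ V, limUnder (𝓝[S] x) I = F x := by
    intro x₀ hx₀
    obtain ⟨U, hU, F, hF, hFI⟩ := hloc x₀ hx₀
    obtain ⟨V, hVU, hV, hx₀V⟩ := mem_nhds_iff.1 hU
    refine ⟨V, hV, hx₀V, F, hF.mono hVU, fun x hx => hFI x ⟨hx.1, hVU hx.2⟩, fun x hx => ?_⟩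
    have : (𝓝[S] x).NeBot := mem_closure_iff_nhdsWithin_neBot.1 (hdense hx.1)
    refine Tendsto.limUnder_eq ?_
    have h1 : Tendsto F (𝓝[S] x) (𝓝 (F x)) :=
      ((hF.mono hVU).continuousOn.continuousAt (hV.mem_nhds hx.2)).tendsto.mono_left
        nhdsWithin_le_nhds
    refine h1.congr' ?_
    filter_upwards [self_mem_nhdsWithin, nhdsWithin_le_nhds (hV.mem_nhds hx.2)] with y hy hyV
    exact hFI y ⟨hy, hVU hyV⟩
  refine ⟨fun x => limUnder (𝓝[S] x) I, fun x hx => ?_, fun x hx => ?_⟩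
  · obtain ⟨V, hV, hxV, F, hF, -, hlim⟩ := key x hx
    refine DifferentiableAt.differentiableWithinAt ?_
    refine (hF.differentiableAt (hV.mem_nhds hxV)).congr_of_eventuallyEq ?_
    filter_upwards [hΩ.mem_nhds hx, hV.mem_nhds hxV] with y hy hyV
    exact hlim y ⟨hy, hyV⟩
  · obtain ⟨V, hV, hxV, F, hF, hFI, hlim⟩ := key x (hSΩ hx)
    exact (hlim x ⟨hSΩ hx, hxV⟩).trans (hFI x ⟨hx, hxV⟩)

/-- By Riemann's theorem the singularities in `Z` are removable. Filling them in changes f neither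
on the circle nor at the centre. -/
theorem cauchy_formula_of_removable {f : ℂ → ℂ} {c : ℂ} {r : ℝ} (hr : 0 < r) {Z : Set ℂ}
    (hZ : Z.Finite) (hZb : Z ⊆ Metric.ball c r) (hc : c ∉ Z)
    (hf : ∀ z ∈ Metric.closedBall c r, z ∉ Z → DifferentiableAt ℂ f z)
    (hlim : ∀ w ∈ Z, Tendsto (fun z => (z - w) * f z) (𝓝[≠] w) (𝓝 0)) :
    (2 * Real.pi * Complex.I : ℂ)⁻¹ • (∮ z in C(c, r), (z - c)⁻¹ • f z) = f c := by
  classical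
  set F : ℂ → ℂ := fun z => if z ∈ Z then limUnder (𝓝[≠] z) f else f z with hF
  have hdF : ∀ z ∈ Metric.closedBall c r, DifferentiableAt ℂ F z := by
    intro w hw
    by_cases hwZ : w ∈ Z
    · have hnear : ∀ᶠ z in 𝓝 w, z ∉ Z \ {w} :=
        (hZ.subset sdiff_subset).isClosed.isOpen_compl.mem_nhds fun h => h.2 rfl
      have hball : ∀ᶠ z in 𝓝 w, z ∈ Metric.ball c r := Metric.isOpen_ball.mem_nhds (hZb hwZ)
      have hs : {z | z ∉ Z \ {w} ∧ z ∈ Metric.ball c r} ∈ 𝓝 w := hnear.and hball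
      have h1 : DifferentiableOn ℂ f ({z | z ∉ Z \ {w} ∧ z ∈ Metric.ball c r} \ {w}) := by
        intro z hz
        exact (hf z (Metric.ball_subset_closedBall hz.1.2)
          fun h => hz.1.1 ⟨h, hz.2⟩).differentiableWithinAt
      have h2 : (fun z => f z - f w) =o[𝓝[≠] w] fun z => (z - w)⁻¹ := by
        rw [Asymptotics.isLittleO_iff_tendsto']
        · have h3 : Tendsto (fun z => (z - w) * f z - (z - w) * f w) (𝓝[≠] w) (𝓝 (0 - 0)) := by
            refine (hlim w hwZ).sub (Tendsto.mono_left ?_ nhdsWithin_le_nhds)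
            have : Continuous fun z : ℂ => (z - w) * f w := by fun_prop
            simpa using this.tendsto w
          rw [sub_zero] at h3
          refine h3.congr fun z => ?_
          rw [div_inv_eq_mul]; ring
        · filter_upwards [self_mem_nhdsWithin] with z hz h
          exact absurd (inv_eq_zero.1 h) (sub_ne_zero.2 hz)
      have h4 := (Complex.differentiableOn_update_limUnder_of_isLittleO hs h1 h2).differentiableAt hs
      refine h4.congr_of_eventuallyEq ?_
      filter_upwards [hnear] with z hz
      rcases eq_or_ne z w with rfl | hzw
      · simp [hF, hwZ]
      · rw [Function.update_of_ne hzw, hF]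
        exact if_neg fun h => hz ⟨h, hzw⟩
    · refine (hf w hw hwZ).congr_of_eventuallyEq ?_
      filter_upwards [hZ.isClosed.isOpen_compl.mem_nhds hwZ] with z hz
      exact if_neg hz
  have h1 := Complex.two_pi_I_inv_smul_circleIntegral_sub_inv_smul_of_differentiable_on_off_countable
    (s := ∅) (f := F) Set.countable_empty (Metric.mem_ball_self hr)
    (fun z hz => (hdF z hz).continuousAt.continuousWithinAt)
    fun z hz => hdF z (Metric.ball_subset_closedBall hz.1)
  have h2 : F c = f c := if_neg hc
  rw [← h2, ← h1]
  congr 1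
  refine circleIntegral.integral_congr hr.le fun z hz => ?_
  have hzZ : z ∉ Z := fun h => by
    have h3 := hZb h
    rw [Metric.mem_ball] at h3
    exact h3.ne hz
  simp only [hF, if_neg hzZ]

theorem dense_ne_zero (l : X →L[ℂ] ℂ) {v : X} (hv : l v ≠ 0) : Dense {x | l x ≠ 0} := by
  intro x
  by_cases hx : l x = 0
  · have h1 : Tendsto (fun c : ℂ => x + c • v) (𝓝[≠] 0) (𝓝 x) := by
      refine Tendsto.mono_left ?_ nhdsWithin_le_nhds
      have : Continuous fun c : ℂ => x + c • v := by fun_prop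
      simpa using this.tendsto 0
    refine mem_closure_of_tendsto h1 ?_
    filter_upwards [self_mem_nhdsWithin] with c hc
    simpa [hx] using ⟨hc, hv⟩
  · exact subset_closure hx

variable [ProperSpace X]

theorem IsLoop.cInt_differentiableOn {γ : ℝ → ℂ} (h : IsLoop γ) {V : Set X} (hV : IsOpen V)
    {f : X → ℂ → ℂ} (h0 : ∀ x ∈ Icc (0 : ℝ) 1, γ x ≠ 0)
    (hf : ∀ y ∈ V, ∀ x ∈ Icc (0 : ℝ) 1, DifferentiableAt ℂ (Function.uncurry f) (y, γ x)) :
    DifferentiableOn ℂ (fun y => cInt γ (f y)) V := by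
  have hd : ∀ y ∈ V, ∀ z ∈ γ '' Icc 0 1, DifferentiableAt ℂ
      (Function.uncurry fun y z => f y z / (2 * Real.pi * Complex.I * z)) (y, z) := by
    rintro y hy _ ⟨x, hx, rfl⟩
    exact (hf y hy x hx).complex_div (by fun_prop) (two_pi_I_mul_ne_zero (h0 x hx))
  refine h.differentiableOn_parametric hV (g := fun y z => f y z / (2 * Real.pi * Complex.I * z))
    (fun p hp => (hd p.1 hp.1 p.2 hp.2).continuousAt.continuousWithinAt) fun z hz y hy => ?_
  have h1 : DifferentiableAt ℂ (fun y : X => (y, z)) y := by fun_prop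
  exact ((hd y hy z hz).comp y h1).differentiableWithinAt

end Extension

/-! ### Holomorphic dependence of separated integrals on parameters -/

section Extension

variable {X : Type*} [NormedAddCommGroup X] [NormedSpace ℂ X]
  {Κ : Type*} [Fintype Κ] {R R' : ℝ}

theorem cInt_div_prod_eq_of_separates {γ₁ γ₂ : ℝ → ℂ} (hR : 0 < R) {H : ℂ → ℂ}
    (hH : DifferentiableOn ℂ H (annulus R)) {a : Κ → ℂ}
    (h₁ : Separates γ₁ (range a)) (h₂ : Separates γ₂ (range a))
    (m₁ : ∀ x ∈ Icc (0 : ℝ) 1, γ₁ x ∈ annulus R) (m₂ : ∀ x ∈ Icc (0 : ℝ) 1, γ₂ x ∈ annulus R) :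
    cInt γ₁ (fun z => H z / ∏ κ, pairFactor (a κ) z) =
      cInt γ₂ (fun z => H z / ∏ κ, pairFactor (a κ) z) := by
  have hav : ∀ {γ : ℝ → ℂ}, Separates γ (range a) → ∀ x ∈ Icc (0 : ℝ) 1,
      γ x ∉ range a ∪ range fun κ => (a κ)⁻¹ := by
    rintro γ h x hx (⟨κ, hκ⟩ | ⟨κ, hκ⟩)
    · exact (h.2.1 (a κ) (Or.inr ⟨κ, rfl⟩)).1 x hx hκ.symm
    · exact (h.2.2 (a κ) ⟨κ, rfl⟩).1 x hx hκ.symm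
  refine cInt_eq_on_annulus hR ((finite_range a).union (finite_range fun κ => (a κ)⁻¹)) ?_ h₁.1 h₂.1
    m₁ m₂ (hav h₁) (hav h₂) ?_ ?_
  · have hz0 : ∀ z ∈ annulus R \ (range a ∪ range fun κ => (a κ)⁻¹), z ≠ 0 := fun z hz =>
      ne_zero_of_mem_annulus hR hz.1
    refine (hH.mono sdiff_subset).fun_div (DifferentiableOn.complex_prod fun κ _ => ?_) fun z hz => ?_
    · change DifferentiableOn ℂ (fun z => (1 - a κ * z) * (1 - a κ / z)) _
      exact DifferentiableOn.fun_mul (by fun_prop)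
        (DifferentiableOn.fun_sub (by fun_prop) (DifferentiableOn.fun_div (by fun_prop)
          (by fun_prop) hz0))
    · refine Finset.prod_ne_zero_iff.2 fun κ _ => mul_ne_zero (sub_ne_zero.2 fun h => ?_)
        (sub_ne_zero.2 fun h => ?_)
      · exact hz.2 (Or.inr ⟨κ, (eq_inv_of_mul_eq_one_right h.symm).symm⟩)
      · rw [eq_div_iff (hz0 z hz), one_mul] at h
        exact hz.2 (Or.inl ⟨κ, h.symm⟩)
  · rw [(h₁.2.1 0 (Or.inl rfl)).2, (h₂.2.1 0 (Or.inl rfl)).2]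
  · rintro _ (⟨κ, rfl⟩ | ⟨κ, rfl⟩)
    · rw [(h₁.2.1 _ (Or.inr ⟨κ, rfl⟩)).2, (h₂.2.1 _ (Or.inr ⟨κ, rfl⟩)).2]
    · rw [(h₁.2.2 _ ⟨κ, rfl⟩).2, (h₂.2.2 _ ⟨κ, rfl⟩).2]

theorem exists_separates_range (hR' : 1 < R') (hR : R' < R) {a : Κ → ℂ} (ha0 : ∀ κ, a κ ≠ 0)
    (ha : ∀ κ, ‖a κ‖ < R') (hne : ∀ κ l, a κ * a l ≠ 1) :
    ∃ γ, Separates γ (range a) ∧ ∀ x ∈ Icc (0 : ℝ) 1, γ x ∈ annulus R := by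
  obtain ⟨γ, hγ, hγR⟩ := exists_separates (A := range a) hR'
    ((finite_range a).subset fun z hz => hz.1) (by rintro _ ⟨κ, rfl⟩; exact ha κ)
    (by rintro _ ⟨κ, rfl⟩; exact ha0 κ) (by rintro _ ⟨κ, rfl⟩ _ ⟨l, rfl⟩; exact hne κ l)
  exact ⟨γ, hγ, fun x _ => mem_annulus_of_le (by linarith) hR (hγR x).1 (hγR x).2⟩

theorem DifferentiableAt.complex_prod {ι : Type*} {f : ι → X → ℂ} {s : Finset ι} {x : X}
    (h : ∀ i ∈ s, DifferentiableAt ℂ (f i) x) : DifferentiableAt ℂ (fun x => ∏ i ∈ s, f i x) x := by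
  classical
  induction s using Finset.induction_on with
  | empty => simp
  | insert a s ha ih =>
    simp only [Finset.prod_insert ha]
    exact (h a (by simp)).fun_mul (ih fun i hi => h i (by simp [hi]))

theorem differentiableAt_pairFactor {a : X → ℂ} {y : X} (ha : DifferentiableAt ℂ a y) {z : ℂ}
    (hz : z ≠ 0) : DifferentiableAt ℂ (fun p : X × ℂ => pairFactor (a p.1) p.2) (y, z) := by
  have h1 : DifferentiableAt ℂ (fun p : X × ℂ => a p.1) (y, z) :=
    DifferentiableAt.comp (g := a) (f := Prod.fst) (y, z) ha differentiableAt_fst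
  have h2 : DifferentiableAt ℂ (fun p : X × ℂ => p.2) (y, z) := differentiableAt_snd
  exact ((differentiableAt_const 1).fun_sub (h1.fun_mul h2)).fun_mul
    ((differentiableAt_const 1).fun_sub (h1.complex_div h2 hz))

/-- A contour that separates the poles at x still does so for nearby parameters, so locally the
integral is taken over a fixed curve. -/
theorem exists_differentiableOn_separated [ProperSpace X] {Ω : Set X} (hΩ : IsOpen Ω) (hR' : 1 < R')
    (hR : R' < R) {a : Κ → X → ℂ} (had : ∀ κ, DifferentiableOn ℂ (a κ) Ω)
    (ha0 : ∀ x ∈ Ω, ∀ κ, a κ x ≠ 0) (ha : ∀ x ∈ Ω, ∀ κ, ‖a κ x‖ < R') {H : X → ℂ → ℂ}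
    (hH : DifferentiableOn ℂ (Function.uncurry H) (Ω ×ˢ annulus R)) :
    ∃ I : X → ℂ, DifferentiableOn ℂ I {x ∈ Ω | ∀ κ l, a κ x * a l x ≠ 1} ∧
      ∀ x ∈ Ω, ∀ γ, Separates γ (range fun κ => a κ x) →
        (∀ θ ∈ Icc (0 : ℝ) 1, γ θ ∈ annulus R) →
        I x = cInt γ (fun z => H x z / ∏ κ, pairFactor (a κ x) z) := by
  classical
  have hR0 : 0 < R := by linarith
  have hHx : ∀ x ∈ Ω, DifferentiableOn ℂ (H x) (annulus R) := by
    intro x hx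
    have h1 : DifferentiableOn ℂ (fun z : ℂ => (x, z)) (annulus R) := by fun_prop
    exact hH.comp h1 fun z hz => ⟨hx, hz⟩
  set I : X → ℂ := fun x => if h : ∃ γ, Separates γ (range fun κ => a κ x) ∧
      ∀ θ ∈ Icc (0 : ℝ) 1, γ θ ∈ annulus R
    then cInt h.choose (fun z => H x z / ∏ κ, pairFactor (a κ x) z) else 0 with hI
  have hIeq : ∀ x ∈ Ω, ∀ γ, Separates γ (range fun κ => a κ x) →
      (∀ θ ∈ Icc (0 : ℝ) 1, γ θ ∈ annulus R) →
      I x = cInt γ (fun z => H x z / ∏ κ, pairFactor (a κ x) z) := by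
    intro x hx γ h1 h2
    have hex : ∃ γ, Separates γ (range fun κ => a κ x) ∧
      ∀ θ ∈ Icc (0 : ℝ) 1, γ θ ∈ annulus R := ⟨γ, h1, h2⟩
    simp only [hI, dif_pos hex]
    exact cInt_div_prod_eq_of_separates hR0 (hHx x hx) hex.choose_spec.1 h1 hex.choose_spec.2 h2
  refine ⟨I, fun x hx => ?_, hIeq⟩
  obtain ⟨γ, hγ, hγR⟩ := exists_separates_range hR' hR (ha0 x hx.1) (ha x hx.1) hx.2
  obtain ⟨δ, hδ, hpert⟩ := hγ.exists_perturbation ((finite_range _).insert 0).isCompact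
  have hnear : ∀ᶠ y in 𝓝 x, y ∈ Ω ∧ ∀ κ, ‖a κ y - a κ x‖ < δ * ‖a κ x‖ := by
    refine Eventually.and (hΩ.mem_nhds hx.1) (eventually_all.2 fun κ => ?_)
    have h1 : Tendsto (a κ) (𝓝 x) (𝓝 (a κ x)) :=
      ((had κ).differentiableAt (hΩ.mem_nhds hx.1)).continuousAt
    have h2 := tendsto_iff_norm_sub_tendsto_zero.1 h1
    exact h2.eventually_lt_const (mul_pos hδ (norm_pos_iff.2 (ha0 x hx.1 κ)))
  obtain ⟨V, hVs, hV, hxV⟩ := eventually_nhds_iff.1 hnear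
  have hsep : ∀ y ∈ V, Separates γ (range fun κ => a κ y) := fun y hy => hpert _ (by
    rintro _ ⟨κ, rfl⟩
    exact ⟨a κ x, ⟨κ, rfl⟩, ((hVs y hy).2 κ).le⟩)
  have hdiff : DifferentiableOn ℂ (fun y => cInt γ (fun z => H y z / ∏ κ, pairFactor (a κ y) z)) V := by
    refine hγ.1.cInt_differentiableOn hV (fun θ hθ => ne_zero_of_mem_annulus hR0 (hγR θ hθ))
      (f := fun y z => H y z / ∏ κ, pairFactor (a κ y) z) fun y hy θ hθ => ?_
    refine DifferentiableAt.complex_div (hH.differentiableAt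
      ((hΩ.prod (isOpen_annulus R)).mem_nhds ⟨(hVs y hy).1, hγR θ hθ⟩)) ?_ ?_
    · exact DifferentiableAt.complex_prod (f := fun κ (p : X × ℂ) => pairFactor (a κ p.1) p.2)
        fun κ _ => differentiableAt_pairFactor ((had κ).differentiableAt (hΩ.mem_nhds (hVs y hy).1))
          (ne_zero_of_mem_annulus hR0 (hγR θ hθ))
    · exact Finset.prod_ne_zero_iff.2 fun κ _ =>
        pairFactor_ne_zero_of_separates (hsep y hy) ⟨κ, rfl⟩ hθ
  refine ((hdiff.differentiableAt (hV.mem_nhds hxV)).congr_of_eventuallyEq ?_).differentiableWithinAt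
  filter_upwards [hV.mem_nhds hxV] with y hy
  exact hIeq y (hVs y hy).1 γ (hsep y hy) hγR

/-- The circles are fixed, and ‖a‖ < R' keeps a off the outer and 1/a off the inner one. In contrast
to the separated integral, no condition on the products of poles is needed. -/
theorem differentiableOn_circlePair [ProperSpace X] {Ω : Set X} (hΩ : IsOpen Ω) (hR' : 1 < R')
    (hR : R' < R) {a : X → ℂ} (had : DifferentiableOn ℂ a Ω) (ha : ∀ x ∈ Ω, ‖a x‖ < R')
    {H : X → ℂ → ℂ} (hH : DifferentiableOn ℂ (Function.uncurry H) (Ω ×ˢ annulus R)) :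
    DifferentiableOn ℂ (fun x => circlePair R' (H x) (a x)) Ω := by
  have h0 : 0 < R' := by linarith
  have hlt : R⁻¹ < R'⁻¹ := inv_strictAnti₀ h0 hR
  have hlt1 : R'⁻¹ < 1 := inv_lt_one_of_one_lt₀ hR'
  have m1 : ∀ θ, circleLoop R'⁻¹ θ ∈ annulus R :=
    fun θ => circleLoop_mem_annulus (inv_pos.2 h0) hlt (by linarith) θ
  have m2 : ∀ θ, circleLoop R' θ ∈ annulus R :=
    fun θ => circleLoop_mem_annulus h0 (by linarith) hR θ
  have had' : ∀ x ∈ Ω, ∀ z : ℂ, DifferentiableAt ℂ (fun p : X × ℂ => a p.1) (x, z) := fun x hx z =>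
    DifferentiableAt.comp (g := a) (f := Prod.fst) (x, z)
      (had.differentiableAt (hΩ.mem_nhds hx)) differentiableAt_fst
  have hH' : ∀ x ∈ Ω, ∀ z ∈ annulus R, DifferentiableAt ℂ (Function.uncurry H) (x, z) :=
    fun x hx z hz => hH.differentiableAt ((hΩ.prod (isOpen_annulus R)).mem_nhds ⟨hx, hz⟩)
  have hne : ∀ ρ, 0 < ρ → ∀ θ, circleLoop ρ θ ≠ 0 := fun ρ hρ θ h => by
    have := norm_circleLoop hρ θ
    rw [h, norm_zero] at this
    exact hρ.ne this
  refine DifferentiableOn.fun_add ?_ (had.fun_mul ?_)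
  · refine (isLoop_circleLoop _).cInt_differentiableOn hΩ (fun θ _ => hne _ (inv_pos.2 h0) θ)
      (f := fun x z => H x z / (1 - a x * z)) fun x hx θ _ => ?_
    refine (hH' x hx _ (m1 θ)).complex_div ((differentiableAt_const 1).fun_sub
      ((had' x hx _).fun_mul differentiableAt_snd)) (sub_ne_zero.2 fun h => ?_)
    have h1 := congrArg norm h
    rw [norm_one, norm_mul, norm_circleLoop (inv_pos.2 h0), eq_mul_inv_iff_mul_eq₀ h0.ne', one_mul] at h1
    exact (ha x hx).ne' h1
  · refine (isLoop_circleLoop _).cInt_differentiableOn hΩ (fun θ _ => hne _ h0 θ)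
      (f := fun x z => H x z / (z - a x)) fun x hx θ _ => ?_
    refine (hH' x hx _ (m2 θ)).complex_div (differentiableAt_snd.fun_sub (had' x hx _))
      (sub_ne_zero.2 fun h => ?_)
    have h1 := congrArg norm h
    rw [norm_circleLoop h0] at h1
    exact (ha x hx).ne' h1

end Extension

/-! ### Continuation across pinched parameters -/

section Extension

variable {E : Type*} [NormedAddCommGroup E] [NormedSpace ℂ E]
  {J Κ : Type*} [Fintype J] [Fintype Κ] {R R' : ℝ}

theorem finite_sq_mul_eq_one (c : ℂ) : {z : ℂ | z ^ 2 * c = 1}.Finite := by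
  rcases Set.eq_empty_or_nonempty {z : ℂ | z ^ 2 * c = 1} with h | ⟨w, hw⟩
  · rw [h]; exact Set.finite_empty
  · refine (Set.toFinite {w, -w}).subset fun z hz => ?_
    rw [Set.mem_ofPred_eq] at hw hz
    have hc : c ≠ 0 := by rintro rfl; simp at hw
    have h1 : z ^ 2 = w ^ 2 := mul_right_cancel₀ hc (hz.trans hw.symm)
    exact sq_eq_sq_iff_eq_or_eq_neg.1 h1

theorem eventually_sq_mul_ne_one (c : ℂ) : ∀ᶠ z in 𝓝[≠] (1 : ℂ), z ^ 2 * c ≠ 1 := by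
  have h := ((finite_sq_mul_eq_one c).subset
    (sdiff_subset (t := {1}))).isClosed.isOpen_compl.mem_nhds (fun h : (1 : ℂ) ∈ _ => h.2 rfl)
  filter_upwards [nhdsWithin_le_nhds h, self_mem_nhdsWithin] with z hz hz1 hzc
  exact hz ⟨hzc, hz1⟩

/-- Each equation a_κ = a_l is linear and nontrivial in the coordinates, so a finite intersection of
complements of hyperplanes remains. -/
theorem dense_injective_scaled [CompleteSpace E] {g : Κ → ℂ} {j : Κ → J} (hg : ∀ κ, g κ ≠ 0)
    (hgj : ∀ κ l, κ ≠ l → j κ = j l → g κ ≠ g l) :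
    Dense {x : (J → ℂ) × E | Function.Injective fun κ => g κ * x.1 (j κ)} := by
  classical
  let l : Κ × Κ → ((J → ℂ) × E →L[ℂ] ℂ) := fun i =>
    g i.1 • (ContinuousLinearMap.proj (j i.1) ∘L ContinuousLinearMap.fst ℂ (J → ℂ) E) -
      g i.2 • (ContinuousLinearMap.proj (j i.2) ∘L ContinuousLinearMap.fst ℂ (J → ℂ) E)
  have hl : ∀ i x, l i x = g i.1 * x.1 (j i.1) - g i.2 * x.1 (j i.2) := fun i x => by simp [l]
  have h1 : Dense (⋂ i : {i : Κ × Κ // i.1 ≠ i.2}, {x : (J → ℂ) × E | l i.1 x ≠ 0}) := by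
    refine dense_iInter_of_isOpen (fun i => ?_) fun i => ?_
    · exact isOpen_ne_fun (l i.1).continuous continuous_const
    · obtain ⟨⟨κ, m⟩, hi⟩ := i
      refine dense_ne_zero (l (κ, m)) (v := (Pi.single (j κ) 1, 0)) ?_
      rw [hl]
      by_cases h : j κ = j m
      · simpa [← h] using sub_ne_zero.2 (hgj κ m hi h)
      · simpa [Pi.single_apply, Ne.symm h] using hg κ
  refine h1.mono fun x hx κ m hκm => ?_
  by_contra hne
  refine (mem_iInter.1 hx ⟨(κ, m), hne⟩) ?_
  rw [hl]
  exact sub_eq_zero.2 hκm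

/-- A contour integral whose integrand has the simple poles `a_κ` and `1 / a_κ`, with the `a_κ`
scalar multiples of independent coordinates, extends holomorphically across the parameters with
`a_κ a_l = 1`, if the numerator vanishes at the pole `a_κ` there. -/
theorem exists_holomorphic_extension [ProperSpace E] [Nonempty Κ] {Ω : Set ((J → ℂ) × E)}
    (hΩ : IsOpen Ω) (hR' : 1 < R') (hR : R' < R) {g : Κ → ℂ} {j : Κ → J} (hg : ∀ κ, g κ ≠ 0)
    (hgj : ∀ κ l, κ ≠ l → j κ = j l → g κ ≠ g l)
    (ha0 : ∀ x ∈ Ω, ∀ κ, x.1 (j κ) ≠ 0) (ha : ∀ x ∈ Ω, ∀ κ, ‖g κ * x.1 (j κ)‖ < R')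
    {H : (J → ℂ) × E → ℂ → ℂ}
    (hH : DifferentiableOn ℂ (Function.uncurry H) (Ω ×ˢ annulus R))
    (hpinch : ∀ x ∈ Ω, ∀ κ l, g κ * x.1 (j κ) * (g l * x.1 (j l)) = 1 →
      H x (g κ * x.1 (j κ)) = 0) :
    ∃ Φ : (J → ℂ) × E → ℂ, DifferentiableOn ℂ Φ Ω ∧
      ∀ x ∈ Ω, ∀ γ, Separates γ (range fun κ => g κ * x.1 (j κ)) →
        (∀ θ ∈ Icc (0 : ℝ) 1, γ θ ∈ annulus R) →
        Φ x = cInt γ (fun z => H x z / ∏ κ, pairFactor (g κ * x.1 (j κ)) z) := by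
  classical
  set a : Κ → (J → ℂ) × E → ℂ := fun κ x => g κ * x.1 (j κ) with ha_def
  have hac : ∀ κ, Differentiable ℂ (a κ) := fun κ => by
    have : Differentiable ℂ fun x : (J → ℂ) × E => x.1 (j κ) :=
      (ContinuousLinearMap.proj (R := ℂ) (φ := fun _ : J => ℂ) (j κ) ∘L
        ContinuousLinearMap.fst ℂ (J → ℂ) E).differentiable
    exact (differentiable_const _).mul this
  have hane : ∀ x ∈ Ω, ∀ κ, a κ x ≠ 0 := fun x hx κ => mul_ne_zero (hg κ) (ha0 x hx κ)
  have hHx : ∀ x ∈ Ω, DifferentiableOn ℂ (H x) (annulus R) := by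
    intro x hx
    have h1 : DifferentiableOn ℂ (fun z : ℂ => (x, z)) (annulus R) := by fun_prop
    exact hH.comp h1 fun z hz => ⟨hx, hz⟩
  obtain ⟨I, hI, hIeq⟩ := exists_differentiableOn_separated hΩ hR' hR
    (fun κ => (hac κ).differentiableOn) hane ha hH
  set S : Set ((J → ℂ) × E) := {x ∈ Ω | ∀ κ l, a κ x * a l x ≠ 1} with hS
  have hSopen : IsOpen S := by
    have h1 : S = Ω ∩ ⋂ κ, ⋂ l, {x | a κ x * a l x ≠ 1} := by
      ext x; simp [hS]
    rw [h1]
    exact hΩ.inter (isOpen_iInter_of_finite fun κ => isOpen_iInter_of_finite fun l =>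
      isOpen_ne_fun ((hac κ).continuous.mul (hac l).continuous) continuous_const)
  have hex : ∀ x ∈ S, ∃ γ, Separates γ (range fun κ => a κ x) ∧
      ∀ θ ∈ Icc (0 : ℝ) 1, γ θ ∈ annulus R := fun x hx =>
    exists_separates_range hR' hR (hane x hx.1) (ha x hx.1) hx.2
  -- Scaling multiplies each a_κ a_l by c², so any pinched point becomes unpinched for c ≠ 1 close
  -- to 1.
  let φ : ℂ → (J → ℂ) × E → (J → ℂ) × E := fun c x => (c • x.1, x.2)
  have hφc : Continuous fun p : ℂ × ((J → ℂ) × E) => φ p.1 p.2 := by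
    simp only [φ]; fun_prop
  have hφd : ∀ x, Differentiable ℂ fun c => φ c x := fun x => by
    simp only [φ]; fun_prop
  have hφ1 : ∀ x, φ 1 x = x := fun x => by simp [φ]
  have haφ : ∀ c x κ, a κ (φ c x) = c * a κ x := fun c x κ => by
    simp only [ha_def, φ, Pi.smul_apply, smul_eq_mul]; ring
  have hSφ : ∀ x ∈ Ω, ∀ᶠ c in 𝓝[≠] (1 : ℂ), φ c x ∈ S := by
    intro x hx
    have h1 : ∀ᶠ c in 𝓝[≠] (1 : ℂ), φ c x ∈ Ω := by
      refine nhdsWithin_le_nhds ?_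
      exact (hφd x).continuous.continuousAt (x := 1) (hΩ.mem_nhds (by rwa [hφ1]))
    have h2 : ∀ᶠ c in 𝓝[≠] (1 : ℂ), ∀ κ l, c ^ 2 * (a κ x * a l x) ≠ 1 :=
      eventually_all.2 fun κ => eventually_all.2 fun l => eventually_sq_mul_ne_one _
    filter_upwards [h1, h2] with c hc1 hc2
    refine ⟨hc1, fun κ l h => hc2 κ l ?_⟩
    rw [haφ, haφ] at h
    linear_combination h
  have hdense : Ω ⊆ closure S := by
    intro x hx
    refine mem_closure_of_tendsto (f := fun c => φ c x) (b := 𝓝[≠] (1 : ℂ)) ?_ (hSφ x hx)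
    have h1 : Tendsto (fun c => φ c x) (𝓝 1) (𝓝 (φ 1 x)) := (hφd x).continuous.tendsto 1
    rw [hφ1] at h1
    exact h1.mono_left nhdsWithin_le_nhds
  have hextend : ∃ Φ : (J → ℂ) × E → ℂ, DifferentiableOn ℂ Φ Ω ∧ ∀ x ∈ S, Φ x = I x := by
    refine exists_glue hΩ (fun x hx => hx.1) hdense fun x₀ hx₀ => ?_
    -- A punctured disk of scalings of x₀ is unpinched. On the circle of radius r this persists for
    -- x near x₀ by compactness; r < 1 keeps c away from 0.
    obtain ⟨ε, hε, hball⟩ := Metric.mem_nhdsWithin_iff.1 (hSφ x₀ hx₀)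
    set r := min (ε / 2) (1 / 2) with hr
    have hr0 : 0 < r := by positivity
    have hrε : r < ε := (min_le_left _ _).trans_lt (by linarith)
    have hr1 : r < 1 := (min_le_right _ _).trans_lt (by norm_num)
    have hne0 : ∀ c ∈ Metric.closedBall (1 : ℂ) r, c ≠ 0 := by
      rintro c hc rfl
      rw [Metric.mem_closedBall, dist_zero_left, norm_one] at hc
      linarith
    have hU1 : ∀ᶠ x in 𝓝 x₀, ∀ c ∈ Metric.closedBall (1 : ℂ) r, φ c x ∈ Ω := by
      refine (isCompact_closedBall (1 : ℂ) r).eventually_forall_of_forall_eventually fun c hc => ?_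
      have h1 : φ c x₀ ∈ Ω := by
        rcases eq_or_ne c 1 with rfl | hc1
        · rwa [hφ1]
        · exact (hball ⟨(Metric.mem_closedBall.1 hc).trans_lt hrε, hc1⟩).1
      exact (hφc.comp continuous_swap).continuousAt (x := (x₀, c)) (hΩ.mem_nhds h1)
    have hU2 : ∀ᶠ x in 𝓝 x₀, ∀ c ∈ Metric.sphere (1 : ℂ) r, φ c x ∈ S := by
      refine (isCompact_sphere (1 : ℂ) r).eventually_forall_of_forall_eventually fun c hc => ?_
      have h1 : φ c x₀ ∈ S := hball ⟨(Metric.mem_sphere.1 hc).trans_lt hrε, by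
        rintro rfl
        rw [Metric.mem_sphere, dist_self] at hc
        exact hr0.ne hc⟩
      exact (hφc.comp continuous_swap).continuousAt (x := (x₀, c)) (hSopen.mem_nhds h1)
    obtain ⟨V, hVs, hV, hx₀V⟩ := eventually_nhds_iff.1 (hU1.and hU2)
    -- The local extension is the Cauchy integral in c over a circle on which no scaled parameter is
    -- pinched.
    have hFd : DifferentiableOn ℂ (fun x => (2 * Real.pi * Complex.I : ℂ)⁻¹ •
        ∮ c in C(1, r), (c - 1)⁻¹ • I (φ c x)) V := by
      simp only [smul_eq_mul]
      refine (differentiableOn_const _).fun_mul ?_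
      have hcm : ∀ θ : ℝ, circleMap 1 r θ - 1 ≠ 0 := fun θ =>
        sub_ne_zero.2 (circleMap_ne_center hr0.ne')
      have hcs : ∀ θ : ℝ, circleMap 1 r θ ∈ Metric.sphere (1 : ℂ) r := fun θ =>
        circleMap_mem_sphere 1 hr0.le θ
      obtain ⟨M, hM⟩ : ∃ M, ∀ θ, ‖deriv (circleMap 1 r) θ‖ ≤ M := ⟨|r|, fun θ => by simp⟩
      have h1 := differentiableOn_parametric_integral hV (a := 0) (b := 2 * Real.pi)
        (g := fun x θ => (circleMap 1 r θ - 1)⁻¹ * I (φ (circleMap 1 r θ) x))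
        (by positivity) ?_ ?_ (m := deriv (circleMap 1 r)) (measurable_deriv _)
        (Eventually.of_forall fun θ _ => hM θ)
      · refine h1.congr fun x _ => ?_
        simp only [circleIntegral, smul_eq_mul]
        refine intervalIntegral.integral_congr fun θ _ => ?_
        ring
      · refine ContinuousOn.mul ?_ ?_
        · exact ContinuousOn.inv₀ (Continuous.continuousOn (by fun_prop)) fun p _ => hcm p.2
        · refine hI.continuousOn.comp (f := fun p : ((J → ℂ) × E) × ℝ => φ (circleMap 1 r p.2) p.1)
            ?_ fun p hp => (hVs p.1 hp.1).2 _ (hcs p.2)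
          have : Continuous fun p : ((J → ℂ) × E) × ℝ => (circleMap 1 r p.2, p.1) := by fun_prop
          exact (hφc.comp this).continuousOn
      · intro θ _
        refine (differentiableOn_const _).fun_mul ?_
        have h2 : Differentiable ℂ fun x => φ (circleMap 1 r θ) x := by
          simp only [φ]; fun_prop
        exact hI.comp h2.differentiableOn fun x hx => (hVs x hx).2 _ (hcs θ)
    refine ⟨V, hV.mem_nhds hx₀V, _, hFd, ?_⟩
    have hgen : ∀ x ∈ S ∩ V, (Function.Injective fun κ => a κ x) →
        (2 * Real.pi * Complex.I : ℂ)⁻¹ • (∮ c in C(1, r), (c - 1)⁻¹ • I (φ c x)) = I x := by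
      intro x hx hinj
      set Z : Set ℂ := {c ∈ Metric.ball (1 : ℂ) r | φ c x ∉ S} with hZ
      have hball' : ∀ c ∈ Metric.closedBall (1 : ℂ) r, φ c x ∈ Ω := (hVs x hx.2).1
      have hZfin : Z.Finite := by
        refine (Set.finite_iUnion fun κ => Set.finite_iUnion fun l =>
          finite_sq_mul_eq_one (a κ x * a l x)).subset fun c hc => ?_
        have h1 : ¬∀ κ l, a κ (φ c x) * a l (φ c x) ≠ 1 := fun h =>
          hc.2 ⟨hball' c (Metric.ball_subset_closedBall hc.1), h⟩
        push Not at h1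
        obtain ⟨κ, l, h1⟩ := h1
        rw [haφ, haφ] at h1
        exact mem_iUnion.2 ⟨κ, mem_iUnion.2 ⟨l, by rw [Set.mem_ofPred_eq, ← h1]; ring⟩⟩
      have h1 := cauchy_formula_of_removable (f := fun c => I (φ c x)) hr0 hZfin (fun c hc => hc.1)
        (fun h => h.2 (by rw [hφ1]; exact hx.1)) ?_ ?_
      · rw [h1, hφ1]
      · intro c hc hcZ
        have hcS : φ c x ∈ S := by
          by_contra h
          rcases (Metric.mem_closedBall.1 hc).lt_or_eq with h2 | h2
          · exact hcZ ⟨h2, h⟩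
          · exact h ((hVs x hx.2).2 c h2)
        exact (hI.differentiableAt (hSopen.mem_nhds hcS)).comp c (hφd x c)
      · intro w hw
        have hwb := Metric.ball_subset_closedBall hw.1
        have hw0 : w ≠ 0 := hne0 w hwb
        have hP : ∀ κ, ContinuousAt (fun c => circlePair R' (H (φ c x)) (c * a κ x)) w := by
          intro κ
          have h2 := (differentiableOn_circlePair hΩ hR' hR (hac κ).differentiableOn
            (fun y hy => ha y hy κ) hH).continuousOn.continuousAt (hΩ.mem_nhds (hball' w hwb))
          have h3 := ContinuousAt.comp (f := fun c => φ c x) h2 (hφd x).continuous.continuousAt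
          simpa only [Function.comp_def, haφ] using h3
        -- Near w the integral is the sum of circle integrals over `residueDenom`. Its residue at c
        -- = w vanishes because paired circle integrals cancel.
        have h4 := tendsto_sub_mul_sum_residue (hane x hx.1.1) hinj hw0 hP ?_
        · refine h4.congr' ?_
          have hnZ : ∀ᶠ c in 𝓝[≠] w, c ∉ Z \ {w} := nhdsWithin_le_nhds
            ((hZfin.subset sdiff_subset).isClosed.isOpen_compl.mem_nhds fun h => h.2 rfl)
          filter_upwards [hnZ, self_mem_nhdsWithin,
            nhdsWithin_le_nhds (Metric.isOpen_ball.mem_nhds hw.1)] with c hc1 hc2 hc3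
          have hcS : φ c x ∈ S := by
            by_contra h
            exact hc1 ⟨⟨hc3, h⟩, hc2⟩
          obtain ⟨γ, hγ, hγR⟩ := hex _ hcS
          have hinj' : Function.Injective fun κ => a κ (φ c x) := by
            intro κ l h
            simp only [haφ] at h
            exact hinj (mul_left_cancel₀ (hne0 c (Metric.ball_subset_closedBall hc3)) h)
          rw [hIeq _ hcS.1 γ hγ hγR,
            cInt_div_prod_pairFactor (a := fun κ => a κ (φ c x)) hR' hR (hHx _ hcS.1) (ha _ hcS.1)
            hinj' hγ hγR]
          simp only [haφ]
        · intro κ l h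
          have hΩw := hball' w hwb
          have h5 : a κ (φ w x) * a l (φ w x) = 1 := by rw [haφ, haφ, ← h]; ring
          have h6 := circlePair_add_circlePair hR' hR (hHx _ hΩw) h5 (ha _ hΩw κ) (ha _ hΩw l)
            (hpinch _ hΩw κ l h5) (hpinch _ hΩw l κ (by rw [← h5]; exact mul_comm _ _))
          simpa only [haφ] using h6
    intro x hx
    -- Distinct poles were needed only for the partial fractions. Both sides are continuous, so
    -- density removes this condition.
    have hdn := dense_injective_scaled (E := E) hg hgj
    have hSV : IsOpen (S ∩ V) := hSopen.inter hV
    have hcl : x ∈ closure (S ∩ V ∩ {x : (J → ℂ) × E | Function.Injective fun κ => a κ x}) :=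
      hdn.open_subset_closure_inter hSV hx
    have hne : (𝓝[S ∩ V ∩ {x : (J → ℂ) × E | Function.Injective fun κ => a κ x}] x).NeBot :=
      mem_closure_iff_nhdsWithin_neBot.1 hcl
    have hle := nhdsWithin_le_nhds (a := x)
      (s := S ∩ V ∩ {x : (J → ℂ) × E | Function.Injective fun κ => a κ x})
    have h1 := ((hFd.continuousOn.continuousAt (hV.mem_nhds hx.2)).tendsto).mono_left hle
    have h2 := ((hI.continuousOn.continuousAt (hSopen.mem_nhds hx.1)).tendsto).mono_left hle
    refine tendsto_nhds_unique (h1.congr' ?_) h2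
    filter_upwards [self_mem_nhdsWithin] with y hy
    exact hgen y hy.1 hy.2
  obtain ⟨Φ, hΦ, hΦI⟩ := hextend
  refine ⟨Φ, hΦ, fun x hx γ hγ hγR => ?_⟩
  have hxS : x ∈ S := ⟨hx, fun κ l => hγ.mul_ne_one ⟨κ, rfl⟩ ⟨l, rfl⟩⟩
  rw [hΦI x hxS, hIeq x hx γ hγ hγR]

end Extension

/-! ### Chains of poles u q^k and √b q^{k/2} -/

section Chains

theorem qPoch_eq_zero {x q : ℂ} (hq : ‖q‖ < 1) {j : ℕ} (h : x * q ^ j = 1) : qPoch x q = 0 := by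
  by_contra h1
  exact (qPoch_ne_zero_iff hq).1 h1 j h

/-- Here z² is an integral power of q. Its sign decides which of the two products vanishes. -/
theorem qPoch_sq_mul_eq_zero {z q : ℂ} (hq0 : q ≠ 0) (hq : ‖q‖ < 1) (hz : z ≠ 0) {m n : ℕ}
    (h : z ^ 2 * q ^ n = q ^ m) : qPoch (z ^ 2) q * qPoch (1 / z ^ 2) q = 0 := by
  rcases le_total m n with hmn | hmn
  · rw [qPoch_eq_zero hq (j := n - m), zero_mul]
    refine mul_right_cancel₀ (pow_ne_zero m hq0) ?_
    rw [mul_assoc, ← pow_add, Nat.sub_add_cancel hmn, h, one_mul]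
  · rw [qPoch_eq_zero (x := 1 / z ^ 2) hq (j := m - n), mul_zero]
    refine mul_right_cancel₀ (pow_ne_zero n hq0) ?_
    rw [mul_assoc, ← pow_add, Nat.sub_add_cancel hmn, ← h]
    field_simp

theorem DifferentiableOn.qPoch_const {X : Type*} [NormedAddCommGroup X] [NormedSpace ℂ X] {q : ℂ}
    (hq : ‖q‖ < 1) {f : X → ℂ} {Ω : Set X} (hf : DifferentiableOn ℂ f Ω) :
    DifferentiableOn ℂ (fun x => _root_.qPoch (f x) q) Ω :=
  (differentiable_qPoch hq).comp_differentiableOn hf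

variable {ι : Type*} [Fintype ι] [LinearOrder ι]

/-- The second factor is (b², qb²; q)/(b, qb; q) written without division, so that it is holomorphic
in b everywhere. -/
noncomputable def chainPref (q b : ℂ) (u : ι → ℂ) : ℂ :=
  (∏ i, ∏ j, if i < j then qPoch (u i * u j) q else 1) *
    (qPoch (-b) q * qPoch (-(b * q)) q * qPoch (b ^ 2 * q) (q ^ 2) ^ 2)

noncomputable def chainIntegrand (q b : ℂ) (u : ι → ℂ) (z : ℂ) : ℂ :=
  qPoch (z ^ 2) q * qPoch (1 / z ^ 2) q / (qPoch (b * z ^ 2) q * qPoch (b / z ^ 2) q) *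
    ∏ i, qPoch (b * u i * z) q * qPoch (b * u i / z) q / (qPoch (u i * z) q * qPoch (u i / z) q)

def chainPoles (q b : ℂ) (u : ι → ℂ) : Set ℂ :=
  {z | ∃ k : ℕ, (∃ i, z = u i * q ^ k) ∨ z ^ 2 = b * q ^ k}

theorem chainPref_eq_zero_of_pair {q b : ℂ} (hq : ‖q‖ < 1) {u : ι → ℂ} {i j : ι} (hij : i ≠ j) {n : ℕ}
    (h : u i * u j * q ^ n = 1) : chainPref q b u = 0 := by
  have key : ∀ i j : ι, i < j → u i * u j * q ^ n = 1 → chainPref q b u = 0 := by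
    intro i j hij h
    rw [chainPref, Finset.prod_eq_zero (Finset.mem_univ i), zero_mul]
    exact Finset.prod_eq_zero (Finset.mem_univ j) (by rw [if_pos hij, qPoch_eq_zero hq h])
  rcases lt_or_gt_of_ne hij with h1 | h1
  · exact key i j h1 h
  · exact key j i h1 (by rw [mul_comm (u j)]; exact h)

theorem chainPref_eq_zero_of_neg {q b : ℂ} (hq : ‖q‖ < 1) {u : ι → ℂ} {n : ℕ}
    (h : -b * q ^ n = 1) : chainPref q b u = 0 := by
  rw [chainPref, qPoch_eq_zero (x := -b) hq h]
  ring

theorem chainPref_eq_zero_of_sq {q b : ℂ} (hq : ‖q‖ < 1) {u : ι → ℂ} {n : ℕ}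
    (h : b ^ 2 * q ^ (2 * n + 1) = 1) : chainPref q b u = 0 := by
  rw [chainPref, qPoch_eq_zero (x := b ^ 2 * q) (j := n) (norm_sq_lt_one hq)]
  · ring
  · rw [← h]; ring

theorem prod_pairFactor_chain {u q z : ℂ} (hq : ‖q‖ < 1) (K : ℕ) :
    qPoch (u * z) q * qPoch (u / z) q = (∏ l : Fin K, pairFactor (q ^ (l : ℕ) * u) z) *
      (qPoch (u * z * q ^ K) q * qPoch (u / z * q ^ K) q) := by
  rw [qPoch_eq_prod_mul hq (u * z) K, qPoch_eq_prod_mul hq (u / z) K,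
    Fin.prod_univ_eq_prod_range (fun l => pairFactor (q ^ l * u) z) K]
  simp only [pairFactor, Finset.prod_mul_distrib]
  have h1 : ∀ l, q ^ l * u * z = u * z * q ^ l := fun l => by ring
  have h2 : ∀ l, q ^ l * u / z = u / z * q ^ l := fun l => by ring
  simp only [h1, h2]
  ring

/-- The poles of 1/(bz^{±2};q) become multiples of one coordinate s = √b, by 1 - s² q^l z² = (1 -
σ^l s z)(1 + σ^l s z). -/
theorem prod_pairFactor_sq_chain {s σ q z : ℂ} (hσ : σ ^ 2 = q) (hq : ‖q‖ < 1) (K : ℕ) :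
    qPoch (s ^ 2 * z ^ 2) q * qPoch (s ^ 2 / z ^ 2) q =
      (∏ i : Bool × Fin K, pairFactor (cond i.1 1 (-1) * σ ^ (i.2 : ℕ) * s) z) *
      (qPoch (s ^ 2 * z ^ 2 * q ^ K) q * qPoch (s ^ 2 / z ^ 2 * q ^ K) q) := by
  rw [qPoch_eq_prod_mul hq (s ^ 2 * z ^ 2) K, qPoch_eq_prod_mul hq (s ^ 2 / z ^ 2) K,
    Fintype.prod_prod_type, Fintype.prod_bool, ← Finset.prod_mul_distrib]
  have h1 : ∀ l : ℕ, pairFactor (1 * σ ^ l * s) z * pairFactor (-1 * σ ^ l * s) z =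
      (1 - s ^ 2 * z ^ 2 * q ^ l) * (1 - s ^ 2 / z ^ 2 * q ^ l) := by
    intro l
    rw [← hσ, ← pow_mul, mul_comm 2 l, pow_mul]
    simp only [pairFactor]
    ring
  simp only [cond_true, cond_false]
  rw [Fin.prod_univ_eq_prod_range
    (fun l => pairFactor (1 * σ ^ l * s) z * pairFactor (-1 * σ ^ l * s) z) K]
  simp only [h1, Finset.prod_mul_distrib]
  ring

theorem norm_mul_mul_lt {a b c M N δ : ℝ} (ha : 0 ≤ a) (hb : 0 ≤ b) (hc : 0 ≤ c) (haM : a ≤ M)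
    (hbN : b ≤ N) (hcδ : c ≤ δ) (h : M * N * δ < 1) : a * b * c < 1 :=
  lt_of_le_of_lt (mul_le_mul (mul_le_mul haM hbN hb (ha.trans haM)) hcδ hc
    (mul_nonneg (ha.trans haM) (hb.trans hbN))) h

/-- The bound on K makes every argument of the remaining products smaller than 1 in modulus
throughout the annulus. -/
theorem chain_tails_ne_zero {q u s z : ℂ} {R R' : ℝ} (hq : ‖q‖ < 1) (hR' : 1 < R') (hR : R' < R)
    {K : ℕ} (hK : (R' * R) ^ 2 * ‖q‖ ^ K < 1) (hu : ‖u‖ < R') (hs : ‖s‖ < R') (hz : z ∈ annulus R) :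
    qPoch (u * z * q ^ K) q * qPoch (u / z * q ^ K) q ≠ 0 ∧
      qPoch (s ^ 2 * z ^ 2 * q ^ (2 * K)) q * qPoch (s ^ 2 / z ^ 2 * q ^ (2 * K)) q ≠ 0 := by
  have hR0 : 0 < R := by linarith
  have hR'0 : 0 < R' := by linarith
  have hzi : ‖z‖⁻¹ < R := (inv_lt_comm₀ hR0 (norm_pos_iff.2 (ne_zero_of_mem_annulus hR0 hz))).1 hz.1
  have hK1 : R' * R * ‖q‖ ^ K < 1 := by
    refine lt_of_le_of_lt (mul_le_mul_of_nonneg_right ?_ (by positivity)) hK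
    have : 1 ≤ R' * R := by nlinarith
    nlinarith
  have hK2 : R' ^ 2 * R ^ 2 * ‖q‖ ^ K < 1 := by rw [← mul_pow]; exact hK
  have hq2 : ‖q‖ ^ (2 * K) ≤ ‖q‖ ^ K :=
    pow_le_pow_of_le_one (norm_nonneg _) hq.le (by omega)
  refine ⟨mul_ne_zero ?_ ?_, mul_ne_zero ?_ ?_⟩ <;> refine qPoch_ne_zero_of_norm_lt hq ?_
  · rw [norm_mul, norm_mul, norm_pow]
    exact norm_mul_mul_lt (by positivity) (by positivity) (by positivity) hu.le hz.2.le le_rfl hK1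
  · rw [norm_mul, norm_div, norm_pow, div_eq_mul_inv]
    exact norm_mul_mul_lt (by positivity) (by positivity) (by positivity) hu.le hzi.le le_rfl hK1
  · rw [norm_mul, norm_mul, norm_pow, norm_pow, norm_pow]
    exact norm_mul_mul_lt (by positivity) (by positivity) (by positivity)
      (pow_le_pow_left₀ (norm_nonneg _) hs.le 2) (pow_le_pow_left₀ (norm_nonneg _) hz.2.le 2) hq2 hK2
  · rw [norm_mul, norm_div, norm_pow, norm_pow, norm_pow, div_eq_mul_inv, ← inv_pow]
    exact norm_mul_mul_lt (by positivity) (by positivity) (by positivity)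
      (pow_le_pow_left₀ (norm_nonneg _) hs.le 2) (pow_le_pow_left₀ (by positivity) hzi.le 2) hq2 hK2

end Chains

/-! ### Vanishing of the numerator at pinches -/

section Chains

variable {ι : Type*} [Fintype ι] [LinearOrder ι] {E : Type*} [NormedAddCommGroup E] [NormedSpace ℂ E]

/-- The part of the integrand with chains of poles that is left after the factors vanishing in an
annulus are removed. -/
noncomputable def chainNumerator (q : ℂ) (K : ℕ) (G : E → ℂ → ℂ) (x : (Option ι → ℂ) × E) (z : ℂ) : ℂ :=
  chainPref q (x.1 none ^ 2) (fun i => x.1 (some i)) *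
    (G x.2 z * (qPoch (z ^ 2) q * qPoch (1 / z ^ 2) q) *
      (∏ i, qPoch (x.1 none ^ 2 * x.1 (some i) * z) q * qPoch (x.1 none ^ 2 * x.1 (some i) / z) q)) /
    ((∏ i, qPoch (x.1 (some i) * z * q ^ K) q * qPoch (x.1 (some i) / z * q ^ K) q) *
      (qPoch (x.1 none ^ 2 * z ^ 2 * q ^ (2 * K)) q * qPoch (x.1 none ^ 2 / z ^ 2 * q ^ (2 * K)) q))

theorem differentiableOn_chainNumerator {q : ℂ} (hq : ‖q‖ < 1) {R R' : ℝ}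
    (hR' : 1 < R') (hR : R' < R) {K : ℕ} (hK : (R' * R) ^ 2 * ‖q‖ ^ K < 1) {Ω : Set E}
    {G : E → ℂ → ℂ} (hG : DifferentiableOn ℂ (Function.uncurry G) (Ω ×ˢ annulus R)) :
    DifferentiableOn ℂ (Function.uncurry (chainNumerator (ι := ι) q K G))
      ({x : (Option ι → ℂ) × E | x.2 ∈ Ω ∧ ∀ o, x.1 o ≠ 0 ∧ ‖x.1 o‖ < R'} ×ˢ annulus R) := by
  set D := {x : (Option ι → ℂ) × E | x.2 ∈ Ω ∧ ∀ o, x.1 o ≠ 0 ∧ ‖x.1 o‖ < R'} ×ˢ annulus R with hD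
  have hR0 : 0 < R := by linarith
  have hw : ∀ o, DifferentiableOn ℂ (fun p : ((Option ι → ℂ) × E) × ℂ => p.1.1 o) D := fun o => by
    fun_prop
  have hz : DifferentiableOn ℂ (fun p : ((Option ι → ℂ) × E) × ℂ => p.2) D := by fun_prop
  have hz0 : ∀ p ∈ D, p.2 ≠ 0 := fun p hp => ne_zero_of_mem_annulus hR0 hp.2
  have hz2 : DifferentiableOn ℂ (fun p : ((Option ι → ℂ) × E) × ℂ => p.2 ^ 2) D := by fun_prop
  have hz20 : ∀ p ∈ D, p.2 ^ 2 ≠ 0 := fun p hp => pow_ne_zero 2 (hz0 p hp)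
  have hb : DifferentiableOn ℂ (fun p : ((Option ι → ℂ) × E) × ℂ => p.1.1 none ^ 2) D :=
    (hw none).fun_pow 2
  have hc : ∀ {c : ℂ}, DifferentiableOn ℂ (fun _ : ((Option ι → ℂ) × E) × ℂ => c) D :=
    differentiableOn_const _
  refine DifferentiableOn.complex_div (DifferentiableOn.fun_mul ?_ (DifferentiableOn.fun_mul
    (DifferentiableOn.fun_mul ?_ (DifferentiableOn.fun_mul (hz2.qPoch_const hq)
      ((hc.complex_div hz2 hz20).qPoch_const hq))) ?_)) (DifferentiableOn.fun_mul ?_ ?_) ?_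
  · refine DifferentiableOn.fun_mul (DifferentiableOn.complex_prod fun i _ =>
      DifferentiableOn.complex_prod fun j _ => ?_) ?_
    · by_cases hij : i < j
      · simp only [if_pos hij]
        exact ((hw _).fun_mul (hw _)).qPoch_const hq
      · simp only [if_neg hij]
        exact hc
    · exact ((hb.fun_neg.qPoch_const hq).fun_mul ((hb.fun_mul hc).fun_neg.qPoch_const hq)).fun_mul
        ((((hb.fun_pow 2).fun_mul hc).qPoch_const (norm_sq_lt_one hq)).fun_pow 2)
  · refine hG.comp (f := fun p : ((Option ι → ℂ) × E) × ℂ => (p.1.2, p.2)) (by fun_prop) ?_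
    exact fun p hp => ⟨hp.1.1, hp.2⟩
  · exact DifferentiableOn.complex_prod fun i _ => (((hb.fun_mul (hw _)).fun_mul hz).qPoch_const hq).fun_mul
      (((hb.fun_mul (hw _)).complex_div hz hz0).qPoch_const hq)
  · exact DifferentiableOn.complex_prod fun i _ => ((((hw _).fun_mul hz).fun_mul hc).qPoch_const hq).fun_mul
      ((((hw _).complex_div hz hz0).fun_mul hc).qPoch_const hq)
  · exact (((hb.fun_mul hz2).fun_mul hc).qPoch_const hq).fun_mul
      (((hb.complex_div hz2 hz20).fun_mul hc).qPoch_const hq)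
  · intro p hp
    refine mul_ne_zero (Finset.prod_ne_zero_iff.2 fun i _ => ?_) ?_
    · exact (chain_tails_ne_zero hq hR' hR hK (hp.1.2 (some i)).2 (hp.1.2 none).2 hp.2).1
    · exact (chain_tails_ne_zero hq hR' hR hK (hp.1.2 none).2 (hp.1.2 none).2 hp.2).2

/-- Each way in which two poles can have product 1 is met by its own zero. Two poles from one chain
of u_i: z² is a power of q and (z^{±2};q) vanishes. Chains of u_i and u_j with i ≠ j: the prefactor
(u_i u_j;q). A chain of u_i and one of √b: the numerator (b u_i z^{±1};q). Two poles from √b: for an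
odd power of σ the prefactor (b²q;q²); for an even power (-b;q) if the signs differ, and (z^{±2};q)
if they agree. -/
theorem chainNumerator_eq_zero {q σ : ℂ} (hq0 : q ≠ 0) (hq : ‖q‖ < 1) (hσ : σ ^ 2 = q) {K : ℕ}
    {G : E → ℂ → ℂ} {x : (Option ι → ℂ) × E} {κ l : (ι × Fin K) ⊕ (Bool × Fin (2 * K))}
    (g : (ι × Fin K) ⊕ (Bool × Fin (2 * K)) → ℂ)
    (hg : g = Sum.elim (fun i => q ^ (i.2 : ℕ)) (fun i => cond i.1 1 (-1) * σ ^ (i.2 : ℕ)))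
    (j : (ι × Fin K) ⊕ (Bool × Fin (2 * K)) → Option ι)
    (hj : j = Sum.elim (fun i => some i.1) (fun _ => none))
    (h : g κ * x.1 (j κ) * (g l * x.1 (j l)) = 1) :
    chainNumerator q K G x (g κ * x.1 (j κ)) = 0 := by
  have hz0 : g κ * x.1 (j κ) ≠ 0 := left_ne_zero_of_mul_eq_one h
  set s := x.1 none with hs
  have hW : ∀ {z : ℂ} {m n : ℕ}, z ≠ 0 → z ^ 2 * q ^ n = q ^ m → chainNumerator q K G x z = 0 := by
    intro z m n hz h
    rw [chainNumerator, qPoch_sq_mul_eq_zero hq0 hq hz h]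
    simp
  have hpref : ∀ {z : ℂ}, chainPref q (s ^ 2) (fun i => x.1 (some i)) = 0 →
      chainNumerator q K G x z = 0 := by
    intro z h
    rw [chainNumerator, h]
    simp
  have hnum : ∀ {z : ℂ} (i : ι), qPoch (s ^ 2 * x.1 (some i) * z) q *
      qPoch (s ^ 2 * x.1 (some i) / z) q = 0 → chainNumerator q K G x z = 0 := by
    intro z i h
    rw [chainNumerator, Finset.prod_eq_zero (Finset.mem_univ i) h]
    simp
  have hsgn : ∀ e : Bool, (cond e 1 (-1) : ℂ) ^ 2 = 1 := by rintro (_ | _) <;> simp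
  have hσ2 : ∀ n : ℕ, (σ ^ n) ^ 2 = q ^ n := fun n => by rw [← hσ, ← pow_mul, ← pow_mul, mul_comm]
  subst hg hj
  rcases κ with ⟨i, m⟩ | ⟨e, m⟩ <;> rcases l with ⟨i', n⟩ | ⟨e', n⟩ <;>
    simp only [Sum.elim_inl, Sum.elim_inr] at h hz0 ⊢
  · by_cases hii : i = i'
    · subst hii
      refine hW (m := m) (n := n) hz0 ?_
      linear_combination q ^ (m : ℕ) * h
    · refine hpref (chainPref_eq_zero_of_pair hq hii (n := m + n) ?_)
      rw [← h]; ring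
  · refine hnum i ?_
    rw [qPoch_eq_zero (x := s ^ 2 * x.1 (some i) * _) hq (j := m + n), zero_mul]
    rw [← one_pow 2, ← h, pow_add, ← hσ2 n]
    linear_combination -(q ^ (m : ℕ) * x.1 (some i) * σ ^ (n : ℕ) * s) ^ 2 * hsgn e'
  · refine hnum i' ?_
    rw [qPoch_eq_zero (x := s ^ 2 * x.1 (some i') / _) hq (j := m + n), mul_zero]
    have h1 : s ^ 2 * x.1 (some i') / (cond e 1 (-1) * σ ^ (m : ℕ) * s) =
        s ^ 2 * x.1 (some i') * (q ^ (n : ℕ) * x.1 (some i')) := by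
      rw [div_eq_iff hz0, mul_assoc _ (q ^ (n : ℕ) * x.1 (some i')), mul_comm (q ^ (n : ℕ) * _), h,
        mul_one]
    rw [h1, ← one_pow 2, ← h, pow_add, ← hσ2 m]
    linear_combination -(q ^ (n : ℕ) * x.1 (some i') * σ ^ (m : ℕ) * s) ^ 2 * hsgn e
  · have h1 : (cond e 1 (-1) * cond e' 1 (-1) : ℂ) * (s ^ 2 * σ ^ ((m : ℕ) + n)) = 1 := by
      rw [pow_add, hs]; linear_combination h
    rcases Nat.even_or_odd' ((m : ℕ) + n) with ⟨d, hd | hd⟩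
    · rw [hd, pow_mul, hσ] at h1
      have h2 : (cond e 1 (-1) * cond e' 1 (-1) : ℂ) = 1 ∨ (cond e 1 (-1) * cond e' 1 (-1) : ℂ) = -1 := by
        rcases e with _ | _ <;> rcases e' with _ | _ <;> simp
      rcases h2 with h2 | h2
      · rw [h2, one_mul] at h1
        refine hW (m := m) (n := d) hz0 ?_
        rw [mul_pow, mul_pow, hsgn, hσ2]
        linear_combination q ^ (m : ℕ) * h1
      · rw [h2] at h1
        refine hpref (chainPref_eq_zero_of_neg hq (n := d) ?_)
        rw [← h1]; ring
    · refine hpref (chainPref_eq_zero_of_sq hq (n := d) ?_)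
      rw [← hd, ← hσ2, ← one_pow 2, ← h1, mul_pow, mul_pow (cond e 1 (-1)), hsgn, hsgn]
      ring

/-- Joint holomorphic continuation of contour integrals with several chains of poles. -/
theorem exists_chain_extension [ProperSpace E] {q σ : ℂ} (hq0 : q ≠ 0) (hq : ‖q‖ < 1) (hσ : σ ^ 2 = q)
    {R R' : ℝ} (hR' : 1 < R') (hR : R' < R) {Ω : Set E} (hΩ : IsOpen Ω) {u : ι → E → ℂ} {s : E → ℂ}
    (hu : ∀ i, DifferentiableOn ℂ (u i) Ω) (hs : DifferentiableOn ℂ s Ω)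
    (hu0 : ∀ y ∈ Ω, ∀ i, u i y ≠ 0 ∧ ‖u i y‖ < R') (hs0 : ∀ y ∈ Ω, s y ≠ 0 ∧ ‖s y‖ < R')
    {G : E → ℂ → ℂ} (hG : DifferentiableOn ℂ (Function.uncurry G) (Ω ×ˢ annulus R)) :
    ∃ Φ : E → ℂ, DifferentiableOn ℂ Φ Ω ∧ ∀ y ∈ Ω, ∀ γ,
      Separates γ (chainPoles q (s y ^ 2) fun i => u i y) →
      (∀ θ ∈ Icc (0 : ℝ) 1, γ θ ∈ annulus R) →
      Φ y = chainPref q (s y ^ 2) (fun i => u i y) *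
        cInt γ (fun z => G y z * chainIntegrand q (s y ^ 2) (fun i => u i y) z) := by
  classical
  have hR0 : 0 < R := by linarith
  obtain ⟨K, hK⟩ : ∃ K : ℕ, (R' * R) ^ 2 * ‖q‖ ^ K < 1 := by
    have h1 : Tendsto (fun K : ℕ => (R' * R) ^ 2 * ‖q‖ ^ K) atTop (𝓝 ((R' * R) ^ 2 * 0)) :=
      (tendsto_pow_atTop_nhds_zero_of_lt_one (norm_nonneg _) hq).const_mul _
    rw [mul_zero] at h1
    exact (h1.eventually_lt_const one_pos).exists
  have hσ0 : σ ≠ 0 := by rintro rfl; exact hq0 (by rw [← hσ]; simp)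
  have hσ1 : ‖σ‖ < 1 := by
    have h1 : ‖σ‖ ^ 2 < 1 := by rw [← norm_pow, hσ]; exact hq
    exact (sq_lt_one_iff₀ (norm_nonneg _)).1 h1
  have hK0 : 0 < K := by
    rcases Nat.eq_zero_or_pos K with rfl | h
    · rw [pow_zero, mul_one] at hK
      have : 1 ≤ R' * R := by nlinarith
      nlinarith
    · exact h
  set Κ := (ι × Fin K) ⊕ (Bool × Fin (2 * K)) with hΚ
  have : Nonempty Κ := ⟨Sum.inr (true, ⟨0, by omega⟩)⟩
  set g : Κ → ℂ := Sum.elim (fun i => q ^ (i.2 : ℕ)) (fun i => cond i.1 1 (-1) * σ ^ (i.2 : ℕ)) with hg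
  set j : Κ → Option ι := Sum.elim (fun i => some i.1) (fun _ => none) with hj
  set D := {x : (Option ι → ℂ) × E | x.2 ∈ Ω ∧ ∀ o, x.1 o ≠ 0 ∧ ‖x.1 o‖ < R'} with hD
  have hDopen : IsOpen D := by
    have h1 : D = (Prod.snd ⁻¹' Ω) ∩ ⋂ o, {x : (Option ι → ℂ) × E | x.1 o ≠ 0 ∧ ‖x.1 o‖ < R'} := by
      ext x; simp [hD]
    rw [h1]
    refine (hΩ.preimage continuous_snd).inter (isOpen_iInter_of_finite fun o => ?_)
    have hco : Continuous fun x : (Option ι → ℂ) × E => x.1 o := by fun_prop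
    exact (isOpen_ne_fun hco continuous_const).inter (isOpen_lt hco.norm continuous_const)
  have hsgn1 : ∀ e : Bool, ‖(cond e 1 (-1) : ℂ)‖ = 1 := by rintro (_ | _) <;> simp
  have hsgn0 : ∀ e : Bool, (cond e 1 (-1) : ℂ) ≠ 0 := by rintro (_ | _) <;> simp
  have hg0 : ∀ κ, g κ ≠ 0 := by
    rintro (i | i)
    · exact pow_ne_zero _ hq0
    · exact mul_ne_zero (hsgn0 _) (pow_ne_zero _ hσ0)
  have hg1 : ∀ κ, ‖g κ‖ ≤ 1 := by
    rintro (i | i)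
    · simp only [hg, Sum.elim_inl, norm_pow]
      exact pow_le_one₀ (norm_nonneg _) hq.le
    · simp only [hg, Sum.elim_inr, norm_mul, norm_pow, hsgn1, one_mul]
      exact pow_le_one₀ (norm_nonneg _) hσ1.le
  have hpow : ∀ {a : ℂ}, a ≠ 0 → ‖a‖ < 1 → ∀ {m n : ℕ}, ‖a‖ ^ m = ‖a‖ ^ n → m = n := by
    intro a ha ha1 m n h
    exact pow_right_injective₀ (norm_pos_iff.2 ha) ha1.ne h
  have hgj : ∀ κ l, κ ≠ l → j κ = j l → g κ ≠ g l := by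
    rintro (⟨i, m⟩ | ⟨e, m⟩) (⟨i', n⟩ | ⟨e', n⟩) hne hjj hgg
    · simp only [hj, hg, Sum.elim_inl, Option.some.injEq] at hjj hgg
      subst hjj
      have h1 := congrArg norm hgg
      rw [norm_pow, norm_pow] at h1
      exact hne (by rw [Fin.ext (hpow hq0 hq h1)])
    · simp [hj] at hjj
    · simp [hj] at hjj
    · simp only [hg, Sum.elim_inr] at hgg
      have h1 := congrArg norm hgg
      rw [norm_mul, norm_mul, hsgn1, hsgn1, one_mul, one_mul, norm_pow, norm_pow] at h1
      have h2 : m = n := Fin.ext (hpow hσ0 hσ1 h1)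
      subst h2
      have h3 := mul_right_cancel₀ (pow_ne_zero _ hσ0) hgg
      refine hne ?_
      rcases e with _ | _ <;> rcases e' with _ | _
      · rfl
      · norm_num at h3
      · norm_num at h3
      · rfl
  obtain ⟨Φ, hΦ, hΦeq⟩ := exists_holomorphic_extension (Κ := Κ) (J := Option ι) hDopen hR' hR hg0 hgj
    (fun x hx κ => (hx.2 _).1) (fun x hx κ => by
      rw [norm_mul]
      exact lt_of_le_of_lt (mul_le_of_le_one_left (norm_nonneg _) (hg1 κ)) (hx.2 _).2)
    (H := chainNumerator q K G) (differentiableOn_chainNumerator hq hR' hR hK hG)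
    (fun x hx κ l h => chainNumerator_eq_zero hq0 hq hσ g hg j hj h)
  -- The variables are doubled: the values s and u_i become independent coordinates which can be
  -- scaled while the parameter y of `G` stays fixed. The result is pulled back to the graph.
  set w : E → (Option ι → ℂ) × E := fun y => (fun o => o.elim (s y) fun i => u i y, y) with hw
  have hwD : ∀ y ∈ Ω, w y ∈ D := by
    intro y hy
    refine ⟨hy, ?_⟩
    rintro (_ | i)
    · exact hs0 y hy
    · exact hu0 y hy i
  refine ⟨fun y => Φ (w y), ?_, fun y hy γ hγ hγR => ?_⟩
  · refine hΦ.comp (DifferentiableOn.prodMk (differentiableOn_pi.2 ?_) differentiableOn_id) hwD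
    rintro (_ | i)
    · exact hs
    · exact hu i
  · change Φ (w y) = _
    rw [hΦeq (w y) (hwD y hy) γ (hγ.mono ?_) hγR, ← cInt_const_mul]
    · refine cInt_congr fun θ hθ => ?_
      have hprod : ∏ κ, pairFactor (g κ * (w y).1 (j κ)) (γ θ) =
          (∏ i, ∏ l : Fin K, pairFactor (q ^ (l : ℕ) * u i y) (γ θ)) *
          ∏ i : Bool × Fin (2 * K), pairFactor (cond i.1 1 (-1) * σ ^ (i.2 : ℕ) * s y) (γ θ) := by
        rw [Fintype.prod_sum_type, Fintype.prod_prod_type]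
        rfl
      rw [hprod]
      simp only [chainNumerator, chainIntegrand, hw, Option.elim_none, Option.elim_some]
      rw [prod_pairFactor_sq_chain hσ hq (2 * K)]
      simp only [prod_pairFactor_chain hq K, Finset.prod_mul_distrib, Finset.prod_div_distrib]
      ring
    · rintro _ ⟨⟨i, m⟩ | ⟨e, m⟩, rfl⟩
      · exact ⟨m, Or.inl ⟨i, by simp [hg, hj, hw, mul_comm]⟩⟩
      · refine ⟨m, Or.inr ?_⟩
        simp only [hg, hj, hw, Sum.elim_inr, Option.elim_none]
        have hsgn : (cond e 1 (-1) : ℂ) ^ 2 = 1 := by rcases e with _ | _ <;> simp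
        rw [mul_pow, mul_pow, hsgn, ← pow_mul, mul_comm (m : ℕ) 2, pow_mul, hσ]
        ring

end Chains

/-! ### The simplified elliptic integrand and its contours -/

section Core

/-- The integrand of the elliptic hypergeometric integral `E(b;t;p,q)` in terms of `b`, `u` and `v`,
after simplification by the duplication formula. -/
noncomputable def ellCore (p q b : ℂ) (u v : Fin 4 → ℂ) (z : ℂ) : ℂ :=
  (qPoch (z ^ 2) q * qPoch (1 / z ^ 2) q) * (qPoch (p * z ^ 2) p * qPoch (p / z ^ 2) p) *
    (pqPoch (p * q / (b * z ^ 2)) p q * pqPoch (p * q * z ^ 2 / b) p q) /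
    (pqPoch (b * z ^ 2) p q * pqPoch (b / z ^ 2) p q) *
  ∏ r, (pqPoch (b * u r * z) p q * pqPoch (b * u r / z) p q *
      (pqPoch (b * v r * z) p q * pqPoch (b * v r / z) p q)) /
    (pqPoch (u r * z) p q * pqPoch (u r / z) p q * (pqPoch (v r * z) p q * pqPoch (v r / z) p q))

/-- The nonzero poles of `ellCore` that accumulate at the origin. -/
def corePoles (p q b : ℂ) (u v : Fin 4 → ℂ) : Set ℂ :=
  {z | z ≠ 0 ∧ ∃ i k : ℕ, (∃ r, z = u r * p ^ i * q ^ k ∨ z = v r * p ^ i * q ^ k) ∨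
    z ^ 2 = b * p ^ i * q ^ k}

variable {p q b : ℂ} {u v : Fin 4 → ℂ}

theorem mem_corePoles_of_pqPoch_eq_zero (hp : ‖p‖ < 1) (hq : ‖q‖ < 1) {z : ℂ} (hz : z ≠ 0) {c : ℂ}
    (hc : ∃ r, c = u r ∨ c = v r) (h : pqPoch (c * z) p q = 0 ∨ pqPoch (c / z) p q = 0) :
    z ∈ corePoles p q b u v ∨ z⁻¹ ∈ corePoles p q b u v := by
  obtain ⟨r, hr⟩ := hc
  have key : ∀ {w : ℂ}, w ≠ 0 → pqPoch (c / w) p q = 0 → w ∈ corePoles p q b u v := by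
    intro w hw h
    have h1 : ¬ ∀ i j : ℕ, c / w * p ^ i * q ^ j ≠ 1 := fun h' =>
      (pqPoch_ne_zero_iff hp hq).2 h' h
    push Not at h1
    obtain ⟨i, k, h1⟩ := h1
    have h2 : w = c * p ^ i * q ^ k := by field_simp at h1; exact h1.symm
    refine ⟨hw, i, k, Or.inl ⟨r, ?_⟩⟩
    rcases hr with rfl | rfl
    · exact Or.inl h2
    · exact Or.inr h2
  rcases h with h | h
  · exact Or.inr (key (inv_ne_zero hz) (by rwa [div_inv_eq_mul]))
  · exact Or.inl (key hz h)

theorem mem_corePoles_of_pqPoch_sq_eq_zero (hp : ‖p‖ < 1) (hq : ‖q‖ < 1) {z : ℂ} (hz : z ≠ 0)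
    (h : pqPoch (b * z ^ 2) p q = 0 ∨ pqPoch (b / z ^ 2) p q = 0) :
    z ∈ corePoles p q b u v ∨ z⁻¹ ∈ corePoles p q b u v := by
  have key : ∀ {w : ℂ}, w ≠ 0 → pqPoch (b / w ^ 2) p q = 0 → w ∈ corePoles p q b u v := by
    intro w hw h
    have h1 : ¬ ∀ i j : ℕ, b / w ^ 2 * p ^ i * q ^ j ≠ 1 := fun h' =>
      (pqPoch_ne_zero_iff hp hq).2 h' h
    push Not at h1
    obtain ⟨i, k, h1⟩ := h1
    refine ⟨hw, i, k, Or.inr ?_⟩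
    field_simp at h1
    exact h1.symm
  rcases h with h | h
  · exact Or.inr (key (inv_ne_zero hz) (by rwa [inv_pow, div_inv_eq_mul]))
  · exact Or.inl (key hz h)

/-- Away from 0 the denominator vanishes only at points of `corePoles` and their reciprocals, and
there the winding numbers are prescribed. No finiteness of the poles is needed. -/
theorem cInt_ellCore_eq (hp : ‖p‖ < 1) (hq : ‖q‖ < 1) {γ₁ γ₂ : ℝ → ℂ}
    (h₁ : Separates γ₁ (corePoles p q b u v)) (h₂ : Separates γ₂ (corePoles p q b u v)) :
    cInt γ₁ (ellCore p q b u v) = cInt γ₂ (ellCore p q b u v) := by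
  set A := corePoles p q b u v with hA
  set den : ℂ → ℂ := fun z => (pqPoch (b * z ^ 2) p q * pqPoch (b / z ^ 2) p q) *
    ∏ r, (pqPoch (u r * z) p q * pqPoch (u r / z) p q * (pqPoch (v r * z) p q * pqPoch (v r / z) p q))
    with hden
  have hcomp : ∀ {f : ℂ → ℂ} {Ω : Set ℂ}, DifferentiableOn ℂ f Ω →
      DifferentiableOn ℂ (fun z => pqPoch (f z) p q) Ω := fun hf =>
    hf.pqPoch (differentiableOn_const _) (differentiableOn_const _) (fun _ _ => hp) (fun _ _ => hq)
  have hcd : ∀ c : ℂ, DifferentiableOn ℂ (fun z : ℂ => c / z) {z | z ≠ 0} := fun c =>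
    (differentiableOn_const c).fun_div differentiableOn_id fun z hz => hz
  have hcd2 : ∀ c : ℂ, DifferentiableOn ℂ (fun z : ℂ => c / z ^ 2) {z | z ≠ 0} := fun c =>
    (differentiableOn_const c).fun_div (by fun_prop) fun z hz => pow_ne_zero 2 hz
  have hdend : DifferentiableOn ℂ den {z | z ≠ 0} :=
    ((hcomp (by fun_prop)).fun_mul (hcomp (hcd2 b))).fun_mul (DifferentiableOn.complex_prod fun r _ =>
      ((hcomp (by fun_prop)).fun_mul (hcomp (hcd _))).fun_mul
      ((hcomp (by fun_prop)).fun_mul (hcomp (hcd _))))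
  have h0open : IsOpen {z : ℂ | z ≠ 0} := isOpen_ne
  have hUopen : IsOpen {z | z ≠ 0 ∧ den z ≠ 0} :=
    hdend.continuousOn.isOpen_inter_preimage h0open isOpen_ne
  have hzero : ∀ z, z ≠ 0 → den z = 0 → z ∈ A ∨ z⁻¹ ∈ A := by
    intro z hz h
    rcases mul_eq_zero.1 h with h | h
    · exact mem_corePoles_of_pqPoch_sq_eq_zero hp hq hz (mul_eq_zero.1 h)
    · obtain ⟨r, -, h⟩ := Finset.prod_eq_zero_iff.1 h
      rcases mul_eq_zero.1 h with h | h
      · exact mem_corePoles_of_pqPoch_eq_zero hp hq hz ⟨r, Or.inl rfl⟩ (mul_eq_zero.1 h)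
      · exact mem_corePoles_of_pqPoch_eq_zero hp hq hz ⟨r, Or.inr rfl⟩ (mul_eq_zero.1 h)
  have hmem : ∀ {γ}, Separates γ A → ∀ x ∈ Icc (0 : ℝ) 1, γ x ∈ {z | z ≠ 0 ∧ den z ≠ 0} := by
    intro γ h x hx
    have hz := (h.2.1 0 (Or.inl rfl)).1 x hx
    refine ⟨hz, fun hd => ?_⟩
    rcases hzero _ hz hd with h1 | h1
    · exact (h.2.1 _ (Or.inr h1)).1 x hx rfl
    · exact (h.2.2 _ h1).1 x hx (inv_inv _).symm
  refine loopIntegral_eq_of_windingNr_eq hUopen ?_ h₁.1 h₂.1 (hmem h₁) (hmem h₂) fun a ha => ?_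
  · have hsub : {z | z ≠ 0 ∧ den z ≠ 0} ⊆ {z : ℂ | z ≠ 0} := fun z hz => hz.1
    have hqc : ∀ {f : ℂ → ℂ} {Ω : Set ℂ}, DifferentiableOn ℂ f Ω →
      DifferentiableOn ℂ (fun z => qPoch (f z) q) Ω := fun hf => hf.qPoch_const hq
    have hpc : ∀ {f : ℂ → ℂ} {Ω : Set ℂ}, DifferentiableOn ℂ f Ω →
      DifferentiableOn ℂ (fun z => qPoch (f z) p) Ω := fun hf => hf.qPoch_const hp
    have hcd3 : DifferentiableOn ℂ (fun z : ℂ => p * q / (b * z ^ 2)) {z | z ≠ 0} := by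
      simp only [← div_div]
      exact hcd2 _
    have hnum : DifferentiableOn ℂ (fun z => ((qPoch (z ^ 2) q * qPoch (1 / z ^ 2) q) *
        (qPoch (p * z ^ 2) p * qPoch (p / z ^ 2) p) *
        (pqPoch (p * q / (b * z ^ 2)) p q * pqPoch (p * q * z ^ 2 / b) p q)) *
        ∏ r, (pqPoch (b * u r * z) p q * pqPoch (b * u r / z) p q *
          (pqPoch (b * v r * z) p q * pqPoch (b * v r / z) p q))) {z | z ≠ 0} :=
      ((((hqc (by fun_prop)).fun_mul (hqc (hcd2 1))).fun_mul ((hpc (by fun_prop)).fun_mul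
        (hpc (hcd2 _)))).fun_mul ((hcomp hcd3).fun_mul (hcomp (by fun_prop)))).fun_mul
        (DifferentiableOn.complex_prod fun r _ =>
          ((hcomp (by fun_prop)).fun_mul (hcomp (hcd _))).fun_mul
          ((hcomp (by fun_prop)).fun_mul (hcomp (hcd _))))
    refine DifferentiableOn.fun_div ?_ (by fun_prop) fun z hz => two_pi_I_mul_ne_zero hz.1
    refine ((hnum.mono hsub).fun_div (hdend.mono hsub) fun z hz => hz.2).congr fun z _ => ?_
    rw [ellCore, Finset.prod_div_distrib, div_mul_div_comm]
  · by_cases ha0 : a = 0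
    · subst ha0
      rw [(h₁.2.1 0 (Or.inl rfl)).2, (h₂.2.1 0 (Or.inl rfl)).2]
    · have hd : den a = 0 := by
        by_contra h
        exact ha ⟨ha0, h⟩
      rcases hzero a ha0 hd with h | h
      · rw [(h₁.2.1 a (Or.inr h)).2, (h₂.2.1 a (Or.inr h)).2]
      · have e1 := (h₁.2.2 _ h).2
        have e2 := (h₂.2.2 _ h).2
        rw [inv_inv] at e1 e2
        rw [e1, e2]

theorem finite_sq_eq (c : ℂ) : {z : ℂ | z ^ 2 = c}.Finite := by
  rcases Set.eq_empty_or_nonempty {z : ℂ | z ^ 2 = c} with h | ⟨w, hw⟩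
  · rw [h]; exact Set.finite_empty
  · refine (Set.toFinite {w, -w}).subset fun z hz => ?_
    rw [Set.mem_ofPred_eq] at hw hz
    exact sq_eq_sq_iff_eq_or_eq_neg.1 (hz.trans hw.symm)

theorem finite_large_pq (hp : ‖p‖ < 1) (hq : ‖q‖ < 1) (c : ℂ) {δ : ℝ} (hδ : 0 < δ) :
    {i : ℕ × ℕ | δ ≤ ‖c * p ^ i.1 * q ^ i.2‖}.Finite := by
  have h1 := (summable_norm_pq c hp hq).tendsto_cofinite_zero.eventually_lt_const hδ
  simp only [norm_neg] at h1
  refine (Filter.eventually_cofinite.1 h1).subset fun i hi => ?_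
  exact not_lt.2 hi

theorem norm_mul_pow_mul_pow_le (hp : ‖p‖ < 1) (hq : ‖q‖ < 1) (c : ℂ) (i k : ℕ) :
    ‖c * p ^ i * q ^ k‖ ≤ ‖c‖ := by
  rw [norm_mul, norm_mul, norm_pow, norm_pow, mul_assoc]
  exact mul_le_of_le_one_right (norm_nonneg _) (mul_le_one₀ (pow_le_one₀ (norm_nonneg _) hp.le)
    (by positivity) (pow_le_one₀ (norm_nonneg _) hq.le))

/-- Since p^i q^k tends to 0, only finitely many poles have modulus at least 1/R'. The contour is
moreover placed in a given annulus, as the continuation argument requires. -/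
theorem exists_separates_corePoles (hp : ‖p‖ < 1) (hq : ‖q‖ < 1)
    (hne : ∀ a ∈ corePoles p q b u v, ∀ c ∈ corePoles p q b u v, a * c ≠ 1) {R R' : ℝ} (hR' : 1 < R') (hR : R' < R)
    (hu : ∀ r, ‖u r‖ < R') (hv : ∀ r, ‖v r‖ < R') (hb : ‖b‖ < R' ^ 2) :
    ∃ γ₀, Separates γ₀ (corePoles p q b u v) ∧ ∀ x ∈ Icc (0 : ℝ) 1, γ₀ x ∈ annulus R := by
  have h0 : 0 < R' := by linarith
  suffices h : {a ∈ corePoles p q b u v | R'⁻¹ ≤ ‖a‖}.Finite ∧ ∀ a ∈ corePoles p q b u v, ‖a‖ < R' by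
    obtain ⟨γ₀, hγ₀, hγR⟩ := exists_separates hR' h.1 h.2 (fun a ha => ha.1) hne
    exact ⟨γ₀, hγ₀, fun x _ => mem_annulus_of_le h0 hR (hγR x).1 (hγR x).2⟩
  constructor
  · have f1 : ∀ c : ℂ, ((fun i : ℕ × ℕ => c * p ^ i.1 * q ^ i.2) ''
        {i | R'⁻¹ ≤ ‖c * p ^ i.1 * q ^ i.2‖}).Finite := fun c =>
      (finite_large_pq hp hq c (inv_pos.2 h0)).image _
    have f2 : (⋃ i ∈ {i : ℕ × ℕ | (R'⁻¹) ^ 2 ≤ ‖b * p ^ i.1 * q ^ i.2‖},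
        {z : ℂ | z ^ 2 = b * p ^ i.1 * q ^ i.2}).Finite :=
      (finite_large_pq hp hq b (by positivity)).biUnion fun i _ => finite_sq_eq _
    refine (((Set.finite_iUnion fun r => f1 (u r)).union (Set.finite_iUnion fun r =>
      f1 (v r))).union f2).subset ?_
    rintro z ⟨⟨-, i, k, ⟨r, h | h⟩ | h⟩, hz⟩
    · exact Or.inl (Or.inl (mem_iUnion.2 ⟨r, (i, k), by rw [h] at hz; exact hz, h.symm⟩))
    · exact Or.inl (Or.inr (mem_iUnion.2 ⟨r, (i, k), by rw [h] at hz; exact hz, h.symm⟩))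
    · refine Or.inr (mem_iUnion₂.2 ⟨(i, k), ?_, h⟩)
      rw [Set.mem_ofPred_eq, ← h, norm_pow]
      exact pow_le_pow_left₀ (by positivity) hz 2
  · rintro z ⟨-, i, k, ⟨r, rfl | rfl⟩ | h⟩
    · exact (norm_mul_pow_mul_pow_le hp hq _ i k).trans_lt (hu r)
    · exact (norm_mul_pow_mul_pow_le hp hq _ i k).trans_lt (hv r)
    · refine lt_of_pow_lt_pow_left₀ 2 h0.le ?_
      rw [← norm_pow, h]
      exact (norm_mul_pow_mul_pow_le hp hq _ i k).trans_lt hb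

end Core

/-! ### Separating the chains that survive at p = 0 -/

section Core

theorem csqrt_sq (z : ℂ) : csqrt z ^ 2 = z := by
  simp [csqrt]

theorem prod_coe_eq_prod_ite {α : Type*} [Fintype α] [DecidableEq α] (I : Finset α) (f : α → ℂ) :
    ∏ i : I, f i = ∏ r, if r ∈ I then f r else 1 := by
  rw [Finset.prod_coe_sort I f, Finset.prod_ite_mem, Finset.univ_inter]

/-- The factors `(v w; p, q)` of the prefactor for `v` and `w` among
`±√b, ±√(bq), ±√(bp), ±√(bpq)`. -/
noncomputable def octetPref (p q b : ℂ) : ℂ :=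
  pqPoch (-b) p q * pqPoch (-(b * q)) p q * (pqPoch (-(b * p)) p q * pqPoch (-(b * p * q)) p q) *
    (pqPoch (b ^ 2 * q) (p ^ 2) (q ^ 2) * (pqPoch (b ^ 2 * p) (p ^ 2) (q ^ 2) *
      pqPoch (b ^ 2 * p * q) (p ^ 2) (q ^ 2) ^ 2 * pqPoch (b ^ 2 * p * q ^ 2) (p ^ 2) (q ^ 2) *
      pqPoch (b ^ 2 * p ^ 2 * q) (p ^ 2) (q ^ 2))) ^ 2

noncomputable def octetRest (p q b : ℂ) : ℂ :=
  pqPoch (-b * p) p q * pqPoch (-(b * q) * p) p q *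
    (pqPoch (-(b * p)) p q * pqPoch (-(b * p * q)) p q) *
    (pqPoch (b ^ 2 * q * p ^ 2) (p ^ 2) (q ^ 2) * (pqPoch (b ^ 2 * p) (p ^ 2) (q ^ 2) *
      pqPoch (b ^ 2 * p * q) (p ^ 2) (q ^ 2) ^ 2 * pqPoch (b ^ 2 * p * q ^ 2) (p ^ 2) (q ^ 2) *
      pqPoch (b ^ 2 * p ^ 2 * q) (p ^ 2) (q ^ 2))) ^ 2

theorem octetPref_eq {p q : ℂ} (hp : ‖p‖ < 1) (hq : ‖q‖ < 1) (b : ℂ) : octetPref p q b =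
    qPoch (-b) q * qPoch (-(b * q)) q * qPoch (b ^ 2 * q) (q ^ 2) ^ 2 * octetRest p q b := by
  rw [octetPref, octetRest, pqPoch_eq_qPoch_mul hp hq (-b), pqPoch_eq_qPoch_mul hp hq (-(b * q)),
    pqPoch_eq_qPoch_mul (norm_sq_lt_one hp) (norm_sq_lt_one hq) (b ^ 2 * q)]
  ring

/-- The prefactor of the elliptic hypergeometric integral, divided by `ellDenom`. -/
noncomputable def corePref (p q b : ℂ) (u v : Fin 4 → ℂ) : ℂ :=
  (∏ r, ∏ s, if r < s then pqPoch (u r * u s) p q *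
    (pqPoch (u r * v s) p q * pqPoch (v r * u s) p q * pqPoch (v r * v s) p q) else 1) *
  (∏ r, pqPoch (u r * v r) p q) * octetPref p q b

/-- In the continuation, `I` consists of the indices whose u_r does not tend to 0. Zeros that
compensate pinches come from pairs inside `I` and are left to `chainPref`; this complementary factor
only has to be holomorphic. -/
noncomputable def coreRest (I : Finset (Fin 4)) (p q b : ℂ) (u v : Fin 4 → ℂ) : ℂ :=
  (∏ r, ∏ s, if r < s then (if r ∈ I ∧ s ∈ I then 1 else qPoch (u r * u s) q) *
    pqPoch (u r * u s * p) p q *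
    (pqPoch (u r * v s) p q * pqPoch (v r * u s) p q * pqPoch (v r * v s) p q) else 1) *
  (∏ r, pqPoch (u r * v r) p q) * octetRest p q b

theorem prod_coe_pairs (I : Finset (Fin 4)) (f : Fin 4 → Fin 4 → ℂ) :
    (∏ i : I, ∏ j : I, if i < j then f i j else 1) =
      ∏ r, ∏ s, if r < s then (if r ∈ I ∧ s ∈ I then f r s else 1) else 1 := by
  have h1 : ∀ r : Fin 4, (∏ j : I, if r < (j : Fin 4) then f r j else 1) =
      ∏ s, if s ∈ I then (if r < s then f r s else 1) else 1 := fun r =>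
    prod_coe_eq_prod_ite I fun s => if r < s then f r s else 1
  have h2 := prod_coe_eq_prod_ite I fun r => ∏ s, if s ∈ I then (if r < s then f r s else 1) else 1
  simp only [← h1] at h2
  refine Eq.trans h2 (Finset.prod_congr rfl fun r _ => ?_)
  by_cases hr : r ∈ I
  · rw [if_pos hr, h1]
    refine Finset.prod_congr rfl fun s _ => ?_
    by_cases hs : s ∈ I <;> simp [hr, hs]
  · simp [hr]

theorem corePref_eq {p q : ℂ} (hp : ‖p‖ < 1) (hq : ‖q‖ < 1) (I : Finset (Fin 4)) (b : ℂ)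
    (u v : Fin 4 → ℂ) :
    corePref p q b u v = chainPref q b (fun i : I => u i) * coreRest I p q b u v := by
  have h1 : (∏ r, ∏ s, if r < s then pqPoch (u r * u s) p q *
      (pqPoch (u r * v s) p q * pqPoch (v r * u s) p q * pqPoch (v r * v s) p q) else 1) =
      (∏ i : I, ∏ j : I, if i < j then qPoch (u i * u j) q else 1) *
      (∏ r, ∏ s, if r < s then (if r ∈ I ∧ s ∈ I then 1 else qPoch (u r * u s) q) *
        pqPoch (u r * u s * p) p q *
        (pqPoch (u r * v s) p q * pqPoch (v r * u s) p q * pqPoch (v r * v s) p q) else 1) := by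
    rw [prod_coe_pairs I fun r s => qPoch (u r * u s) q, ← Finset.prod_mul_distrib]
    refine Finset.prod_congr rfl fun r _ => ?_
    rw [← Finset.prod_mul_distrib]
    refine Finset.prod_congr rfl fun s _ => ?_
    by_cases hrs : r < s
    · rw [if_pos hrs, if_pos hrs, if_pos hrs, pqPoch_eq_qPoch_mul hp hq (u r * u s)]
      by_cases hI : r ∈ I ∧ s ∈ I
      · rw [if_pos hI, if_pos hI]; ring
      · rw [if_neg hI, if_neg hI]; ring
    · simp [hrs]
  rw [corePref, coreRest, chainPref, h1, octetPref_eq hp hq]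
  ring

/-- The part of `ellCore` without the factors with poles in an annulus. -/
noncomputable def coreRemainder (I : Finset (Fin 4)) (p q b : ℂ) (u v : Fin 4 → ℂ) (z : ℂ) : ℂ :=
  (qPoch (p * z ^ 2) p * qPoch (p / z ^ 2) p) *
    (pqPoch (p * q / (b * z ^ 2)) p q * pqPoch (p * q * z ^ 2 / b) p q) /
    (pqPoch (b * z ^ 2 * p) p q * pqPoch (b / z ^ 2 * p) p q) *
  (∏ r, (pqPoch (b * u r * z * p) p q * pqPoch (b * u r / z * p) p q *
      (pqPoch (b * v r * z) p q * pqPoch (b * v r / z) p q)) /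
    (pqPoch (u r * z * p) p q * pqPoch (u r / z * p) p q *
      (pqPoch (v r * z) p q * pqPoch (v r / z) p q))) *
  ∏ r, if r ∈ I then 1 else
    (qPoch (b * u r * z) q * qPoch (b * u r / z) q) / (qPoch (u r * z) q * qPoch (u r / z) q)

theorem ellCore_eq {p q : ℂ} (hp : ‖p‖ < 1) (hq : ‖q‖ < 1) (I : Finset (Fin 4)) (b : ℂ)
    (u v : Fin 4 → ℂ) (z : ℂ) : ellCore p q b u v z =
      coreRemainder I p q b u v z * chainIntegrand q b (fun i : I => u i) z := by
  have h1 : (∏ r, (pqPoch (b * u r * z) p q * pqPoch (b * u r / z) p q *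
      (pqPoch (b * v r * z) p q * pqPoch (b * v r / z) p q)) /
    (pqPoch (u r * z) p q * pqPoch (u r / z) p q * (pqPoch (v r * z) p q * pqPoch (v r / z) p q))) =
    (∏ r, (pqPoch (b * u r * z * p) p q * pqPoch (b * u r / z * p) p q *
      (pqPoch (b * v r * z) p q * pqPoch (b * v r / z) p q)) /
    (pqPoch (u r * z * p) p q * pqPoch (u r / z * p) p q *
      (pqPoch (v r * z) p q * pqPoch (v r / z) p q))) *
    (∏ r, if r ∈ I then 1 else
    (qPoch (b * u r * z) q * qPoch (b * u r / z) q) / (qPoch (u r * z) q * qPoch (u r / z) q)) *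
    (∏ i : I, qPoch (b * u i * z) q * qPoch (b * u i / z) q / (qPoch (u i * z) q * qPoch (u i / z) q))
      := by
    rw [prod_coe_eq_prod_ite I fun r => qPoch (b * u r * z) q * qPoch (b * u r / z) q /
      (qPoch (u r * z) q * qPoch (u r / z) q), ← Finset.prod_mul_distrib, ← Finset.prod_mul_distrib]
    refine Finset.prod_congr rfl fun r _ => ?_
    rw [pqPoch_eq_qPoch_mul hp hq (b * u r * z), pqPoch_eq_qPoch_mul hp hq (b * u r / z),
      pqPoch_eq_qPoch_mul hp hq (u r * z), pqPoch_eq_qPoch_mul hp hq (u r / z)]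
    by_cases hr : r ∈ I
    · rw [if_pos hr, if_pos hr]; ring
    · rw [if_neg hr, if_neg hr]; ring
  rw [ellCore, h1, coreRemainder, chainIntegrand, pqPoch_eq_qPoch_mul hp hq (b * z ^ 2),
    pqPoch_eq_qPoch_mul hp hq (b / z ^ 2)]
  ring

/-- The conditions on the parameters under which `coreRemainder` is holomorphic in the annulus. -/
structure CoreAdmissible (I : Finset (Fin 4)) (R' R : ℝ) (b₀ : ℂ)
    (y : ℂ × (Fin 4 → ℂ) × (Fin 4 → ℂ) × ℂ) : Prop where
  norm_p : ‖y.2.2.2‖ < 1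
  b_slit : y.1 / b₀ ∈ Complex.slitPlane
  norm_sqrt : ‖csqrt b₀ * csqrt (y.1 / b₀)‖ < R'
  norm_u : ∀ r, ‖y.2.1 r‖ < R'
  norm_v : ∀ r, ‖y.2.2.1 r‖ < R'
  u_ne_zero : ∀ r ∈ I, y.2.1 r ≠ 0
  norm_u_small : ∀ r, r ∉ I → ‖y.2.1 r‖ * R < 1
  norm_v_small : ∀ r, ‖y.2.2.1 r‖ * R < 1
  norm_up : ∀ r, ‖y.2.1 r * y.2.2.2‖ * R < 1
  norm_bp : ‖y.1 * y.2.2.2‖ * R ^ 2 < 1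

theorem differentiableAt_csqrt {X : Type*} [NormedAddCommGroup X] [NormedSpace ℂ X] {f : X → ℂ} {x : X}
    (hf : DifferentiableAt ℂ f x) (h : f x ∈ Complex.slitPlane) :
    DifferentiableAt ℂ (fun x => csqrt (f x)) x :=
  hf.cpow (differentiableAt_const _) h

theorem eventually_coreAdmissible {I : Finset (Fin 4)} {R' R : ℝ} {b₀ : ℂ} {u₀ : Fin 4 → ℂ} (hb₀ : b₀ ≠ 0)
    (hI : ∀ r, r ∈ I ↔ u₀ r ≠ 0) (hs : ‖csqrt b₀‖ < R') (hu : ∀ r, ‖u₀ r‖ < R') (hR' : 0 < R') :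
    ∀ᶠ y in 𝓝 ((b₀, u₀, 0, 0) : ℂ × (Fin 4 → ℂ) × (Fin 4 → ℂ) × ℂ),
      CoreAdmissible I R' R b₀ y := by
  set y₀ : ℂ × (Fin 4 → ℂ) × (Fin 4 → ℂ) × ℂ := (b₀, u₀, 0, 0) with hy₀
  have hlt : ∀ {f : ℂ × (Fin 4 → ℂ) × (Fin 4 → ℂ) × ℂ → ℝ} {c : ℝ}, ContinuousAt f y₀ → f y₀ < c →
      ∀ᶠ y in 𝓝 y₀, f y < c := fun hf h => hf.tendsto.eventually_lt_const h
  have hbb : b₀ / b₀ = 1 := div_self hb₀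
  have hs1 : csqrt 1 = 1 := by simp [csqrt]
  have e1 : ∀ᶠ y in 𝓝 y₀, ‖y.2.2.2‖ < 1 := hlt (by fun_prop) (by simp [y₀])
  have e2 : ∀ᶠ y in 𝓝 y₀, y.1 / b₀ ∈ Complex.slitPlane := by
    have hc : ContinuousAt (fun y : ℂ × (Fin 4 → ℂ) × (Fin 4 → ℂ) × ℂ => y.1 / b₀) y₀ := by fun_prop
    exact hc (Complex.isOpen_slitPlane.mem_nhds (by simp [y₀, hbb]))
  have e3 : ∀ᶠ y in 𝓝 y₀, ‖csqrt b₀ * csqrt (y.1 / b₀)‖ < R' := by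
    refine hlt (ContinuousAt.norm (ContinuousAt.mul continuousAt_const ?_)) (by simp [y₀, hbb, hs1, hs])
    exact (differentiableAt_csqrt (by fun_prop) (by simp [y₀, hbb])).continuousAt
  have e4 : ∀ᶠ y in 𝓝 y₀, ∀ r, ‖y.2.1 r‖ < R' :=
    eventually_all.2 fun r => hlt (by fun_prop) (by simpa [y₀] using hu r)
  have e5 : ∀ᶠ y in 𝓝 y₀, ∀ r, ‖y.2.2.1 r‖ < R' :=
    eventually_all.2 fun r => hlt (by fun_prop) (by simpa [y₀] using hR')
  have e6 : ∀ᶠ y in 𝓝 y₀, ∀ r ∈ I, y.2.1 r ≠ 0 := by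
    refine eventually_all.2 fun r => ?_
    by_cases hr : r ∈ I
    · have hc : ContinuousAt (fun y : ℂ × (Fin 4 → ℂ) × (Fin 4 → ℂ) × ℂ => y.2.1 r) y₀ := by fun_prop
      filter_upwards [hc.eventually_ne ((hI r).1 hr)] with y hy _
      exact hy
    · exact Eventually.of_forall fun y h => absurd h hr
  have e7 : ∀ᶠ y in 𝓝 y₀, ∀ r, r ∉ I → ‖y.2.1 r‖ * R < 1 := by
    refine eventually_all.2 fun r => ?_
    by_cases hr : r ∈ I
    · exact Eventually.of_forall fun y h => absurd hr h
    · have h0 : u₀ r = 0 := by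
        by_contra h
        exact hr ((hI r).2 h)
      filter_upwards [hlt (f := fun y => ‖y.2.1 r‖ * R) (c := 1) (by fun_prop) (by simp [y₀, h0])]
        with y hy _
      exact hy
  have e8 : ∀ᶠ y in 𝓝 y₀, ∀ r, ‖y.2.2.1 r‖ * R < 1 :=
    eventually_all.2 fun r => hlt (by fun_prop) (by simp [y₀])
  have e9 : ∀ᶠ y in 𝓝 y₀, ∀ r, ‖y.2.1 r * y.2.2.2‖ * R < 1 :=
    eventually_all.2 fun r => hlt (by fun_prop) (by simp [y₀])
  have e10 : ∀ᶠ y in 𝓝 y₀, ‖y.1 * y.2.2.2‖ * R ^ 2 < 1 := hlt (by fun_prop) (by simp [y₀])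
  filter_upwards [e1, e2, e3, e4, e5, e6, e7, e8, e9, e10] with y h1 h2 h3 h4 h5 h6 h7 h8 h9 h10
  exact ⟨h1, h2, h3, h4, h5, h6, h7, h8, h9, h10⟩

end Core

/-! ### Continuation to a neighbourhood of p = 0, v = 0 -/

section Core

variable {I : Finset (Fin 4)} {R' R : ℝ} {b₀ q : ℂ}

theorem CoreAdmissible.b_ne_zero {y : ℂ × (Fin 4 → ℂ) × (Fin 4 → ℂ) × ℂ}
    (h : CoreAdmissible I R' R b₀ y) : y.1 ≠ 0 := by
  intro h0
  have h1 := h.b_slit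
  rw [h0, zero_div] at h1
  exact Complex.zero_notMem_slitPlane h1

/-- The factor b/b₀ stays in the slit plane, so this product is a holomorphic branch of √b near
every nonzero b₀, including the negative axis. -/
theorem CoreAdmissible.sqrt_sq {y : ℂ × (Fin 4 → ℂ) × (Fin 4 → ℂ) × ℂ}
    (h : CoreAdmissible I R' R b₀ y) : (csqrt b₀ * csqrt (y.1 / b₀)) ^ 2 = y.1 := by
  have hb : b₀ ≠ 0 := by
    rintro rfl
    have h1 := h.b_slit
    rw [div_zero] at h1
    exact Complex.zero_notMem_slitPlane h1
  rw [mul_pow, csqrt_sq, csqrt_sq, mul_div_cancel₀ _ hb]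

theorem norm_mul_lt_one_of_mem_annulus (hR : 0 < R) {c z : ℂ} (hz : z ∈ annulus R)
    (h : ‖c‖ * R < 1) : ‖c * z‖ < 1 ∧ ‖c / z‖ < 1 := by
  have hzi : ‖z‖⁻¹ < R := (inv_lt_comm₀ hR (norm_pos_iff.2 (ne_zero_of_mem_annulus hR hz))).1 hz.1
  constructor
  · rw [norm_mul]
    exact lt_of_le_of_lt (mul_le_mul_of_nonneg_left hz.2.le (norm_nonneg _)) h
  · rw [norm_div, div_eq_mul_inv]
    exact lt_of_le_of_lt (mul_le_mul_of_nonneg_left hzi.le (norm_nonneg _)) h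

theorem norm_mul_sq_lt_one_of_mem_annulus (hR : 0 < R) {c z : ℂ} (hz : z ∈ annulus R)
    (h : ‖c‖ * R ^ 2 < 1) : ‖c * z ^ 2‖ < 1 ∧ ‖c / z ^ 2‖ < 1 := by
  have hzi : ‖z‖⁻¹ < R := (inv_lt_comm₀ hR (norm_pos_iff.2 (ne_zero_of_mem_annulus hR hz))).1 hz.1
  constructor
  · rw [norm_mul, norm_pow]
    exact lt_of_le_of_lt (mul_le_mul_of_nonneg_left
      (pow_le_pow_left₀ (norm_nonneg _) hz.2.le 2) (norm_nonneg _)) h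
  · rw [norm_div, norm_pow, div_eq_mul_inv, ← inv_pow]
    exact lt_of_le_of_lt (mul_le_mul_of_nonneg_left
      (pow_le_pow_left₀ (by positivity) hzi.le 2) (norm_nonneg _)) h

theorem differentiableOn_coreRemainder (hq : ‖q‖ < 1) (hR : 0 < R)
    {Ω : Set (ℂ × (Fin 4 → ℂ) × (Fin 4 → ℂ) × ℂ)} (hΩ : ∀ y ∈ Ω, CoreAdmissible I R' R b₀ y) :
    DifferentiableOn ℂ (Function.uncurry fun (y : ℂ × (Fin 4 → ℂ) × (Fin 4 → ℂ) × ℂ) z =>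
      coreRemainder I y.2.2.2 q y.1 y.2.1 y.2.2.1 z) (Ω ×ˢ annulus R) := by
  set D := Ω ×ˢ annulus R with hD
  have hz0 : ∀ x ∈ D, x.2 ≠ 0 := fun x hx => ne_zero_of_mem_annulus hR hx.2
  have hz20 : ∀ x ∈ D, x.2 ^ 2 ≠ 0 := fun x hx => pow_ne_zero 2 (hz0 x hx)
  have hb0 : ∀ x ∈ D, x.1.1 ≠ 0 := fun x hx => (hΩ _ hx.1).b_ne_zero
  have hp1 : ∀ x ∈ D, ‖x.1.2.2.2‖ < 1 := fun x hx => (hΩ _ hx.1).norm_p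
  have hc : ∀ {c : ℂ}, DifferentiableOn ℂ
      (fun _ : (ℂ × (Fin 4 → ℂ) × (Fin 4 → ℂ) × ℂ) × ℂ => c) D := differentiableOn_const _
  have hb : DifferentiableOn ℂ (fun x : (ℂ × (Fin 4 → ℂ) × (Fin 4 → ℂ) × ℂ) × ℂ => x.1.1) D := by
    fun_prop
  have hu : ∀ r, DifferentiableOn ℂ
      (fun x : (ℂ × (Fin 4 → ℂ) × (Fin 4 → ℂ) × ℂ) × ℂ => x.1.2.1 r) D := fun r => by fun_prop
  have hv : ∀ r, DifferentiableOn ℂ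
      (fun x : (ℂ × (Fin 4 → ℂ) × (Fin 4 → ℂ) × ℂ) × ℂ => x.1.2.2.1 r) D := fun r => by fun_prop
  have hp : DifferentiableOn ℂ (fun x : (ℂ × (Fin 4 → ℂ) × (Fin 4 → ℂ) × ℂ) × ℂ => x.1.2.2.2) D := by
    fun_prop
  have hz : DifferentiableOn ℂ (fun x : (ℂ × (Fin 4 → ℂ) × (Fin 4 → ℂ) × ℂ) × ℂ => x.2) D := by
    fun_prop
  have hz2 : DifferentiableOn ℂ (fun x : (ℂ × (Fin 4 → ℂ) × (Fin 4 → ℂ) × ℂ) × ℂ => x.2 ^ 2) D := by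
    fun_prop
  have hP : ∀ {f : (ℂ × (Fin 4 → ℂ) × (Fin 4 → ℂ) × ℂ) × ℂ → ℂ}, DifferentiableOn ℂ f D →
      DifferentiableOn ℂ (fun x => pqPoch (f x) x.1.2.2.2 q) D := fun hf =>
    hf.pqPoch hp hc hp1 fun _ _ => hq
  have hPp : ∀ {f : (ℂ × (Fin 4 → ℂ) × (Fin 4 → ℂ) × ℂ) × ℂ → ℂ}, DifferentiableOn ℂ f D →
      DifferentiableOn ℂ (fun x => qPoch (f x) x.1.2.2.2) D := fun hf => hf.qPoch hp hp1
  refine DifferentiableOn.fun_mul (DifferentiableOn.fun_mul (DifferentiableOn.complex_div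
    (DifferentiableOn.fun_mul ((hPp (hp.fun_mul hz2)).fun_mul (hPp (hp.complex_div hz2 hz20)))
      ((hP ((hp.fun_mul hc).complex_div (hb.fun_mul hz2) fun x hx =>
        mul_ne_zero (hb0 x hx) (hz20 x hx))).fun_mul
        (hP (((hp.fun_mul hc).fun_mul hz2).complex_div hb hb0))))
      ((hP ((hb.fun_mul hz2).fun_mul hp)).fun_mul (hP ((hb.complex_div hz2 hz20).fun_mul hp))) ?_)
      (DifferentiableOn.complex_prod fun r _ => ?_)) (DifferentiableOn.complex_prod fun r _ => ?_)
  · intro x hx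
    have h1 := norm_mul_sq_lt_one_of_mem_annulus hR hx.2 (hΩ _ hx.1).norm_bp
    rw [mul_right_comm, mul_div_right_comm] at h1
    exact mul_ne_zero (pqPoch_ne_zero_of_norm_lt (hp1 x hx) hq h1.1)
      (pqPoch_ne_zero_of_norm_lt (hp1 x hx) hq h1.2)
  · refine DifferentiableOn.complex_div
      (((hP ((((hb.fun_mul (hu r)).fun_mul hz)).fun_mul hp)).fun_mul
      (hP (((hb.fun_mul (hu r)).complex_div hz hz0).fun_mul hp))).fun_mul
      ((hP ((hb.fun_mul (hv r)).fun_mul hz)).fun_mul (hP ((hb.fun_mul (hv r)).complex_div hz hz0))))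
      (((hP (((hu r).fun_mul hz).fun_mul hp)).fun_mul
      (hP (((hu r).complex_div hz hz0).fun_mul hp))).fun_mul
      ((hP ((hv r).fun_mul hz)).fun_mul (hP ((hv r).complex_div hz hz0)))) fun x hx => ?_
    have h1 := norm_mul_lt_one_of_mem_annulus hR hx.2 ((hΩ _ hx.1).norm_up r)
    have h2 := norm_mul_lt_one_of_mem_annulus hR hx.2 ((hΩ _ hx.1).norm_v_small r)
    rw [mul_right_comm, mul_div_right_comm] at h1
    exact mul_ne_zero (mul_ne_zero (pqPoch_ne_zero_of_norm_lt (hp1 x hx) hq h1.1)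
      (pqPoch_ne_zero_of_norm_lt (hp1 x hx) hq h1.2)) (mul_ne_zero
      (pqPoch_ne_zero_of_norm_lt (hp1 x hx) hq h2.1) (pqPoch_ne_zero_of_norm_lt (hp1 x hx) hq h2.2))
  · by_cases hr : r ∈ I
    · simp only [if_pos hr]
      exact hc
    · simp only [if_neg hr]
      refine DifferentiableOn.complex_div
        ((((hb.fun_mul (hu r)).fun_mul hz).qPoch_const hq).fun_mul
        (((hb.fun_mul (hu r)).complex_div hz hz0).qPoch_const hq))
        ((((hu r).fun_mul hz).qPoch_const hq).fun_mul
        (((hu r).complex_div hz hz0).qPoch_const hq)) fun x hx => ?_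
      have h1 := norm_mul_lt_one_of_mem_annulus hR hx.2 ((hΩ _ hx.1).norm_u_small r hr)
      exact mul_ne_zero (qPoch_ne_zero_of_norm_lt hq h1.1) (qPoch_ne_zero_of_norm_lt hq h1.2)

theorem differentiableOn_coreRest (hq : ‖q‖ < 1)
    {Ω : Set (ℂ × (Fin 4 → ℂ) × (Fin 4 → ℂ) × ℂ)} (hΩ : ∀ y ∈ Ω, ‖y.2.2.2‖ < 1) :
    DifferentiableOn ℂ (fun y : ℂ × (Fin 4 → ℂ) × (Fin 4 → ℂ) × ℂ =>
      coreRest I y.2.2.2 q y.1 y.2.1 y.2.2.1) Ω := by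
  have hq2 := norm_sq_lt_one hq
  have hc : ∀ {c : ℂ}, DifferentiableOn ℂ
      (fun _ : ℂ × (Fin 4 → ℂ) × (Fin 4 → ℂ) × ℂ => c) Ω := differentiableOn_const _
  have hp : DifferentiableOn ℂ (fun x : ℂ × (Fin 4 → ℂ) × (Fin 4 → ℂ) × ℂ => x.2.2.2) Ω := by
    fun_prop
  have hP : ∀ {f : ℂ × (Fin 4 → ℂ) × (Fin 4 → ℂ) × ℂ → ℂ}, DifferentiableOn ℂ f Ω →
      DifferentiableOn ℂ (fun x => pqPoch (f x) x.2.2.2 q) Ω := fun hf =>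
    hf.pqPoch hp hc hΩ fun _ _ => hq
  have hP2 : ∀ {f : ℂ × (Fin 4 → ℂ) × (Fin 4 → ℂ) × ℂ → ℂ}, DifferentiableOn ℂ f Ω →
      DifferentiableOn ℂ (fun x => pqPoch (f x) (x.2.2.2 ^ 2) (q ^ 2)) Ω := fun hf =>
    hf.pqPoch (hp.fun_pow 2) hc (fun y hy => norm_sq_lt_one (hΩ y hy)) fun _ _ => hq2
  refine DifferentiableOn.fun_mul (DifferentiableOn.fun_mul (DifferentiableOn.complex_prod fun r _ =>
    DifferentiableOn.complex_prod fun s _ => ?_) (DifferentiableOn.complex_prod fun r _ =>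
    hP (by fun_prop))) ?_
  · by_cases hrs : r < s
    · simp only [if_pos hrs]
      refine DifferentiableOn.fun_mul (DifferentiableOn.fun_mul ?_ (hP (by fun_prop)))
        (((hP (by fun_prop)).fun_mul (hP (by fun_prop))).fun_mul (hP (by fun_prop)))
      by_cases hI : r ∈ I ∧ s ∈ I
      · simp only [if_pos hI]
        exact hc
      · simp only [if_neg hI]
        exact DifferentiableOn.qPoch_const hq (by fun_prop)
    · simp only [if_neg hrs]
      exact hc
  · exact (((hP (by fun_prop)).fun_mul (hP (by fun_prop))).fun_mul ((hP (by fun_prop)).fun_mul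
      (hP (by fun_prop)))).fun_mul (((hP2 (by fun_prop)).fun_mul ((((hP2 (by fun_prop)).fun_mul
      ((hP2 (by fun_prop)).fun_pow 2)).fun_mul (hP2 (by fun_prop))).fun_mul
      (hP2 (by fun_prop)))).fun_pow 2)

/-- The renormalized integral extends holomorphically to a neighbourhood of each point with
`p = 0` and `v = 0`. -/
theorem exists_core_extension (hq0 : q ≠ 0) (hq : ‖q‖ < 1) (hb₀ : b₀ ≠ 0) (u₀ : Fin 4 → ℂ) :
    ∃ (Ω : Set (ℂ × (Fin 4 → ℂ) × (Fin 4 → ℂ) × ℂ)) (Ψ : ℂ × (Fin 4 → ℂ) × (Fin 4 → ℂ) × ℂ → ℂ),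
      IsOpen Ω ∧ (b₀, u₀, 0, 0) ∈ Ω ∧ DifferentiableOn ℂ Ψ Ω ∧ ∀ b u v p, (b, u, v, p) ∈ Ω →
        ‖p‖ < 1 ∧ ∀ γ, Separates γ (corePoles p q b u v) →
          Ψ (b, u, v, p) = corePref p q b u v * (qPoch p p * qPoch q q / 2) *
            cInt γ (ellCore p q b u v) := by
  classical
  set I : Finset (Fin 4) := Finset.univ.filter fun r => u₀ r ≠ 0 with hIdef
  have hI : ∀ r, r ∈ I ↔ u₀ r ≠ 0 := fun r => by simp [hIdef]
  -- Larger than 1, than √b₀ and than all u₀ in modulus, so all chains start inside the circle of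
  -- radius R'.
  set R' : ℝ := 2 + ‖csqrt b₀‖ + ∑ r, ‖u₀ r‖ with hR'def
  set R : ℝ := R' + 1 with hRdef
  have hsum : 0 ≤ ∑ r, ‖u₀ r‖ := Finset.sum_nonneg fun r _ => norm_nonneg _
  have hsn := norm_nonneg (csqrt b₀)
  have hR' : 1 < R' := by linarith
  have hR : R' < R := by linarith
  have hu₀ : ∀ r, ‖u₀ r‖ < R' := fun r => by
    have := Finset.single_le_sum (f := fun r => ‖u₀ r‖) (fun r _ => norm_nonneg _) (Finset.mem_univ r)
    linarith
  obtain ⟨Ω, hΩs, hΩ, h0Ω⟩ := eventually_nhds_iff.1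
    (eventually_coreAdmissible (I := I) (R' := R') (R := R) hb₀ hI (by linarith) hu₀ (by linarith))
  obtain ⟨Φ, hΦ, hΦeq⟩ := exists_chain_extension (ι := I) hq0 hq (csqrt_sq q) hR' hR hΩ
    (u := fun i y => y.2.1 i) (s := fun y => csqrt b₀ * csqrt (y.1 / b₀)) (fun i => by fun_prop)
    (fun y hy => (DifferentiableAt.fun_mul (differentiableAt_const _) (differentiableAt_csqrt
      (f := fun y : ℂ × (Fin 4 → ℂ) × (Fin 4 → ℂ) × ℂ => y.1 / b₀)
      (by fun_prop) (hΩs y hy).b_slit)).differentiableWithinAt)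
    (fun y hy i => ⟨(hΩs y hy).u_ne_zero i i.2, (hΩs y hy).norm_u i⟩)
    (fun y hy => ⟨fun h => (hΩs y hy).b_ne_zero (by rw [← (hΩs y hy).sqrt_sq, h]; simp),
      (hΩs y hy).norm_sqrt⟩)
    (differentiableOn_coreRemainder (I := I) (R' := R') (b₀ := b₀) hq (by linarith) hΩs)
  refine ⟨Ω, fun y => coreRest I y.2.2.2 q y.1 y.2.1 y.2.2.1 * (qPoch y.2.2.2 y.2.2.2 * qPoch q q / 2) *
    Φ y, hΩ, h0Ω, ?_, ?_⟩
  · refine ((differentiableOn_coreRest hq fun y hy => (hΩs y hy).norm_p).fun_mul ?_).fun_mul hΦ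
    have h1 : DifferentiableOn ℂ (fun y : ℂ × (Fin 4 → ℂ) × (Fin 4 → ℂ) × ℂ => y.2.2.2) Ω := by fun_prop
    simp only [div_eq_mul_inv]
    exact ((h1.qPoch h1 fun y hy => (hΩs y hy).norm_p).fun_mul
      (differentiableOn_const _)).fun_mul (differentiableOn_const _)
  · intro b u v p hy
    have hadm := hΩs _ hy
    have hp : ‖p‖ < 1 := hadm.norm_p
    have hb0 : b ≠ 0 := hadm.b_ne_zero
    have hsq : (csqrt b₀ * csqrt (b / b₀)) ^ 2 = b := hadm.sqrt_sq
    refine ⟨hp, fun γ hγ => ?_⟩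
    have hbR : ‖b‖ < R' ^ 2 := by
      rw [← hsq, norm_pow]
      exact pow_lt_pow_left₀ hadm.norm_sqrt (norm_nonneg _) two_ne_zero
    -- The given contour may leave the annulus on which the extension was constructed. That it
    -- separates the poles implies that a contour inside the annulus exists, and both give the same
    -- integral.
    obtain ⟨γ₀, hγ₀, hγ₀R⟩ := exists_separates_corePoles hp hq
      (fun a ha c hc => hγ.mul_ne_one ha hc) hR' hR hadm.norm_u hadm.norm_v hbR
    have h1 := hΦeq _ hy γ₀ (hγ₀.mono ?_) hγ₀R
    · rw [cInt_ellCore_eq hp hq hγ hγ₀, corePref_eq hp hq I]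
      simp only [hsq] at h1
      have h2 : ellCore p q b u v = fun z =>
          coreRemainder I p q b u v z * chainIntegrand q b (fun i : I => u i) z :=
        funext fun z => ellCore_eq hp hq I b u v z
      change _ * _ * Φ (b, u, v, p) = _
      rw [h1, h2]
      ring
    · simp only [hsq]
      rintro z ⟨k, ⟨i, hz⟩ | hz⟩
      · exact ⟨by rw [hz]; exact mul_ne_zero (hadm.u_ne_zero i i.2) (pow_ne_zero k hq0), 0, k,
          Or.inl ⟨i, Or.inl (by rw [hz]; simp)⟩⟩
      · refine ⟨?_, 0, k, Or.inr (by rw [hz]; simp)⟩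
        rintro rfl
        have : b * q ^ k ≠ 0 := mul_ne_zero hb0 (pow_ne_zero k hq0)
        exact this (by rw [← hz]; simp)

end Core

/-! ### Identification of the value at p = 0 -/

section Limit

variable {q b : ℂ} {τ : Fin 4 → ℝ} {t : Fin 4 → ℂ}

/-- The parameters of the limiting integral, or `0` for parameters that disappear in the limit. -/
noncomputable def limParams (q : ℂ) (τ : Fin 4 → ℝ) (b : ℂ) (t : Fin 4 → ℂ) (r : Fin 4) : ℂ :=
  if τ r = 0 then t r else if τ r = 1 then q / (b * t r) else 0

/-- At p = 0 only the index i = 0 gives nonzero points. The condition z ≠ 0 in `corePoles` discards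
the points produced by vanishing u_r, v_r and p. -/
theorem corePoles_zero (hq0 : q ≠ 0) (hb : b ≠ 0) (ht : ∀ r, t r ≠ 0) :
    corePoles 0 q b (limParams q τ b t) 0 = limPoles q τ b t := by
  ext z
  constructor
  · rintro ⟨hz, i, k, h⟩
    rcases Nat.eq_zero_or_pos i with rfl | hi
    · simp only [pow_zero, mul_one] at h
      rcases h with ⟨r, h | h⟩ | h
      · simp only [limParams] at h
        by_cases h0 : τ r = 0
        · rw [if_pos h0] at h
          exact ⟨k, Or.inl ⟨r, h0, h⟩⟩
        · by_cases h1 : τ r = 1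
          · rw [if_neg h0, if_pos h1] at h
            exact ⟨k, Or.inr (Or.inl ⟨r, h1, h⟩)⟩
          · rw [if_neg h0, if_neg h1, zero_mul] at h
            exact absurd h hz
      · exact absurd (by simpa using h) hz
      · exact ⟨k, Or.inr (Or.inr h)⟩
    · rw [zero_pow hi.ne'] at h
      simp [hz] at h
  · rintro ⟨k, ⟨r, h0, h⟩ | ⟨r, h1, h⟩ | h⟩
    · refine ⟨by rw [h]; exact mul_ne_zero (ht r) (pow_ne_zero k hq0), 0, k, Or.inl ⟨r, Or.inl ?_⟩⟩
      simp [limParams, h0, h]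
    · have hz : z ≠ 0 := by
        rw [h]
        exact mul_ne_zero (div_ne_zero hq0 (mul_ne_zero hb (ht r))) (pow_ne_zero k hq0)
      refine ⟨hz, 0, k, Or.inl ⟨r, Or.inl ?_⟩⟩
      simp [limParams, h1, h]
    · refine ⟨?_, 0, k, Or.inr (by simp [h])⟩
      rintro rfl
      have : b * q ^ k ≠ 0 := mul_ne_zero hb (pow_ne_zero k hq0)
      exact this (by rw [← h]; simp)

theorem ellCore_zero (hb : b ≠ 0) (z : ℂ) :
    ellCore 0 q b (limParams q τ b t) 0 z = limIntegrand q τ b t z := by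
  have h1 : ∀ r, (qPoch (b * limParams q τ b t r * z) q * qPoch (b * limParams q τ b t r / z) q) /
      (qPoch (limParams q τ b t r * z) q * qPoch (limParams q τ b t r / z) q) =
      (if τ r = 0 then
        qPoch (b * t r * z) q * qPoch (b * t r / z) q / (qPoch (t r * z) q * qPoch (t r / z) q)
      else 1) *
      (if τ r = 1 then
        qPoch (q / t r * z) q * qPoch (q / t r / z) q /
          (qPoch (q / (b * t r) * z) q * qPoch (q / (b * t r) / z) q)
      else 1) := by
    intro r
    by_cases h0 : τ r = 0
    · simp [limParams, h0]
    · by_cases h1 : τ r = 1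
      · have h2 : b * (q / (b * t r)) = q / t r := by rw [mul_div_assoc', mul_div_mul_left _ _ hb]
        simp [limParams, h1, h2]
      · simp [limParams, h0, h1]
  rw [ellCore, limIntegrand, mul_assoc (_ / _), ← Finset.prod_mul_distrib]
  simp only [pqPoch_zero, zero_mul, zero_div, qPoch_zero_left, mul_one, Pi.zero_apply, mul_zero, h1]

theorem corePref_zero (hq : ‖q‖ < 1) (hb : qPoch b q ≠ 0) (hqb : qPoch (q * b) q ≠ 0) :
    corePref 0 q b (limParams q τ b t) 0 = limPrefactor q τ b t := by
  have hsw : ∀ c : Fin 4 → Fin 4 → ℂ, (∀ r, c r r = 1) →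
      ∏ r, ∏ s, c r s = ∏ r, ∏ s, if r < s then c r s * c s r else 1 := by
    intro c hc
    simp only [Fin.prod_univ_four, hc]
    simp
    ring
  have h2 := hsw (fun r s => if τ r = 0 ∧ τ s = 1 then qPoch (q * t r / (b * t s)) q else 1)
    (fun r => if_neg fun h => by rw [h.1] at h; exact zero_ne_one h.2)
  have hpair : (∏ r, ∏ s, if r < s then qPoch (limParams q τ b t r * limParams q τ b t s) q else 1) =
      (∏ r, ∏ s, if r < s ∧ τ r = 0 ∧ τ s = 0 then qPoch (t r * t s) q else 1) *
      (∏ r, ∏ s, if τ r = 0 ∧ τ s = 1 then qPoch (q * t r / (b * t s)) q else 1) *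
      (∏ r, ∏ s, if r < s ∧ τ r = 1 ∧ τ s = 1 then qPoch (q ^ 2 / (b ^ 2 * t r * t s)) q else 1) := by
    rw [h2, ← Finset.prod_mul_distrib, ← Finset.prod_mul_distrib]
    refine Finset.prod_congr rfl fun r _ => ?_
    rw [← Finset.prod_mul_distrib, ← Finset.prod_mul_distrib]
    refine Finset.prod_congr rfl fun s _ => ?_
    have e1 : q / (b * t r) * (q / (b * t s)) = q ^ 2 / (b ^ 2 * t r * t s) := by
      rw [div_mul_div_comm]; ring_nf
    have e2 : t r * (q / (b * t s)) = q * t r / (b * t s) := by ring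
    have e3 : q / (b * t r) * t s = q * t s / (b * t r) := by ring
    by_cases hrs : r < s
    · by_cases r0 : τ r = 0 <;> by_cases r1 : τ r = 1 <;> by_cases s0 : τ s = 0 <;>
        by_cases s1 : τ s = 1 <;> simp [limParams, hrs, r0, r1, s0, s1, e1, e2, e3]
    · simp [hrs]
  -- (b²;q) = (b²;q²)(b²q;q²) and (b²;q²) = (b;q)(-b;q), and likewise for qb².
  have hquot : qPoch (-b) q * qPoch (-(b * q)) q * qPoch (b ^ 2 * q) (q ^ 2) ^ 2 =
      qPoch (b ^ 2) q * qPoch (q * b ^ 2) q / (qPoch b q * qPoch (q * b) q) := by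
    rw [eq_div_iff (mul_ne_zero hb hqb), qPoch_even_odd hq (b ^ 2), qPoch_even_odd hq (q * b ^ 2),
      ← qPoch_mul_neg hq b]
    have e1 : q * b ^ 2 * q = (q * b) ^ 2 := by ring
    rw [e1, ← qPoch_mul_neg hq (q * b), mul_comm b q, mul_comm (b ^ 2) q]
    ring
  rw [corePref, limPrefactor, ← hpair, ← hquot, octetPref]
  simp only [pqPoch_zero, Pi.zero_apply, mul_zero, zero_mul, neg_zero, qPoch_zero_left, mul_one,
    Finset.prod_const_one, ne_eq, OfNat.ofNat_ne_zero, not_false_eq_true, zero_pow, one_pow]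

/-- If b q^j = 1, then √b and its inverse are both poles, because 1/b = b q^{2j}. So a contour
exists only where the denominator of the prefactor is nonzero. -/
theorem qPoch_ne_zero_of_separates (hq : ‖q‖ < 1) (hb : b ≠ 0) {γ : ℝ → ℂ}
    (hγ : Separates γ (limPoles q τ b t)) : qPoch b q ≠ 0 ∧ qPoch (q * b) q ≠ 0 := by
  have key : ∀ j : ℕ, b * q ^ j ≠ 1 := by
    intro j hj
    have hs := csqrt_sq b
    have hs0 : csqrt b ≠ 0 := fun h => hb (by rw [← hs, h]; simp)
    refine hγ.mul_ne_one (a := csqrt b) (b := (csqrt b)⁻¹) ⟨0, Or.inr (Or.inr (by simp [hs]))⟩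
      ⟨2 * j, Or.inr (Or.inr ?_)⟩ (mul_inv_cancel₀ hs0)
    rw [inv_pow, hs]
    refine mul_left_cancel₀ hb ?_
    rw [mul_inv_cancel₀ hb, two_mul, pow_add]
    linear_combination -(b * q ^ j + 1) * hj
  refine ⟨(qPoch_ne_zero_iff hq).2 key, (qPoch_ne_zero_iff hq).2 fun j h => key (j + 1) ?_⟩
  rw [← h]; ring

theorem limValue_eq (hq : ‖q‖ < 1) (hb : b ≠ 0) {γ : ℝ → ℂ}
    (hγ : Separates γ (limPoles q τ b t)) : limValue q τ γ b t =
      corePref 0 q b (limParams q τ b t) 0 * (qPoch 0 0 * qPoch q q / 2) *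
        cInt γ (ellCore 0 q b (limParams q τ b t) 0) := by
  obtain ⟨h1, h2⟩ := qPoch_ne_zero_of_separates hq hb hγ
  have h3 : ellCore 0 q b (limParams q τ b t) 0 = limIntegrand q τ b t :=
    funext fun z => ellCore_zero hb z
  rw [corePref_zero hq h1 h2, h3, qPoch_zero_left, one_mul]
  rfl

end Limit

/-! ### Duplication formula and the elliptic prefactor -/

section Elliptic

variable {p q : ℂ}

/-- The product of `g (c_r c_s)` over `r < s`. -/
noncomputable def pairProd {n : ℕ} (g : ℂ → ℂ) (c : Fin n → ℂ) : ℂ :=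
  ∏ r, ∏ s, if r < s then g (c r * c s) else 1

theorem pairProd_vecCons {n : ℕ} (g : ℂ → ℂ) (a : ℂ) (c : Fin n → ℂ) :
    pairProd g (Matrix.vecCons a c) = (∏ s, g (a * c s)) * pairProd g c := by
  rw [pairProd, Fin.prod_univ_succ]
  simp only [Fin.prod_univ_succ (n := n), Matrix.cons_val_zero, Matrix.cons_val_succ,
    Fin.succ_lt_succ_iff, Fin.succ_pos, Fin.not_lt_zero, if_true, if_false, lt_irrefl, one_mul, pairProd]

theorem pairProd_zero (g : ℂ → ℂ) (c : Fin 0 → ℂ) : pairProd g c = 1 := by simp [pairProd]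

theorem prod_vecCons_apply {n : ℕ} (g : ℂ → ℂ) (a : ℂ) (c : Fin n → ℂ) :
    ∏ s, g (Matrix.vecCons a c s) = g a * ∏ s, g (c s) := by
  rw [Fin.prod_univ_succ]
  simp only [Matrix.cons_val_zero, Matrix.cons_val_succ]

/-- The parameters `±√b, ±√(bq), ±√(bp), ±√(bpq)`. -/
noncomputable def octet (p q b : ℂ) : Fin 8 → ℂ :=
  ![csqrt b, -csqrt b, csqrt (b * q), -csqrt (b * q),
    csqrt (b * p), -csqrt (b * p), csqrt (b * p * q), -csqrt (b * p * q)]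

theorem ellParams_eq (b : ℂ) (t : Fin 4 → ℂ) (p q : ℂ) : ellParams b t p q =
    Matrix.vecCons (t 0) (Matrix.vecCons (p * q / (b * t 0)) (Matrix.vecCons (t 1)
    (Matrix.vecCons (p * q / (b * t 1)) (Matrix.vecCons (t 2) (Matrix.vecCons (p * q / (b * t 2))
    (Matrix.vecCons (t 3) (Matrix.vecCons (p * q / (b * t 3)) (octet p q b)))))))) := rfl

theorem prod_octet (g : ℂ → ℂ) (b : ℂ) : ∏ s, g (octet p q b s) =
    g (csqrt b) * g (-csqrt b) * (g (csqrt (b * q)) * g (-csqrt (b * q))) *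
      (g (csqrt (b * p)) * g (-csqrt (b * p)) * (g (csqrt (b * p * q)) * g (-csqrt (b * p * q)))) := by
  simp only [octet, prod_vecCons_apply, Fin.prod_univ_zero]
  ring

theorem pqPoch_mul_mul_neg (hp : ‖p‖ < 1) (hq : ‖q‖ < 1) (a x : ℂ) :
    pqPoch (a * x) p q * pqPoch (a * -x) p q = pqPoch (a ^ 2 * x ^ 2) (p ^ 2) (q ^ 2) := by
  rw [mul_neg, pqPoch_mul_neg hp hq, mul_pow]

/-- Opposite signs combine to base (p²,q²), and the four resulting products are the parity classes
of (ba²;p,q). -/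
theorem prod_pqPoch_mul_octet (hp : ‖p‖ < 1) (hq : ‖q‖ < 1) (a b : ℂ) :
    ∏ s, pqPoch (a * octet p q b s) p q = pqPoch (b * a ^ 2) p q := by
  rw [prod_octet fun x => pqPoch (a * x) p q]
  simp only [pqPoch_mul_mul_neg hp hq, csqrt_sq]
  rw [pqPoch_even_odd hp hq (b * a ^ 2)]
  congr 1 <;> congr 1 <;> congr 1 <;> ring

theorem prod_pqPoch_div_octet (hp : ‖p‖ < 1) (hq : ‖q‖ < 1) (hp0 : p ≠ 0) (hq0 : q ≠ 0) (x : ℂ) {b : ℂ}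
    (hb : b ≠ 0) :
    ∏ s, pqPoch (x / octet p q b s) p q = pqPoch (x ^ 2 / (b * p * q)) p q := by
  rw [prod_octet fun y => pqPoch (x / y) p q]
  have h1 : ∀ y, pqPoch (x / y) p q * pqPoch (x / -y) p q = pqPoch (x ^ 2 / y ^ 2) (p ^ 2) (q ^ 2) := by
    intro y
    rw [div_neg, pqPoch_mul_neg hp hq, div_pow]
  simp only [h1, csqrt_sq]
  have e1 : x ^ 2 / b = x ^ 2 / (b * p * q) * p * q := by field_simp
  have e2 : x ^ 2 / (b * q) = x ^ 2 / (b * p * q) * p := by field_simp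
  have e3 : x ^ 2 / (b * p) = x ^ 2 / (b * p * q) * q := by field_simp
  rw [e1, e2, e3, pqPoch_even_odd hp hq (x ^ 2 / (b * p * q))]
  ring

theorem pairProd_octet (hp : ‖p‖ < 1) (hq : ‖q‖ < 1) (b : ℂ) :
    pairProd (fun x => pqPoch x p q) (octet p q b) = octetPref p q b := by
  have h : ∀ (g : ℂ → ℂ) (a c d e : ℂ), pairProd g ![a, -a, c, -c, d, -d, e, -e] =
      (g (a * -a) * g (c * -c) * (g (d * -d) * g (e * -e))) *
      ((g (a * c) * g (a * -c)) * (g (-a * c) * g (-a * -c)) *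
      ((g (a * d) * g (a * -d)) * (g (-a * d) * g (-a * -d))) *
      ((g (a * e) * g (a * -e)) * (g (-a * e) * g (-a * -e))) *
      ((g (c * d) * g (c * -d)) * (g (-c * d) * g (-c * -d))) *
      ((g (c * e) * g (c * -e)) * (g (-c * e) * g (-c * -e))) *
      ((g (d * e) * g (d * -e)) * (g (-d * e) * g (-d * -e)))) := by
    intro g a c d e
    have h1 : ∀ {n : ℕ} (x a : ℂ) (c : Fin n → ℂ), ∏ s, g (x * Matrix.vecCons a c s) =
        g (x * a) * ∏ s, g (x * c s) := fun x a c => prod_vecCons_apply (fun y => g (x * y)) a c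
    simp only [pairProd_vecCons, pairProd_zero, h1, Fin.prod_univ_zero]
    ring
  have hneg : ∀ x : ℂ, x * -x = -(x ^ 2) := fun x => by ring
  rw [octet, h]
  simp only [pqPoch_mul_mul_neg hp hq, hneg, csqrt_sq, neg_sq]
  rw [octetPref]
  have e1 : b * (b * q) = b ^ 2 * q := by ring
  have e2 : b * (b * p) = b ^ 2 * p := by ring
  have e3 : b * (b * p * q) = b ^ 2 * p * q := by ring
  have e4 : b * q * (b * p) = b ^ 2 * p * q := by ring
  have e5 : b * q * (b * p * q) = b ^ 2 * p * q ^ 2 := by ring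
  have e6 : b * p * (b * p * q) = b ^ 2 * p ^ 2 * q := by ring
  rw [e1, e2, e3, e4, e5, e6]
  ring

theorem ellDenom_eq {b : ℂ} {t : Fin 4 → ℂ} (hb : b ≠ 0) :
    ellDenom b t p q = ∏ r, pqPoch (b * t r ^ 2) p q * pqPoch (b * (p * q / (b * t r)) ^ 2) p q := by
  refine Finset.prod_congr rfl fun r _ => ?_
  have h : p ^ 2 * q ^ 2 / (b * t r ^ 2) = b * (p * q / (b * t r)) ^ 2 := by
    rw [div_pow, mul_pow, mul_pow, pow_two b, mul_assoc b b, mul_div_assoc', mul_div_mul_left _ _ hb]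
  rw [h]

/-- The pairs of one t_r or pq/(b t_r) with the eight square roots give exactly `ellDenom`, by
duplication. This is why E is normalized by that denominator. -/
theorem pairProd_ellParams (hp : ‖p‖ < 1) (hq : ‖q‖ < 1) {b : ℂ} {t : Fin 4 → ℂ} (hb : b ≠ 0) :
    (∏ r, ∏ s, if r < s then pqPoch (ellParams b t p q r * ellParams b t p q s) p q else 1) =
      corePref p q b t (fun r => p * q / (b * t r)) * ellDenom b t p q := by
  have h1 : ∀ {n : ℕ} (x a : ℂ) (c : Fin n → ℂ), ∏ s, pqPoch (x * Matrix.vecCons a c s) p q =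
      pqPoch (x * a) p q * ∏ s, pqPoch (x * c s) p q := fun x a c =>
    prod_vecCons_apply (fun y => pqPoch (x * y) p q) a c
  change pairProd (fun x => pqPoch x p q) (ellParams b t p q) = _
  rw [ellParams_eq, ellDenom_eq hb, corePref, ← pairProd_octet hp hq]
  set v : Fin 4 → ℂ := fun r => p * q / (b * t r) with hv
  simp only [pairProd_vecCons, h1, prod_pqPoch_mul_octet hp hq]
  simp only [Fin.prod_univ_four]
  have e0 : p * q / (b * t 0) = v 0 := rfl
  have e1 : p * q / (b * t 1) = v 1 := rfl
  have e2 : p * q / (b * t 2) = v 2 := rfl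
  have e3 : p * q / (b * t 3) = v 3 := rfl
  simp only [e0, e1, e2, e3]
  simp
  ring

end Elliptic

/-! ### Poles and integrand in terms of b, u and v -/

section Elliptic

variable {p q b : ℂ} {t : Fin 4 → ℂ}

theorem prod_ellParams (hb : b ≠ 0) (ht : ∀ r, t r ≠ 0) :
    ∏ r, ellParams b t p q r = (p * q) ^ (5 + 1) := by
  have h : ∀ {n : ℕ} (a : ℂ) (c : Fin n → ℂ), ∏ s, Matrix.vecCons a c s = a * ∏ s, c s :=
    fun a c => prod_vecCons_apply (fun x => x) a c
  rw [ellParams_eq]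
  simp only [h]
  rw [prod_octet fun x => x]
  have h2 : ∀ x : ℂ, csqrt x * -csqrt x = -x := fun x => by
    rw [mul_neg, ← pow_two, csqrt_sq]
  simp only [h2]
  have := ht 0
  have := ht 1
  have := ht 2
  have := ht 3
  field_simp
  ring

theorem ellPoles_ellParams (hp0 : p ≠ 0) (hq0 : q ≠ 0) (hb : b ≠ 0) (ht : ∀ r, t r ≠ 0) :
    ellPoles p q (ellParams b t p q) = corePoles p q b t fun r => p * q / (b * t r) := by
  ext z
  have hw : ∀ {c : ℂ} (i k : ℕ), c ≠ 0 → c * p ^ i * q ^ k ≠ 0 := fun i k hc =>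
    mul_ne_zero (mul_ne_zero hc (pow_ne_zero i hp0)) (pow_ne_zero k hq0)
  constructor
  · rintro ⟨r, i, k, hz⟩
    have hu : ∀ r, z = t r * p ^ i * q ^ k → z ∈ corePoles p q b t fun r => p * q / (b * t r) :=
      fun r h => ⟨by rw [h]; exact hw i k (ht r), i, k, Or.inl ⟨r, Or.inl h⟩⟩
    have hv : ∀ r, z = p * q / (b * t r) * p ^ i * q ^ k →
        z ∈ corePoles p q b t fun r => p * q / (b * t r) :=
      fun r h => ⟨by
        rw [h]
        exact hw i k (div_ne_zero (mul_ne_zero hp0 hq0) (mul_ne_zero hb (ht r))),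
        i, k, Or.inl ⟨r, Or.inr h⟩⟩
    have hs : ∀ m n : ℕ, z ^ 2 = b * p ^ m * q ^ n → z ∈ corePoles p q b t fun r => p * q / (b * t r) :=
      fun m n h => ⟨by
        rintro rfl
        exact hw m n hb (by rw [← h]; simp), m, n, Or.inr h⟩
    have hs' : ∀ (c : ℂ) (m n : ℕ), (z = csqrt c * p ^ i * q ^ k ∨ z = -csqrt c * p ^ i * q ^ k) →
        c = b * p ^ m * q ^ n → z ∈ corePoles p q b t fun r => p * q / (b * t r) := by
      intro c m n h hc
      refine hs (2 * i + m) (2 * k + n) ?_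
      have h2 : z ^ 2 = csqrt c ^ 2 * p ^ (2 * i) * q ^ (2 * k) := by
        rcases h with rfl | rfl <;> ring
      rw [h2, csqrt_sq, hc]
      ring
    fin_cases r
    · exact hu 0 hz
    · exact hv 0 hz
    · exact hu 1 hz
    · exact hv 1 hz
    · exact hu 2 hz
    · exact hv 2 hz
    · exact hu 3 hz
    · exact hv 3 hz
    · exact hs' _ 0 0 (Or.inl hz) (by ring)
    · exact hs' _ 0 0 (Or.inr hz) (by ring)
    · exact hs' _ 0 1 (Or.inl hz) (by ring)
    · exact hs' _ 0 1 (Or.inr hz) (by ring)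
    · exact hs' _ 1 0 (Or.inl hz) (by ring)
    · exact hs' _ 1 0 (Or.inr hz) (by ring)
    · exact hs' _ 1 1 (Or.inl hz) (by ring)
    · exact hs' _ 1 1 (Or.inr hz) (by ring)
  · rintro ⟨-, i, k, ⟨r, h | h⟩ | h⟩
    · fin_cases r
      · exact ⟨0, i, k, h⟩
      · exact ⟨2, i, k, h⟩
      · exact ⟨4, i, k, h⟩
      · exact ⟨6, i, k, h⟩
    · fin_cases r
      · exact ⟨1, i, k, h⟩
      · exact ⟨3, i, k, h⟩
      · exact ⟨5, i, k, h⟩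
      · exact ⟨7, i, k, h⟩
    · have key : ∀ (c : ℂ) (m n : ℕ), z ^ 2 = c * p ^ (2 * m) * q ^ (2 * n) →
          z = csqrt c * p ^ m * q ^ n ∨ z = -csqrt c * p ^ m * q ^ n := by
        intro c m n h
        rw [neg_mul, neg_mul]
        refine sq_eq_sq_iff_eq_or_eq_neg.1 ?_
        rw [h, mul_pow, mul_pow, csqrt_sq]
        ring
      rcases Nat.even_or_odd' i with ⟨m, rfl | rfl⟩ <;> rcases Nat.even_or_odd' k with ⟨n, rfl | rfl⟩
      · rcases key b m n h with h | h
        · exact ⟨8, m, n, h⟩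
        · exact ⟨9, m, n, h⟩
      · rcases key (b * q) m n (by rw [h]; ring) with h | h
        · exact ⟨10, m, n, h⟩
        · exact ⟨11, m, n, h⟩
      · rcases key (b * p) m n (by rw [h]; ring) with h | h
        · exact ⟨12, m, n, h⟩
        · exact ⟨13, m, n, h⟩
      · rcases key (b * p * q) m n (by rw [h]; ring) with h | h
        · exact ⟨14, m, n, h⟩
        · exact ⟨15, m, n, h⟩

theorem prod_ellGamma_octet (hp : ‖p‖ < 1) (hq : ‖q‖ < 1) (hp0 : p ≠ 0) (hq0 : q ≠ 0) (hb : b ≠ 0)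
    {z : ℂ} (hz : z ≠ 0) :
    ∏ s, ellGamma (octet p q b s * z) p q * ellGamma (octet p q b s / z) p q =
      (pqPoch (p * q / (b * z ^ 2)) p q * pqPoch (p * q * z ^ 2 / b) p q) /
        (pqPoch (b * z ^ 2) p q * pqPoch (b / z ^ 2) p q) := by
  have h1 : ∀ s, ellGamma (octet p q b s * z) p q * ellGamma (octet p q b s / z) p q =
      (pqPoch (p * q / z / octet p q b s) p q * pqPoch (p * q * z / octet p q b s) p q) /
        (pqPoch (z * octet p q b s) p q * pqPoch (z⁻¹ * octet p q b s) p q) := by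
    intro s
    have e1 : p * q / (octet p q b s * z) = p * q / z / octet p q b s := by
      rw [div_div, mul_comm z]
    have e2 : p * q / (octet p q b s / z) = p * q * z / octet p q b s := by rw [div_div_eq_mul_div]
    rw [ellGamma, ellGamma, e1, e2, mul_comm (octet p q b s) z, div_mul_div_comm,
      div_eq_inv_mul (octet p q b s) z]
  simp only [h1]
  rw [Finset.prod_div_distrib, Finset.prod_mul_distrib, Finset.prod_mul_distrib,
    prod_pqPoch_mul_octet hp hq, prod_pqPoch_mul_octet hp hq, prod_pqPoch_div_octet hp hq hp0 hq0 _ hb,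
    prod_pqPoch_div_octet hp hq hp0 hq0 _ hb]
  have e3 : (p * q / z) ^ 2 / (b * p * q) = p * q / (b * z ^ 2) := by field_simp
  have e4 : (p * q * z) ^ 2 / (b * p * q) = p * q * z ^ 2 / b := by field_simp
  rw [e3, e4, inv_pow, div_eq_mul_inv b (z ^ 2)]

/-- As bcd = pq, the numerator pq/(cz) of one gamma factor is bd/z, and symmetrically. This makes
the integrand polynomial-like in b, c, d with p and q only as bases. -/
theorem ellGamma_pair (hb : b ≠ 0) (hp0 : p ≠ 0) (hq0 : q ≠ 0) {c d z : ℂ} (hc : c ≠ 0)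
    (hd : d = p * q / (b * c)) :
    ellGamma (c * z) p q * ellGamma (c / z) p q * (ellGamma (d * z) p q * ellGamma (d / z) p q) =
      (pqPoch (b * c * z) p q * pqPoch (b * c / z) p q *
        (pqPoch (b * d * z) p q * pqPoch (b * d / z) p q)) /
      (pqPoch (c * z) p q * pqPoch (c / z) p q * (pqPoch (d * z) p q * pqPoch (d / z) p q)) := by
  have hdc : p * q = b * c * d := by rw [hd]; field_simp
  have hd0 : d ≠ 0 := by
    rintro rfl
    rw [mul_zero] at hdc
    exact mul_ne_zero hp0 hq0 hdc
  have e1 : p * q / (c * z) = b * d / z := by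
    rw [hdc, mul_right_comm, mul_comm c z, mul_div_mul_right _ _ hc]
  have e2 : p * q / (c / z) = b * d * z := by rw [hdc, div_div_eq_mul_div]; field_simp
  have e3 : p * q / (d * z) = b * c / z := by rw [hdc, mul_comm d z, mul_div_mul_right _ _ hd0]
  have e4 : p * q / (d / z) = b * c * z := by rw [hdc, div_div_eq_mul_div]; field_simp
  simp only [ellGamma, e1, e2, e3, e4]
  ring

/-- The conditions on z exclude the points where the factors common to numerator and denominator of
1/Γ(z^{±2}) vanish and the cancellation would read 0/0. -/
theorem ellIntegrand_eq (hp : ‖p‖ < 1) (hq : ‖q‖ < 1) (hp0 : p ≠ 0) (hq0 : q ≠ 0) (hb : b ≠ 0)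
    (ht : ∀ r, t r ≠ 0) {z : ℂ} (hz : z ≠ 0) (h1 : pqPoch (p * q / z ^ 2) p q ≠ 0)
    (h2 : pqPoch (p * q * z ^ 2) p q ≠ 0) :
    (∏ r, ellGamma (ellParams b t p q r * z) p q * ellGamma (ellParams b t p q r / z) p q) /
        (ellGamma (z ^ 2) p q * ellGamma (1 / z ^ 2) p q) =
      ellCore p q b t (fun r => p * q / (b * t r)) z := by
  have h3 := prod_ellGamma_octet hp hq hp0 hq0 hb hz
  rw [ellParams_eq]
  simp only [fun (n : ℕ) => prod_vecCons_apply (n := n)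
    (fun x => ellGamma (x * z) p q * ellGamma (x / z) p q)]
  rw [h3, ellCore, Fin.prod_univ_four, ← ellGamma_pair hb hp0 hq0 (ht 0) rfl,
    ← ellGamma_pair hb hp0 hq0 (ht 1) rfl, ← ellGamma_pair hb hp0 hq0 (ht 2) rfl,
    ← ellGamma_pair hb hp0 hq0 (ht 3) rfl]
  have e1 : p * q / (1 / z ^ 2) = p * q * z ^ 2 := by rw [div_div_eq_mul_div, div_one]
  have h4 : (ellGamma (z ^ 2) p q * ellGamma (1 / z ^ 2) p q)⁻¹ =
      (qPoch (z ^ 2) q * qPoch (1 / z ^ 2) q) * (qPoch (p * z ^ 2) p * qPoch (p / z ^ 2) p) := by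
    have f1 : pqPoch (z ^ 2) p q =
        qPoch (z ^ 2) q * qPoch (p * z ^ 2) p * pqPoch (p * q * z ^ 2) p q := by
      rw [pqPoch_eq_mul_mul hp hq, mul_comm (z ^ 2) p, mul_right_comm p]
    have f2 : pqPoch (1 / z ^ 2) p q =
        qPoch (1 / z ^ 2) q * qPoch (p / z ^ 2) p * pqPoch (p * q / z ^ 2) p q := by
      rw [pqPoch_eq_mul_mul hp hq, one_div_mul_eq_div, div_mul_eq_mul_div]
    rw [ellGamma, ellGamma, e1, mul_inv, inv_div, inv_div, f1, f2, div_mul_div_comm,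
      div_eq_iff (mul_ne_zero h1 h2)]
    ring
  rw [div_eq_mul_inv, h4]
  ring

end Elliptic

/-! ### Reduction of E to the core integral, and its symmetry -/

section Elliptic

variable {p q b : ℂ} {t u v : Fin 4 → ℂ}

theorem countable_pqPoch_eq_zero (hp : ‖p‖ < 1) (hq : ‖q‖ < 1) :
    {z : ℂ | z ≠ 0 ∧ (pqPoch (p * q / z ^ 2) p q = 0 ∨ pqPoch (p * q * z ^ 2) p q = 0)}.Countable := by
  have hc : (⋃ (i : ℕ) (k : ℕ), ({z : ℂ | z ^ 2 = p * q * p ^ i * q ^ k} ∪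
      {z : ℂ | z ^ 2 * (p * q * p ^ i * q ^ k) = 1})).Countable :=
    countable_iUnion fun i => countable_iUnion fun k =>
      ((finite_sq_eq _).union (finite_sq_mul_eq_one _)).countable
  refine hc.mono ?_
  rintro z ⟨hz, h | h⟩
  · have h1 : ¬ ∀ i j : ℕ, p * q / z ^ 2 * p ^ i * q ^ j ≠ 1 := fun h' =>
      (pqPoch_ne_zero_iff hp hq).2 h' h
    push Not at h1
    obtain ⟨i, k, h1⟩ := h1
    refine mem_iUnion.2 ⟨i, mem_iUnion.2 ⟨k, Or.inl ?_⟩⟩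
    change z ^ 2 = _
    field_simp at h1
    rw [← h1]
  · have h1 : ¬ ∀ i j : ℕ, p * q * z ^ 2 * p ^ i * q ^ j ≠ 1 := fun h' =>
      (pqPoch_ne_zero_iff hp hq).2 h' h
    push Not at h1
    obtain ⟨i, k, h1⟩ := h1
    refine mem_iUnion.2 ⟨i, mem_iUnion.2 ⟨k, Or.inr ?_⟩⟩
    change z ^ 2 * _ = 1
    rw [← h1]
    ring

/-- If (bc²;p,q) = 0 for c = t_r or c = pq/(b t_r), then 1/c is a pole as well as c. So a separating
contour excludes zeros of the denominator. -/
theorem ellDenom_ne_zero (hp : ‖p‖ < 1) (hq : ‖q‖ < 1) (hp0 : p ≠ 0) (hq0 : q ≠ 0) (hb : b ≠ 0)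
    (ht : ∀ r, t r ≠ 0) {γ : ℝ → ℂ}
    (hγ : Separates γ (corePoles p q b t fun r => p * q / (b * t r))) : ellDenom b t p q ≠ 0 := by
  have key : ∀ c : ℂ, c ≠ 0 → (∃ r, c = t r ∨ c = p * q / (b * t r)) →
      pqPoch (b * c ^ 2) p q ≠ 0 := by
    rintro c hc ⟨r, hr⟩
    rw [pqPoch_ne_zero_iff hp hq]
    intro i k h
    have hc1 : c ∈ corePoles p q b t fun r => p * q / (b * t r) := by
      refine ⟨hc, 0, 0, Or.inl ⟨r, ?_⟩⟩
      simpa only [pow_zero, mul_one] using hr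
    have hc2 : c⁻¹ ∈ corePoles p q b t fun r => p * q / (b * t r) := by
      refine ⟨inv_ne_zero hc, i, k, Or.inr ?_⟩
      rw [inv_pow, eq_comm]
      refine eq_inv_of_mul_eq_one_left ?_
      rw [← h]
      ring
    exact hγ.mul_ne_one hc1 hc2 (mul_inv_cancel₀ hc)
  rw [ellDenom_eq hb]
  refine Finset.prod_ne_zero_iff.2 fun r _ => mul_ne_zero (key _ (ht r) ⟨r, Or.inl rfl⟩)
    (key _ (div_ne_zero (mul_ne_zero hp0 hq0) (mul_ne_zero hb (ht r))) ⟨r, Or.inr rfl⟩)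

theorem ellParams_mem_ellGeneric (hp0 : p ≠ 0) (hq0 : q ≠ 0) (hb : b ≠ 0) (ht : ∀ r, t r ≠ 0) :
    ellParams b t p q ∈ ellGeneric 5 p q ↔
      ∃ γ, Separates γ (corePoles p q b t fun r => p * q / (b * t r)) := by
  rw [ellGeneric, mem_ofPred_eq, ellPoles_ellParams hp0 hq0 hb ht]
  exact ⟨fun h => h.2, fun h => ⟨prod_ellParams hb ht, h⟩⟩

theorem ellBeta_div_ellDenom (hp : ‖p‖ < 1) (hq : ‖q‖ < 1) (hp0 : p ≠ 0) (hq0 : q ≠ 0) (hb : b ≠ 0)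
    (ht : ∀ r, t r ≠ 0) {γ : ℝ → ℂ}
    (hγ : Separates γ (corePoles p q b t fun r => p * q / (b * t r))) :
    ellBeta 5 p q (ellParams b t p q) / ellDenom b t p q =
      corePref p q b t (fun r => p * q / (b * t r)) * (qPoch p p * qPoch q q / 2) *
        cInt γ (ellCore p q b t fun r => p * q / (b * t r)) := by
  have hd := ellDenom_ne_zero hp hq hp0 hq0 hb ht hγ
  have hgen := (ellParams_mem_ellGeneric hp0 hq0 hb ht).2 ⟨γ, hγ⟩
  have h : ∃ γ, Separates γ (ellPoles p q (ellParams b t p q)) := hgen.2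
  have hch : Separates h.choose (corePoles p q b t fun r => p * q / (b * t r)) := by
    rw [← ellPoles_ellParams hp0 hq0 hb ht]
    exact h.choose_spec
  have hint : sepIntegral (ellPoles p q (ellParams b t p q)) (fun z =>
      (∏ r, ellGamma (ellParams b t p q r * z) p q * ellGamma (ellParams b t p q r / z) p q) /
        (ellGamma (z ^ 2) p q * ellGamma (1 / z ^ 2) p q)) =
      cInt γ (ellCore p q b t fun r => p * q / (b * t r)) := by
    rw [sepIntegral, dif_pos h, ← cInt_ellCore_eq hp hq hch hγ]
    refine loopIntegral_congr_off_countable (countable_pqPoch_eq_zero hp hq) fun x hx hxB => ?_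
    have hz : h.choose x ≠ 0 := (hch.2.1 0 (Or.inl rfl)).1 x hx
    have hB : ¬ (pqPoch (p * q / h.choose x ^ 2) p q = 0 ∨ pqPoch (p * q * h.choose x ^ 2) p q = 0) :=
      fun h' => hxB ⟨hz, h'⟩
    push Not at hB
    rw [ellIntegrand_eq hp hq hp0 hq0 hb ht hz hB.1 hB.2]
  rw [ellBeta, continued, if_pos hgen, ellBetaIntegral, hint, pairProd_ellParams hp hq hb]
  field_simp

/-- The exchange of `v r` for `u r` at the places in `I`. -/
noncomputable def exchange (I : Finset (Fin 4)) (u v : Fin 4 → ℂ) (r : Fin 4) : ℂ :=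
  if r ∈ I then v r else u r

variable (I : Finset (Fin 4))

/-- Only the unordered pairs {u_r, v_r} matter. The exchange at indices with τ_r = 1 makes all v_r
tend to 0 in the limit. -/
theorem ellCore_exchange :
    ellCore p q b (exchange I u v) (exchange I v u) = ellCore p q b u v := by
  funext z
  unfold ellCore
  congr 1
  refine Finset.prod_congr rfl fun r _ => ?_
  by_cases hr : r ∈ I
  · simp only [exchange, if_pos hr]
    ring
  · simp only [exchange, if_neg hr]

theorem corePoles_exchange :
    corePoles p q b (exchange I u v) (exchange I v u) = corePoles p q b u v := by
  unfold corePoles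
  ext z
  refine and_congr_right fun _ => exists_congr fun i => exists_congr fun k =>
    or_congr_left (exists_congr fun r => ?_)
  by_cases hr : r ∈ I
  · simp only [exchange, if_pos hr]
    exact or_comm
  · simp only [exchange, if_neg hr]

theorem corePref_exchange :
    corePref p q b (exchange I u v) (exchange I v u) = corePref p q b u v := by
  unfold corePref
  congr 1
  congr 1
  · refine Finset.prod_congr rfl fun r _ => Finset.prod_congr rfl fun s _ => ?_
    congr 1
    by_cases hr : r ∈ I <;> by_cases hs : s ∈ I <;>
      simp only [exchange, if_pos, if_neg, hr, hs, not_false_eq_true] <;> ring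
  · refine Finset.prod_congr rfl fun r _ => ?_
    by_cases hr : r ∈ I
    · simp only [exchange, if_pos hr, mul_comm]
    · simp only [exchange, if_neg hr]

end Elliptic

/-! ### Density of the unpinched parameters -/

section Density

variable {p q b : ℂ} {τ : Fin 4 → ℝ} {t u v : Fin 4 → ℂ}

/-- Along the curve (e^{2x} b, e^x t) the poles from t_r and √b grow like e^x, those from c/(b t_r)
like e^{-3x}. Two such exponents never add to 0, so each pair of poles has product 1 for at most one
x. -/
theorem countable_exists_mul_eq_one {Λ : Set (ℝ × ℝ)} (hΛ : Λ.Countable)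
    (hw : ∀ a ∈ Λ, a.1 = 1 ∨ a.1 = -3) {P : ℝ → Set ℂ} (h0 : ∀ x, ∀ z ∈ P x, z ≠ 0)
    (hP : ∀ x, ∀ z ∈ P x, ∃ a ∈ Λ, Real.log ‖z‖ = a.1 * x + a.2) :
    {x | ∃ z ∈ P x, ∃ w ∈ P x, z * w = 1}.Countable := by
  have hc : (⋃ a ∈ Λ, ⋃ a' ∈ Λ, {x : ℝ | a.1 * x + a.2 + (a'.1 * x + a'.2) = 0}).Countable := by
    refine hΛ.biUnion fun a ha => hΛ.biUnion fun a' ha' => Set.Subsingleton.countable ?_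
    intro x hx y hy
    have hne : a.1 + a'.1 ≠ 0 := by
      rcases hw a ha with h | h <;> rcases hw a' ha' with h' | h' <;> rw [h, h'] <;> norm_num
    have hx' : a.1 * x + a.2 + (a'.1 * x + a'.2) = 0 := hx
    have hy' : a.1 * y + a.2 + (a'.1 * y + a'.2) = 0 := hy
    exact mul_left_cancel₀ hne (by linarith)
  refine hc.mono ?_
  rintro x ⟨z, hz, w, hw', hzw⟩
  obtain ⟨a, ha, hza⟩ := hP x z hz
  obtain ⟨a', ha', hwa⟩ := hP x w hw'
  simp only [mem_iUnion]
  refine ⟨a, ha, a', ha', ?_⟩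
  change _ = (0 : ℝ)
  rw [← hza, ← hwa, ← Real.log_mul (norm_ne_zero_iff.2 (h0 x z hz)) (norm_ne_zero_iff.2 (h0 x w hw')),
    ← norm_mul, hzw, norm_one, Real.log_one]

theorem countable_corePoles_mul_eq_one {B : ℝ → ℂ} {U V : ℝ → Fin 4 → ℂ} {e f : Fin 4 → ℝ}
    (he : ∀ r, e r = 1 ∨ e r = -3) (hf : ∀ r, f r = 1 ∨ f r = -3)
    (hB : ∀ x, ‖B x‖ = Real.exp (2 * x) * ‖b‖) (hU : ∀ x r, ‖U x r‖ = Real.exp (e r * x) * ‖u r‖)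
    (hV : ∀ x r, ‖V x r‖ = Real.exp (f r * x) * ‖v r‖) :
    {x | ∃ z ∈ corePoles p q (B x) (U x) (V x), ∃ w ∈ corePoles p q (B x) (U x) (V x),
      z * w = 1}.Countable := by
  set Λ : Set (ℝ × ℝ) :=
    (range fun i : Fin 4 × ℕ × ℕ => (e i.1, Real.log (‖u i.1‖ * ‖p ^ i.2.1 * q ^ i.2.2‖))) ∪
    (range fun i : Fin 4 × ℕ × ℕ => (f i.1, Real.log (‖v i.1‖ * ‖p ^ i.2.1 * q ^ i.2.2‖))) ∪
    (range fun i : ℕ × ℕ => ((1 : ℝ), Real.log (‖b‖ * ‖p ^ i.1 * q ^ i.2‖) / 2)) with hΛ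
  have hlog : ∀ {z : ℂ} {c d x m : ℝ}, z ≠ 0 → ‖z‖ = Real.exp (m * x) * c * d →
      Real.log ‖z‖ = m * x + Real.log (c * d) := by
    intro z c d x m hz h
    have hcd : c * d ≠ 0 := by
      intro h'
      rw [mul_assoc, h', mul_zero] at h
      exact hz (norm_eq_zero.1 h)
    rw [h, mul_assoc, Real.log_mul (Real.exp_pos _).ne' hcd, Real.log_exp]
  refine countable_exists_mul_eq_one (Λ := Λ)
    (((countable_range _).union (countable_range _)).union (countable_range _)) ?_
    (fun x z hz => hz.1) ?_
  · rintro a ((⟨i, rfl⟩ | ⟨i, rfl⟩) | ⟨i, rfl⟩)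
    · exact he _
    · exact hf _
    · exact Or.inl rfl
  · rintro x z ⟨hz, i, k, ⟨r, h | h⟩ | h⟩
    · exact ⟨_, Or.inl (Or.inl ⟨(r, i, k), rfl⟩), hlog hz (by rw [h, mul_assoc, norm_mul, hU])⟩
    · exact ⟨_, Or.inl (Or.inr ⟨(r, i, k), rfl⟩), hlog hz (by rw [h, mul_assoc, norm_mul, hV])⟩
    · refine ⟨_, Or.inr ⟨(i, k), rfl⟩, ?_⟩
      have h2 := hlog (pow_ne_zero 2 hz) (by rw [h, mul_assoc, norm_mul, hB])
      rw [norm_pow, Real.log_pow] at h2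
      push_cast at h2
      change Real.log ‖z‖ = 1 * x + Real.log (‖b‖ * ‖p ^ i * q ^ k‖) / 2
      linarith

/-- The curve `x ↦ (e^{2x} b, e^x t)` of parameters. -/
noncomputable def scaled (b : ℂ) (t : Fin 4 → ℂ) (x : ℝ) : ℂ × (Fin 4 → ℂ) :=
  (Complex.exp (2 * x) * b, fun r => Complex.exp x * t r)

theorem norm_cexp_mul_ofReal (m x : ℝ) (c : ℂ) : ‖Complex.exp (m * x) * c‖ = Real.exp (m * x) * ‖c‖ := by
  rw [norm_mul, ← Complex.ofReal_mul, Complex.norm_exp_ofReal]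

theorem norm_scaled_fst (x : ℝ) : ‖(scaled b t x).1‖ = Real.exp (2 * x) * ‖b‖ := by
  have := norm_cexp_mul_ofReal 2 x b
  push_cast at this
  exact this

theorem norm_scaled_snd (x : ℝ) (r : Fin 4) : ‖(scaled b t x).2 r‖ = Real.exp (1 * x) * ‖t r‖ := by
  have := norm_cexp_mul_ofReal 1 x (t r)
  push_cast at this
  rw [one_mul] at this
  exact this

theorem norm_div_scaled (c : ℂ) (x : ℝ) (r : Fin 4) :
    ‖c / ((scaled b t x).1 * (scaled b t x).2 r)‖ = Real.exp (-3 * x) * ‖c / (b * t r)‖ := by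
  rw [norm_div, norm_div, norm_mul, norm_mul, norm_scaled_fst, norm_scaled_snd]
  have h : Real.exp (-3 * x) = (Real.exp (2 * x) * Real.exp (1 * x))⁻¹ := by
    rw [← Real.exp_add, ← Real.exp_neg]
    ring_nf
  rw [h]
  ring

theorem scaled_mem_paramDomain (hb : b ≠ 0) (ht : ∀ r, t r ≠ 0) (x : ℝ) :
    scaled b t x ∈ paramDomain :=
  ⟨mul_ne_zero (Complex.exp_ne_zero _) hb, fun r => mul_ne_zero (Complex.exp_ne_zero _) (ht r)⟩

theorem mem_closure_of_scaled {S : Set (ℂ × (Fin 4 → ℂ))} {Z : Set ℝ} (hZ : Z.Countable)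
    (h : ∀ x, x ∉ Z → scaled b t x ∈ S) : (b, t) ∈ closure S := by
  have h0 : scaled b t 0 = (b, t) := by simp [scaled]
  have hcont : Continuous (scaled b t) := by unfold scaled; fun_prop
  have h1 : scaled b t 0 ∈ closure (scaled b t '' Zᶜ) :=
    image_closure_subset_closure_image hcont ⟨0, hZ.dense_compl ℝ 0, rfl⟩
  rw [h0] at h1
  refine closure_mono ?_ h1
  rintro _ ⟨x, hx, rfl⟩
  exact h x hx

theorem exists_separates_of_mul_ne_one (hp : ‖p‖ < 1) (hq : ‖q‖ < 1)
    (hne : ∀ a ∈ corePoles p q b u v, ∀ c ∈ corePoles p q b u v, a * c ≠ 1) :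
    ∃ γ, Separates γ (corePoles p q b u v) := by
  set M : ℝ := 2 + ‖u‖ + ‖v‖ + ‖b‖ with hM
  have hu0 := norm_nonneg u
  have hv0 := norm_nonneg v
  have hb0 := norm_nonneg b
  obtain ⟨γ, hγ, -⟩ := exists_separates_corePoles hp hq hne (R := M + 1) (R' := M) (by linarith)
    (by linarith) (fun r => (norm_le_pi_norm u r).trans_lt (by linarith))
    (fun r => (norm_le_pi_norm v r).trans_lt (by linarith)) (by nlinarith)
  exact ⟨γ, hγ⟩

theorem paramDomain_subset_closure (hq0 : q ≠ 0) (hq : ‖q‖ < 1) :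
    paramDomain ⊆ closure {x ∈ paramDomain | ∃ γ, Separates γ (limPoles q τ x.1 x.2)} := by
  rintro ⟨b, t⟩ ⟨hb, ht⟩
  have hc := countable_corePoles_mul_eq_one (p := 0) (q := q) (B := fun x => (scaled b t x).1)
    (U := fun x => limParams q τ (scaled b t x).1 (scaled b t x).2) (V := fun _ => 0)
    (u := limParams q τ b t) (v := 0) (b := b)
    (e := fun r => if τ r = 1 then -3 else 1) (f := fun _ => 1) (fun r => by
      by_cases h : τ r = 1
      · simp [h]
      · simp [h]) (fun _ => Or.inl rfl)
    norm_scaled_fst (fun x r => by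
      by_cases h1 : τ r = 1
      · simp only [limParams, h1, one_ne_zero, if_true, if_false]
        exact norm_div_scaled q x r
      · by_cases h0 : τ r = 0
        · simp only [limParams, h0, zero_ne_one, if_true, if_false]
          exact norm_scaled_snd x r
        · simp only [limParams, h0, h1, if_false, norm_zero, mul_zero])
    (fun x r => by simp)
  refine mem_closure_of_scaled hc fun x hx => ⟨scaled_mem_paramDomain hb ht x, ?_⟩
  have hd := scaled_mem_paramDomain hb ht x
  rw [← corePoles_zero hq0 hd.1 hd.2]
  exact exists_separates_of_mul_ne_one (by simp) hq fun a ha c hc' h => hx ⟨a, ha, c, hc', h⟩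

/-- The parameters for which `ellE` is given directly by an integral. -/
def ellDomain (p q : ℂ) : Set (ℂ × (Fin 4 → ℂ)) :=
  {x : ℂ × (Fin 4 → ℂ) | x.1 ≠ 0 ∧ (∀ r, x.2 r ≠ 0) ∧ ellDenom x.1 x.2 p q ≠ 0 ∧
      ellParams x.1 x.2 p q ∈ ellGeneric 5 p q}

theorem mem_ellDomain_iff (hp : ‖p‖ < 1) (hq : ‖q‖ < 1) (hp0 : p ≠ 0) (hq0 : q ≠ 0)
    (hb : b ≠ 0) (ht : ∀ r, t r ≠ 0) : (b, t) ∈ ellDomain p q ↔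
      ∃ γ, Separates γ (corePoles p q b t fun r => p * q / (b * t r)) := by
  constructor
  · rintro ⟨-, -, -, h⟩
    exact (ellParams_mem_ellGeneric hp0 hq0 hb ht).1 h
  · rintro ⟨γ, hγ⟩
    exact ⟨hb, ht, ellDenom_ne_zero hp hq hp0 hq0 hb ht hγ,
      (ellParams_mem_ellGeneric hp0 hq0 hb ht).2 ⟨γ, hγ⟩⟩

theorem mem_closure_ellDomain (hp : ‖p‖ < 1) (hq : ‖q‖ < 1) (hp0 : p ≠ 0) (hq0 : q ≠ 0)
    (hb : b ≠ 0) (ht : ∀ r, t r ≠ 0) : (b, t) ∈ closure (ellDomain p q) := by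
  have hc := countable_corePoles_mul_eq_one (p := p) (q := q) (B := fun x => (scaled b t x).1)
    (U := fun x => (scaled b t x).2)
    (V := fun x r => p * q / ((scaled b t x).1 * (scaled b t x).2 r))
    (u := t) (v := fun r => p * q / (b * t r)) (b := b) (e := fun _ => 1) (f := fun _ => -3)
    (fun _ => Or.inl rfl) (fun _ => Or.inr rfl) norm_scaled_fst norm_scaled_snd
    (fun x r => norm_div_scaled _ x r)
  refine mem_closure_of_scaled hc fun x hx => ?_
  have hd := scaled_mem_paramDomain hb ht x
  refine (mem_ellDomain_iff hp hq hp0 hq0 hd.1 hd.2).2 ?_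
  exact exists_separates_of_mul_ne_one hp hq fun a ha c hc' h => hx ⟨a, ha, c, hc', h⟩

end Density

/-! ### The limit p → 0 -/

section Degeneration

variable {p q b : ℂ} {τ : Fin 4 → ℝ} {t : Fin 4 → ℂ}

theorem continued_eq_of_continuousAt {X : Type*} [TopologicalSpace X] {S : Set X} {f g : X → ℂ} {x : X}
    (hx : x ∈ closure S) (hg : ContinuousAt g x) (hfg : ∀ᶠ y in 𝓝 x, y ∈ S → f y = g y) :
    continued S f x = g x := by
  rw [continued]
  split_ifs with h
  · exact hfg.self_of_nhds h
  · have : (𝓝[S] x).NeBot := mem_closure_iff_nhdsWithin_neBot.1 hx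
    refine Tendsto.limUnder_eq ((hg.tendsto.mono_left nhdsWithin_le_nhds).congr' ?_)
    exact eventually_nhdsWithin_iff.2 (hfg.mono fun y hy hyS => (hy hyS).symm)

theorem isOpen_paramDomain : IsOpen paramDomain := by
  have h : paramDomain = {x : ℂ × (Fin 4 → ℂ) | x.1 ≠ 0} ∩ ⋂ r, {x | x.2 r ≠ 0} := by
    ext x
    simp [paramDomain]
  rw [h]
  exact (isOpen_ne_fun continuous_fst continuous_const).inter (isOpen_iInter_of_finite fun r =>
    isOpen_ne_fun (by fun_prop) continuous_const)

theorem differentiableOn_div_param (c : ℂ) (r : Fin 4) :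
    DifferentiableOn ℂ (fun x : ℂ × (Fin 4 → ℂ) => c / (x.1 * x.2 r)) paramDomain := by
  have h : DifferentiableOn ℂ (fun x : ℂ × (Fin 4 → ℂ) => (x.1 * x.2 r)⁻¹) paramDomain :=
    DifferentiableOn.fun_inv (by fun_prop) fun x hx => mul_ne_zero hx.1 (hx.2 r)
  simpa only [div_eq_mul_inv] using h.const_mul c

theorem differentiableOn_limParams :
    DifferentiableOn ℂ (fun x : ℂ × (Fin 4 → ℂ) => limParams q τ x.1 x.2) paramDomain := by
  refine differentiableOn_pi.2 fun r => ?_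
  unfold limParams
  split_ifs
  · fun_prop
  · exact differentiableOn_div_param q r
  · fun_prop

theorem limValue_congr_contour (hq0 : q ≠ 0) (hq : ‖q‖ < 1) (hb : b ≠ 0) (ht : ∀ r, t r ≠ 0)
    {γ₁ γ₂ : ℝ → ℂ} (h₁ : Separates γ₁ (limPoles q τ b t)) (h₂ : Separates γ₂ (limPoles q τ b t)) :
    limValue q τ γ₁ b t = limValue q τ γ₂ b t := by
  rw [limValue_eq hq hb h₁, limValue_eq hq hb h₂]
  rw [← corePoles_zero hq0 hb ht] at h₁ h₂
  rw [cInt_ellCore_eq (by simp) hq h₁ h₂]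

/-- `Ψ` is the continuation in `(b,u,v,p)` of the elliptic hypergeometric integral to `Ω`. -/
def IsCoreExtension (q : ℂ) (Ω : Set (ℂ × (Fin 4 → ℂ) × (Fin 4 → ℂ) × ℂ))
    (Ψ : ℂ × (Fin 4 → ℂ) × (Fin 4 → ℂ) × ℂ → ℂ) : Prop :=
  IsOpen Ω ∧ DifferentiableOn ℂ Ψ Ω ∧ ∀ b u v p, (b, u, v, p) ∈ Ω → ‖p‖ < 1 ∧
    ∀ γ, Separates γ (corePoles p q b u v) → Ψ (b, u, v, p) =
      corePref p q b u v * (qPoch p p * qPoch q q / 2) * cInt γ (ellCore p q b u v)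

variable {Ω : Set (ℂ × (Fin 4 → ℂ) × (Fin 4 → ℂ) × ℂ)}
  {Ψ : ℂ × (Fin 4 → ℂ) × (Fin 4 → ℂ) × ℂ → ℂ}

theorem IsCoreExtension.limValue_eq (h : IsCoreExtension q Ω Ψ) (hq0 : q ≠ 0) (hq : ‖q‖ < 1)
    (hb : b ≠ 0) (ht : ∀ r, t r ≠ 0) (hmem : (b, limParams q τ b t, 0, 0) ∈ Ω) {γ : ℝ → ℂ}
    (hγ : Separates γ (limPoles q τ b t)) : Ψ (b, limParams q τ b t, 0, 0) = limValue q τ γ b t := by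
  rw [_root_.limValue_eq hq hb hγ]
  rw [← corePoles_zero hq0 hb ht] at hγ
  exact (h.2.2 _ _ _ _ hmem).2 γ hγ

theorem IsCoreExtension.local_limit (h : IsCoreExtension q Ω Ψ) {x₀ : ℂ × (Fin 4 → ℂ)}
    (hx₀ : x₀ ∈ paramDomain) (hmem : (x₀.1, limParams q τ x₀.1 x₀.2, 0, 0) ∈ Ω) :
    ∃ U ∈ 𝓝 x₀, U ⊆ paramDomain ∧ (∀ x ∈ U, (x.1, limParams q τ x.1 x.2, 0, 0) ∈ Ω) ∧
      DifferentiableOn ℂ (fun x : ℂ × (Fin 4 → ℂ) => Ψ (x.1, limParams q τ x.1 x.2, 0, 0)) U := by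
  have hd : DifferentiableOn ℂ (fun x : ℂ × (Fin 4 → ℂ) =>
      (x.1, limParams q τ x.1 x.2, (0 : Fin 4 → ℂ), (0 : ℂ))) paramDomain :=
    differentiableOn_fst.prodMk (differentiableOn_limParams.prodMk (differentiableOn_const _))
  have ho := hd.continuousOn.isOpen_inter_preimage isOpen_paramDomain h.1
  refine ⟨_, ho.mem_nhds ⟨hx₀, hmem⟩, inter_subset_left, fun x hx => hx.2, ?_⟩
  exact h.2.1.comp (hd.mono inter_subset_left) fun x hx => hx.2

/-- The parameters `t_r` for `r ∉ I` and `pq/(b t_r)` for `r ∈ I`, the remaining ones, and `p`. -/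
noncomputable def ellPoint (I : Finset (Fin 4)) (p q : ℂ) (x : ℂ × (Fin 4 → ℂ)) :
    ℂ × (Fin 4 → ℂ) × (Fin 4 → ℂ) × ℂ :=
  (x.1, exchange I x.2 (fun r => p * q / (x.1 * x.2 r)),
    exchange I (fun r => p * q / (x.1 * x.2 r)) x.2, p)

theorem continuousOn_ellPoint (I : Finset (Fin 4)) : ContinuousOn (ellPoint I p q) paramDomain := by
  have hV : ∀ r, ContinuousOn (fun x : ℂ × (Fin 4 → ℂ) => p * q / (x.1 * x.2 r)) paramDomain :=
    fun r => (differentiableOn_div_param _ r).continuousOn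
  have hT : ∀ r, ContinuousOn (fun x : ℂ × (Fin 4 → ℂ) => x.2 r) paramDomain := fun r => by fun_prop
  refine continuousOn_fst.prodMk (ContinuousOn.prodMk (continuousOn_pi.2 fun r => ?_)
    (ContinuousOn.prodMk (continuousOn_pi.2 fun r => ?_) continuousOn_const)) <;>
  · by_cases hr : r ∈ I
    · simp only [exchange, if_pos hr]
      first | exact hV r | exact hT r
    · simp only [exchange, if_neg hr]
      first | exact hV r | exact hT r

/-- Near (b,t) the function Ψ composed with `ellPoint` is continuous and agrees with the integral on
`ellDomain`, which accumulates at (b,t). So its value there is the one defining `ellE`, pinched or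
not. -/
theorem IsCoreExtension.ellE_eq (h : IsCoreExtension q Ω Ψ) (hq0 : q ≠ 0) (hq : ‖q‖ < 1)
    (hp0 : p ≠ 0) (hb : b ≠ 0) (ht : ∀ r, t r ≠ 0) {I : Finset (Fin 4)}
    (hmem : ellPoint I p q (b, t) ∈ Ω) : ellE b t p q = Ψ (ellPoint I p q (b, t)) := by
  have hp : ‖p‖ < 1 := (h.2.2 _ _ _ _ hmem).1
  have hD : paramDomain ∈ 𝓝 (b, t) := isOpen_paramDomain.mem_nhds ⟨hb, ht⟩
  have hc : ContinuousAt (ellPoint I p q) (b, t) := (continuousOn_ellPoint I).continuousAt hD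
  refine continued_eq_of_continuousAt (g := fun x => Ψ (ellPoint I p q x))
    (mem_closure_ellDomain hp hq hp0 hq0 hb ht)
    (((h.2.1.continuousOn).continuousAt (h.1.mem_nhds hmem)).comp hc) ?_
  filter_upwards [hD, hc.preimage_mem_nhds (h.1.mem_nhds hmem)] with x hx hxΩ hxS
  obtain ⟨γ, hγ⟩ := (mem_ellDomain_iff hp hq hp0 hq0 hx.1 hx.2).1 hxS
  rw [ellBeta_div_ellDenom hp hq hp0 hq0 hx.1 hx.2 hγ]
  rw [← corePoles_exchange I] at hγ
  rw [← corePref_exchange I, ← ellCore_exchange I]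
  exact ((h.2.2 _ _ _ _ hxΩ).2 γ hγ).symm

theorem tendsto_cpow_nhds_zero {s : ℝ} (hs : 0 < s) :
    Tendsto (fun p : ℂ => p ^ (s : ℂ)) (𝓝[≠] 0) (𝓝 0) := by
  have h := Complex.continuousAt_cpow_const_of_re_pos (z := 0) (w := (s : ℂ)) (Or.inl le_rfl)
    (by simpa using hs)
  have h2 := h.tendsto
  rw [Complex.zero_cpow (by exact_mod_cast hs.ne')] at h2
  exact h2.mono_left nhdsWithin_le_nhds

theorem tendsto_mul_cpow {s : ℝ} (hs : 0 ≤ s) (c : ℂ) :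
    Tendsto (fun p : ℂ => c * p ^ (s : ℂ)) (𝓝[≠] 0) (𝓝 (if s = 0 then c else 0)) := by
  split_ifs with h
  · simp [h]
  · simpa using (tendsto_cpow_nhds_zero (lt_of_le_of_ne hs (Ne.symm h))).const_mul c

theorem tendsto_div_mul_cpow {s : ℝ} (hs : s ≤ 1) (c d : ℂ) :
    Tendsto (fun p : ℂ => p * c / (d * p ^ (s : ℂ))) (𝓝[≠] 0) (𝓝 (if s = 1 then c / d else 0)) := by
  have h := tendsto_mul_cpow (sub_nonneg.2 hs) (c / d)
  simp only [sub_eq_zero, eq_comm (a := (1 : ℝ))] at h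
  refine h.congr' ?_
  filter_upwards [self_mem_nhdsWithin] with p hp
  have hp0 : p ≠ 0 := hp
  push_cast
  rw [Complex.cpow_sub _ _ hp0, Complex.cpow_one]
  ring

/-- t p^τ survives only for τ = 0, and pq/(b t p^τ) = (q/(bt)) p^{1-τ} only for τ = 1. The exchange
at τ = 1 puts every surviving parameter among the u_r. -/
theorem tendsto_ellPoint (hτ : ∀ r, 0 ≤ τ r ∧ τ r ≤ 1) :
    Tendsto (fun p : ℂ => ellPoint {r | τ r = 1} p q (b, fun r => t r * p ^ (τ r : ℂ))) (𝓝[≠] 0)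
      (𝓝 (b, limParams q τ b t, 0, 0)) := by
  have hT := fun r => tendsto_mul_cpow (hτ r).1 (t r)
  have hV := fun r => tendsto_div_mul_cpow (hτ r).2 q (b * t r)
  refine tendsto_const_nhds.prodMk_nhds (Tendsto.prodMk_nhds (tendsto_pi_nhds.2 fun r => ?_)
    (Tendsto.prodMk_nhds (tendsto_pi_nhds.2 fun r => ?_)
      (tendsto_id.mono_left nhdsWithin_le_nhds)))
  · by_cases h1 : τ r = 1
    · have := hV r
      rw [if_pos h1] at this
      simpa [exchange, limParams, h1, mul_assoc] using this
    · have := hT r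
      simpa [exchange, limParams, h1] using this
  · by_cases h1 : τ r = 1
    · have := hT r
      simpa [exchange, h1] using this
    · have := hV r
      rw [if_neg h1] at this
      simpa [exchange, h1, mul_assoc] using this

end Degeneration

/-! ### The degeneration theorem -/

theorem mainTheorem8 (q : ℂ) (hq0 : q ≠ 0) (hq1 : ‖q‖ < 1)
    (τ : Fin 4 → ℝ) (hτ : ∀ r, 0 ≤ τ r ∧ τ r ≤ 1) :
    ∃ F : ℂ × (Fin 4 → ℂ) → ℂ,
      DifferentiableOn ℂ F paramDomain ∧
      paramDomain ⊆ closure {x ∈ paramDomain | ∃ γ, Separates γ (limPoles q τ x.1 x.2)} ∧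
      (∀ (b : ℂ) (t : Fin 4 → ℂ), (b, t) ∈ paramDomain →
        ∀ γ : ℝ → ℂ, Separates γ (limPoles q τ b t) → F (b, t) = limValue q τ γ b t) ∧
      (∀ (b : ℂ) (t : Fin 4 → ℂ), (b, t) ∈ paramDomain →
        Tendsto (fun p : ℂ => ellE b (fun r => t r * p ^ (τ r : ℂ)) p q) (𝓝[≠] 0)
          (𝓝 (F (b, t)))) := by
  have hdense := paramDomain_subset_closure (τ := τ) hq0 hq1
  set S := {x ∈ paramDomain | ∃ γ, Separates γ (limPoles q τ x.1 x.2)} with hS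
  have hext : ∀ x ∈ paramDomain, ∃ Ω Ψ, (x.1, limParams q τ x.1 x.2, 0, 0) ∈ Ω ∧
      IsCoreExtension q Ω Ψ := by
    intro x hx
    obtain ⟨Ω, Ψ, h1, h2, h3, h4⟩ := exists_core_extension hq0 hq1 hx.1 (limParams q τ x.1 x.2)
    exact ⟨Ω, Ψ, h2, h1, h3, h4⟩
  -- The limiting expression does not depend on the contour, so it defines a function of (b,t) on
  -- `S`; the value 0 elsewhere is arbitrary.
  have hI : ∀ x : ℂ × (Fin 4 → ℂ), ∃ y, x ∈ paramDomain → ∀ γ,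
      Separates γ (limPoles q τ x.1 x.2) → limValue q τ γ x.1 x.2 = y := by
    intro x
    by_cases h : x ∈ S
    · obtain ⟨hx, γ₀, hγ₀⟩ := h
      exact ⟨_, fun _ γ hγ => limValue_congr_contour hq0 hq1 hx.1 hx.2 hγ hγ₀⟩
    · exact ⟨0, fun hx γ hγ => absurd ⟨hx, γ, hγ⟩ h⟩
  choose J hJ using hI
  obtain ⟨F, hF, hFJ⟩ := exists_glue isOpen_paramDomain (sep_subset _ _ : S ⊆ paramDomain) hdense
    (I := J) (by
      intro x₀ hx₀
      obtain ⟨Ω, Ψ, hmem, h⟩ := hext x₀ hx₀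
      obtain ⟨U, hU, -, hUΩ, hUd⟩ := h.local_limit hx₀ hmem
      refine ⟨U, hU, _, hUd, ?_⟩
      rintro x ⟨⟨hx, γ, hγ⟩, hxU⟩
      rw [← hJ x hx γ hγ]
      exact h.limValue_eq hq0 hq1 hx.1 hx.2 (hUΩ x hxU) hγ)
  refine ⟨F, hF, hdense, ?_, ?_⟩
  · intro b t hbt γ hγ
    rw [hFJ (b, t) ⟨hbt, γ, hγ⟩]
    exact (hJ (b, t) hbt γ hγ).symm
  · intro b t hbt
    obtain ⟨Ω, Ψ, hmem, h⟩ := hext (b, t) hbt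
    obtain ⟨U, hU, -, hUΩ, hUd⟩ := h.local_limit hbt hmem
    -- Both sides are continuous in (b,t) and equal `limValue` on `S`, which accumulates at every
    -- point of the domain.
    have hFΨ : F (b, t) = Ψ (b, limParams q τ b t, 0, 0) := by
      have : (𝓝[S] (b, t)).NeBot := mem_closure_iff_nhdsWithin_neBot.1 (hdense hbt)
      have h1 : Tendsto F (𝓝[S] (b, t)) (𝓝 (F (b, t))) :=
        (hF.continuousOn.continuousAt (isOpen_paramDomain.mem_nhds hbt)).tendsto.mono_left
          nhdsWithin_le_nhds
      have h2 : Tendsto (fun x : ℂ × (Fin 4 → ℂ) => Ψ (x.1, limParams q τ x.1 x.2, 0, 0))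
          (𝓝[S] (b, t)) (𝓝 (Ψ (b, limParams q τ b t, 0, 0))) :=
        (hUd.continuousOn.continuousAt hU).tendsto.mono_left nhdsWithin_le_nhds
      refine tendsto_nhds_unique h1 (h2.congr' ?_)
      filter_upwards [self_mem_nhdsWithin, nhdsWithin_le_nhds hU] with x hxS hxU
      obtain ⟨hx, γ, hγ⟩ := hxS
      rw [hFJ x ⟨hx, γ, hγ⟩, ← hJ x hx γ hγ]
      exact h.limValue_eq hq0 hq1 hx.1 hx.2 (hUΩ x hxU) hγ
    rw [hFΨ]
    have hlim := tendsto_ellPoint (q := q) (b := b) (t := t) hτ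
    have hΩ := h.1.mem_nhds hmem
    -- Continuity of Ψ suffices; the path p ↦ p^{τ_r} need not be holomorphic or even continuous
    -- away from 0.
    refine ((h.2.1.continuousOn.continuousAt hΩ).tendsto.comp hlim).congr' ?_
    filter_upwards [hlim.eventually hΩ, self_mem_nhdsWithin] with p hpΩ hp0
    exact (h.ellE_eq hq0 hq1 hp0 hbt.1 (fun r => mul_ne_zero (hbt.2 r)
      (by rw [Ne, Complex.cpow_eq_zero_iff]; exact fun h' => hp0 h'.1)) hpΩ).symm
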